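/- \textbf{Setting.} Let $\Omega$ be a separable Banach space with a centred Gaussian measure $\mathbf P$ whose Cameron--Martin space is $\mathcal H=L^2(\mathbb R,H_0)\subset\Omega$ for some real Hilbert space $H_0$. For $h\in\mathcal H$ let $h^*$ be the associated measurable linear functional on $\Omega$ (defined up to $\mathbf P$-null sets), and let $\mathcal F_t$ be the ($\mathbf P$-completed) $\sigma$-algebra generated by all $h^*$ with $h\in L^2((-\infty,t],H_0)$. Let $\mathcal M$ be a complete separable metric space and $\boldsymbol\xi:\Omega\to\mathcal M$ a random variable. Let $U$ be a separable Banach space and let $\overline U=U\cup\{\dagger\}$ be $U$ with an additional isolated point $\dagger$. Let $\Phi_{s,t}:\overline U\times\mathcal M\to\overline U$, $0\le s\le t\le1$, satisfy $\Phi_{t,r}(\Phi_{s,t}(u,\xi),\xi)=\Phi_{s,r}(u,\xi)$ for all $0\le s\le t\le r\le1$ and $(u,\xi)\in\overline U\times\mathcal M$, and $\Phi_{s,t}(\dagger,\xi)=\dagger$. Write $\Phi_t=\Phi_{0,t}$, $\Phi=\Phi_{0,1}$ and $\mathcal N_t=\{(u,\xi)\in U\times\mathcal M:\Phi_t(u,\xi)\ne\dagger\}$.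 "Locally Lipschitz" means Lipschitz on a neighbourhood of each point of the domain. Assume the following. (1) The set of all $(s,t,u,\xi)$ with $0\le s\le t\le 1$ and $\Phi_{s,t}(u,\xi)\in U$ is (relatively) open, and on it $(s,t,u,\xi)\mapsto\Phi_{s,t}(u,\xi)$ is jointly continuous and Fréchet differentiable in $u$; $D\Phi_t$ denotes the derivative of $\Phi_t$ in $u$. (2) There is a lower semicontinuous map $r:[0,1]\times U\times\mathcal M\to[0,\infty]$ such that: $\omega\mapsto r_t(u,\boldsymbol\xi(\omega))$ is $\mathcal F_t$-measurable for all $u\in U$, $t\in[0,1]$; $r_0(u,\xi)<\infty$ and $t\mapsto r_t(u,\xi)$ is continuous and nondecreasing for all $(u,\xi)$; for $t\in[0,1]$ and $(u,\xi)\in U\times\mathcal M$ one has $\Phi_t(u,\xi)=\dagger$ if and only if $r_t(u,\xi)=\infty$; and $r_t$ is locally Lipschitz on $\mathcal N_t$ for $t\in(0,1]$. (3) Let $p\in(2,\infty)$ and let $X_0$ be a separable Banach space continuously embedded in $H_0$. Set $E=L^p([0,1],X_0)\subset\mathcal H$ (extension by $0$) and, for $s\in[0,1]$, let $E_s=L^p([0,s],X_0)\subset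 E$ be the subspace of elements vanishing on $(s,1]$. There is a continuous action $\tau:E\times\mathcal M\to\mathcal M$ of the additive group $E$ such that $h\mapsto\tau(h,\xi)$ is locally Lipschitz for every $\xi$; for every $h\in E$, $\boldsymbol\xi(\omega+h)=\tau(h,\boldsymbol\xi(\omega))$ for $\mathbf P$-almost every $\omega$; and, for $0\le s\le t\le 1$, $\Phi_{s,t}(u,\tau(h,\xi))=\Phi_{s,t}(u,\xi)$ for all $u\in\overline U$, $\xi\in\mathcal M$ and all $h\in E$ with $h=0$ on $[s,t]$. (4) For every $t\in[0,1]$ and $(u,\xi)\in\mathcal N_t$, the map $E\ni h\mapsto\Phi_t(u,\tau(h,\xi))$ is Fréchet differentiable at $h=0$, with derivative denoted by $\mathcal D\Phi_t(u,\xi)$. (5) For all $0\le s\le t$ with $t\in(0,1]$ there are maps $A_t^{(s)}:\mathcal N_s\to L(U,E_s)$ (bounded linear operators) such that: $(A_t^{(r)}(u,\xi)v)|_{[0,s]}=A_t^{(s)}(u,\xi)v$ for $0<s<r\le t$, $(u,\xi)\in\mathcal N_r$, $v\in U$; for every $u\in U$ the map $\omega\mapsto A_t^{(s)}(u,\boldsymbol\xi(\omega))$,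 defined where $(u,\boldsymbol\xi(\omega))\in\mathcal N_s$, is $\mathcal F_s$-measurable; $D\Phi_t(u,\xi)v+\mathcal D\Phi_t(u,\xi)(A_t^{(t)}(u,\xi)v)=0$ for all $t\in(0,1]$, $(u,\xi)\in\mathcal N_t$, $v\in U$; and, for $0<s\le t\le1$, $A_t^{(s)}$ is locally Lipschitz on $\mathcal N_s$ and bounded on $\{(u,\xi):r_s(u,\xi)\le R\}$ for every $R>0$. For bounded measurable $\Psi:\overline U\to\mathbb R$ let $\mathfrak P\Psi(u)=\mathbf E\,\Psi(\Phi(u,\boldsymbol\xi))$. A probability measure $\mu$ on $\overline U$ is invariant for $\mathfrak P$ if $\int\mathfrak P\Psi\,d\mu=\int\Psi\,d\mu$ for all bounded measurable $\Psi$. \textbf{Corollary.} In this setting, suppose that for every nonempty open set $A\subset U$ and every $u\in U$, $$\mathbf P\bigl(\{\omega:\Phi(u,\boldsymbol\xi(\omega))\in A\}\bigr)>0 .$$ Then $\mathfrak P$ admits at most one invariant probability measure $\mu$ with $\mu(U)=1$. -/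

import Mathlib

open MeasureTheory ProbabilityTheory Set Filter Topology
open scoped ENNReal

noncomputable section

namespace RandomDynamics

/-! ### The Gaussian probability space and its filtration -/

/-- The Hilbert space `L²(ℝ, H₀)`. -/
abbrev NoiseSpace (H₀ : Type*) [NormedAddCommGroup H₀] : Type _ :=
  Lp H₀ 2 (volume : Measure ℝ)

/-- `P` is centred, and its Cameron-Martin space is `L²(ℝ, H₀)`, included in `Ω` through `ι`.
The Cameron-Martin norm of `ω ∈ Ω` is `sup {ℓ(ω) : ℓ ∈ Ω*, ∫ ℓ² dP ≤ 1}`, and the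
Cameron-Martin space consists of the `ω` for which it is finite. -/
structure IsCameronMartin {Ω H₀ : Type*} [NormedAddCommGroup Ω] [NormedSpace ℝ Ω]
    [MeasurableSpace Ω] [NormedAddCommGroup H₀] [InnerProductSpace ℝ H₀]
    (P : Measure Ω) (ι : NoiseSpace H₀ →L[ℝ] Ω) : Prop where
  centered : ∀ ℓ : StrongDual ℝ Ω, ∫ ω, ℓ ω ∂P = 0
  mem_range_iff : ∀ ω : Ω, ω ∈ range ι ↔
    BddAbove {a : ℝ | ∃ ℓ : StrongDual ℝ Ω, ∫ ω', (ℓ ω') ^ 2 ∂P ≤ 1 ∧ a = ℓ ω}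
  norm_eq : ∀ h : NoiseSpace H₀,
    IsLUB {a : ℝ | ∃ ℓ : StrongDual ℝ Ω, ∫ ω', (ℓ ω') ^ 2 ∂P ≤ 1 ∧ a = ℓ (ι h)} ‖h‖

/-- `f` is a version of the measurable linear functional `h*` on `Ω` that corresponds to the
Cameron-Martin vector `h`: it is in the `L²(P)`-closure of the dual of `Ω`, and its covariance
with any `ℓ` in the dual is `ℓ(h)`. This determines `f` up to `P`-null sets. -/
structure IsMeasurableFunctional {Ω H₀ : Type*} [NormedAddCommGroup Ω] [NormedSpace ℝ Ω]
    [MeasurableSpace Ω] [NormedAddCommGroup H₀] [InnerProductSpace ℝ H₀]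
    (P : Measure Ω) (ι : NoiseSpace H₀ →L[ℝ] Ω) (h : NoiseSpace H₀) (f : Ω → ℝ) : Prop where
  aemeasurable : AEMeasurable f P
  mem_closure : ∃ ℓ : ℕ → StrongDual ℝ Ω,
    Tendsto (fun n => eLpNorm (fun ω => ℓ n ω - f ω) 2 P) atTop (𝓝 0)
  covariance : ∀ ℓ : StrongDual ℝ Ω, ∫ ω, f ω * ℓ ω ∂P = ℓ (ι h)

/-- The σ-algebra `𝓕_t` generated by all versions of the `h*` with `h ∈ L²((-∞, t], H₀)`.
As all versions are used, it contains the `P`-null sets. -/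
@[reducible]
def pastSigmaAlgebra {Ω H₀ : Type*} [NormedAddCommGroup Ω] [NormedSpace ℝ Ω]
    [MeasurableSpace Ω] [NormedAddCommGroup H₀] [InnerProductSpace ℝ H₀]
    (P : Measure Ω) (ι : NoiseSpace H₀ →L[ℝ] Ω) (t : ℝ) : MeasurableSpace Ω :=
  MeasurableSpace.generateFrom
    {S : Set Ω | ∃ (h : NoiseSpace H₀) (f : Ω → ℝ) (B : Set ℝ),
      (∀ᵐ x : ℝ, t < x → h x = 0) ∧ IsMeasurableFunctional P ι h f ∧
      MeasurableSet B ∧ S = f ⁻¹' B}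

/-! ### Admissible shifts of the noise -/

/-- The space of shifts `E = L^p([0,1], X₀)`. -/
abbrev ShiftSpace (X₀ : Type*) [NormedAddCommGroup X₀] (p : ℝ≥0∞) : Type _ :=
  Lp X₀ p (volume.restrict (Icc (0 : ℝ) 1))

/-- `h = 0` almost everywhere on `[s, t]`. -/
def VanishesOn {X₀ : Type*} [NormedAddCommGroup X₀] {p : ℝ≥0∞} (h : ShiftSpace X₀ p)
    (s t : ℝ) : Prop :=
  ∀ᵐ x ∂(volume.restrict (Icc (0 : ℝ) 1)), x ∈ Icc s t → h x = 0

theorem memLp_extend {X₀ H₀ : Type*} [NormedAddCommGroup X₀] [NormedSpace ℝ X₀]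
    [NormedAddCommGroup H₀] [InnerProductSpace ℝ H₀] {p : ℝ≥0∞} (hp : 2 < p)
    (j : X₀ →L[ℝ] H₀) (h : ShiftSpace X₀ p) :
    MemLp ((Icc (0 : ℝ) 1).indicator (fun x => j (h x))) 2 (volume : Measure ℝ) := by
  rw [memLp_indicator_iff_restrict measurableSet_Icc]
  exact (j.comp_memLp' (Lp.memLp h)).mono_exponent hp.le

/-- The inclusion `L^p([0,1], X₀) ⊂ L²(ℝ, H₀)` induced by `j : X₀ → H₀` and extension by `0`. -/
def shiftToNoise {X₀ H₀ : Type*} [NormedAddCommGroup X₀] [NormedSpace ℝ X₀]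
    [NormedAddCommGroup H₀] [InnerProductSpace ℝ H₀] {p : ℝ≥0∞} (hp : 2 < p)
    (j : X₀ →L[ℝ] H₀) (h : ShiftSpace X₀ p) : NoiseSpace H₀ :=
  (memLp_extend hp j h).toLp _

/-! ### The dynamics

The state space `U` with an additional isolated death state is `U ⊕ Unit`, with `Sum.inr ()`
as the death state. -/

/-- The value in `U` of a state that is not the death state (and `0` at the death state). -/
def toU {U : Type*} [Zero U] : U ⊕ Unit → U := Sum.elim id (fun _ => 0)

/-- The pairs of times `0 ≤ s ≤ t ≤ 1`. -/
abbrev TimePair : Type := {q : ℝ × ℝ // 0 ≤ q.1 ∧ q.1 ≤ q.2 ∧ q.2 ≤ 1}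

/-- The set `𝒩_t` of the `(u, ξ)` for which there is no blow-up up to time `t`. -/
def survival {U M : Type*} (Φ : ℝ → ℝ → U ⊕ Unit → M → U ⊕ Unit) (t : ℝ) : Set (U × M) :=
  {x | Φ 0 t (Sum.inl x.1) x.2 ≠ Sum.inr ()}

/-- The maps `Φ_{s,t}`, `0 ≤ s ≤ t ≤ 1`, are consistent and fix the death state. -/
structure IsConsistent {U M : Type*} (Φ : ℝ → ℝ → U ⊕ Unit → M → U ⊕ Unit) : Prop where
  comp : ∀ s t r : ℝ, 0 ≤ s → s ≤ t → t ≤ r → r ≤ 1 → ∀ (u : U ⊕ Unit) (ξ : M),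
    Φ t r (Φ s t u ξ) ξ = Φ s r u ξ
  death : ∀ s t : ℝ, 0 ≤ s → s ≤ t → t ≤ 1 → ∀ ξ : M, Φ s t (Sum.inr ()) ξ = Sum.inr ()

/-- The set `Φ⁻¹(U)` in the space of all `(s, t, u, ξ)` with `0 ≤ s ≤ t ≤ 1`. -/
def aliveSet {U M : Type*} (Φ : ℝ → ℝ → U ⊕ Unit → M → U ⊕ Unit) :
    Set (TimePair × (U ⊕ Unit) × M) :=
  {x | Φ x.1.1.1 x.1.1.2 x.2.1 x.2.2 ≠ Sum.inr ()}

/-- `Φ⁻¹(U)` is open, and `Φ` is continuous and Fréchet differentiable in `u` there. -/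
structure IsRegularFlow {U M : Type*} [NormedAddCommGroup U] [NormedSpace ℝ U]
    [MetricSpace M] (Φ : ℝ → ℝ → U ⊕ Unit → M → U ⊕ Unit) : Prop where
  isOpen_alive : IsOpen (aliveSet Φ)
  continuousOn : ContinuousOn
    (fun x : TimePair × (U ⊕ Unit) × M => Φ x.1.1.1 x.1.1.2 x.2.1 x.2.2) (aliveSet Φ)
  differentiable : ∀ s t : ℝ, 0 ≤ s → s ≤ t → t ≤ 1 → ∀ (u : U) (ξ : M),
    Φ s t (Sum.inl u) ξ ≠ Sum.inr () →
      DifferentiableAt ℝ (fun u' : U => toU (Φ s t (Sum.inl u') ξ)) u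

/-- The map `r : [0,1] × U × M → [0,∞]` measures the distance to blow-up. -/
structure IsBlowUpGauge {Ω H₀ U M : Type*} [NormedAddCommGroup Ω] [NormedSpace ℝ Ω]
    [MeasurableSpace Ω] [NormedAddCommGroup H₀] [InnerProductSpace ℝ H₀]
    [NormedAddCommGroup U] [NormedSpace ℝ U] [MetricSpace M]
    (P : Measure Ω) (ι : NoiseSpace H₀ →L[ℝ] Ω) (ξξ : Ω → M)
    (Φ : ℝ → ℝ → U ⊕ Unit → M → U ⊕ Unit) (r : ℝ → U → M → ℝ≥0∞) : Prop where
  lowerSemicontinuous : LowerSemicontinuousOn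
    (fun x : ℝ × U × M => r x.1 x.2.1 x.2.2) (Icc 0 1 ×ˢ univ)
  measurable : ∀ u : U, ∀ t ∈ Icc (0 : ℝ) 1,
    Measurable[pastSigmaAlgebra P ι t] (fun ω => r t u (ξξ ω))
  zero_lt_top : ∀ (u : U) (ξ : M), r 0 u ξ < ∞
  continuousOn_time : ∀ (u : U) (ξ : M), ContinuousOn (fun t => r t u ξ) (Icc 0 1)
  monotoneOn_time : ∀ (u : U) (ξ : M), MonotoneOn (fun t => r t u ξ) (Icc 0 1)
  eq_top_iff : ∀ t ∈ Icc (0 : ℝ) 1, ∀ (u : U) (ξ : M),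
    Φ 0 t (Sum.inl u) ξ = Sum.inr () ↔ r t u ξ = ∞
  locallyLipschitz : ∀ t ∈ Ioc (0 : ℝ) 1,
    LocallyLipschitzOn (survival Φ t) (fun x => (r t x.1 x.2).toReal)

/-- `τ` is a continuous action of the space of shifts on `M` that realises shifts of the noise
and is compatible with the dynamics. -/
structure IsShiftAction {Ω H₀ X₀ U M : Type*} [NormedAddCommGroup Ω] [NormedSpace ℝ Ω]
    [MeasurableSpace Ω] [NormedAddCommGroup H₀] [InnerProductSpace ℝ H₀]
    [NormedAddCommGroup X₀] [NormedSpace ℝ X₀] [MetricSpace M]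
    {p : ℝ≥0∞} [Fact (1 ≤ p)] (hp : 2 < p)
    (P : Measure Ω) (ι : NoiseSpace H₀ →L[ℝ] Ω) (j : X₀ →L[ℝ] H₀) (ξξ : Ω → M)
    (Φ : ℝ → ℝ → U ⊕ Unit → M → U ⊕ Unit) (τ : ShiftSpace X₀ p → M → M) : Prop where
  zero : ∀ ξ : M, τ 0 ξ = ξ
  add : ∀ (h k : ShiftSpace X₀ p) (ξ : M), τ (h + k) ξ = τ h (τ k ξ)
  continuous : Continuous (fun x : ShiftSpace X₀ p × M => τ x.1 x.2)
  locallyLipschitz : ∀ ξ : M, LocallyLipschitz (fun h => τ h ξ)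
  shift : ∀ h : ShiftSpace X₀ p,
    ∀ᵐ ω ∂P, ξξ (ω + ι (shiftToNoise hp j h)) = τ h (ξξ ω)
  dependency : ∀ s t : ℝ, 0 ≤ s → s ≤ t → t ≤ 1 → ∀ h : ShiftSpace X₀ p, VanishesOn h s t →
    ∀ (u : U ⊕ Unit) (ξ : M), Φ s t u (τ h ξ) = Φ s t u ξ

/-- For `(u, ξ) ∈ 𝒩_t`, the map `h ↦ Φ_t(u, τ(h, ξ))` is Fréchet differentiable at `0`. -/
def IsShiftDifferentiable {X₀ U M : Type*} [NormedAddCommGroup X₀] [NormedSpace ℝ X₀]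
    [NormedAddCommGroup U] [NormedSpace ℝ U] {p : ℝ≥0∞} [Fact (1 ≤ p)]
    (Φ : ℝ → ℝ → U ⊕ Unit → M → U ⊕ Unit) (τ : ShiftSpace X₀ p → M → M) : Prop :=
  ∀ t ∈ Icc (0 : ℝ) 1, ∀ (u : U) (ξ : M), (u, ξ) ∈ survival Φ t →
    DifferentiableAt ℝ (fun h : ShiftSpace X₀ p => toU (Φ 0 t (Sum.inl u) (τ h ξ))) 0

/-- The maps `A t s = A_t^{(s)}` on `𝒩_s` transfer variations of the initial condition to
variations of the noise. The space `E_s = L^p([0,s], X₀)` is identified with the subspace of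
the elements of `E` that vanish on `[s, 1]`; values of `A t s` outside `𝒩_s` are irrelevant. -/
structure IsNoiseTransfer {Ω H₀ X₀ U M : Type*} [NormedAddCommGroup Ω] [NormedSpace ℝ Ω]
    [MeasurableSpace Ω] [NormedAddCommGroup H₀] [InnerProductSpace ℝ H₀]
    [NormedAddCommGroup X₀] [NormedSpace ℝ X₀] [NormedAddCommGroup U] [NormedSpace ℝ U]
    [MetricSpace M] {p : ℝ≥0∞} [Fact (1 ≤ p)]
    (P : Measure Ω) (ι : NoiseSpace H₀ →L[ℝ] Ω) (ξξ : Ω → M)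
    (Φ : ℝ → ℝ → U ⊕ Unit → M → U ⊕ Unit) (r : ℝ → U → M → ℝ≥0∞)
    (τ : ShiftSpace X₀ p → M → M) (A : ℝ → ℝ → U × M → U →L[ℝ] ShiftSpace X₀ p) : Prop where
  vanishes : ∀ t ∈ Ioc (0 : ℝ) 1, ∀ s ∈ Icc 0 t, ∀ x ∈ survival Φ s, ∀ v : U,
    VanishesOn (A t s x v) s 1
  compatible : ∀ s r' t : ℝ, 0 < s → s < r' → r' ≤ t → t ≤ 1 → ∀ x ∈ survival Φ r', ∀ v : U,
    VanishesOn (A t r' x v - A t s x v) 0 s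
  measurable : ∀ t ∈ Ioc (0 : ℝ) 1, ∀ s ∈ Icc 0 t, ∀ u : U,
    ∀ B : Set (U →L[ℝ] ShiftSpace X₀ p), MeasurableSet B →
      MeasurableSet[pastSigmaAlgebra P ι s]
        {ω | (u, ξξ ω) ∈ survival Φ s ∧ A t s (u, ξξ ω) ∈ B}
  transfer : ∀ t ∈ Ioc (0 : ℝ) 1, ∀ (u : U) (ξ : M), (u, ξ) ∈ survival Φ t → ∀ v : U,
    fderiv ℝ (fun u' : U => toU (Φ 0 t (Sum.inl u') ξ)) u v
      + fderiv ℝ (fun h : ShiftSpace X₀ p => toU (Φ 0 t (Sum.inl u) (τ h ξ))) 0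
          (A t t (u, ξ) v) = 0
  locallyLipschitz : ∀ s t : ℝ, 0 < s → s ≤ t → t ≤ 1 →
    LocallyLipschitzOn (survival Φ s) (A t s)
  bounded : ∀ s t : ℝ, 0 < s → s ≤ t → t ≤ 1 → ∀ R : ℝ, 0 < R →
    ∃ C : ℝ, ∀ (u : U) (ξ : M), r s u ξ ≤ ENNReal.ofReal R → ‖A t s (u, ξ)‖ ≤ C

/-! ### The Markov operator -/

/-- `𝔓 Ψ (u) = 𝔼 Ψ(Φ_{0,1}(u, ξ))`. -/
def markovOp {Ω U M : Type*} [MeasurableSpace Ω] (P : Measure Ω) (ξξ : Ω → M)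
    (Φ : ℝ → ℝ → U ⊕ Unit → M → U ⊕ Unit) (Ψ : U ⊕ Unit → ℝ) (u : U ⊕ Unit) : ℝ :=
  ∫ ω, Ψ (Φ 0 1 u (ξξ ω)) ∂P

/-- `μ` is an invariant probability measure of `𝔓`. -/
structure IsInvariantMeasure {Ω U M : Type*} [MeasurableSpace Ω] [MeasurableSpace U]
    (P : Measure Ω) (ξξ : Ω → M) (Φ : ℝ → ℝ → U ⊕ Unit → M → U ⊕ Unit)
    (μ : Measure (U ⊕ Unit)) : Prop where
  isProbabilityMeasure : IsProbabilityMeasure μ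
  invariant : ∀ Ψ : U ⊕ Unit → ℝ, Measurable Ψ → (∃ C : ℝ, ∀ u, |Ψ u| ≤ C) →
    ∫ u, markovOp P ξξ Φ Ψ u ∂μ = ∫ u, Ψ u ∂μ

end RandomDynamics

end

/-! Suppose that two distinct invariant probability measures live on `U`. Subtracting their infimum
leaves nonzero invariant measures carried by complementary sets `Sᶜ` and `S`. Every open set is
reached from every point of `U` with positive probability, so both charge every ball around `0`;
hence any such ball contains `u`, `u'` whose transition laws are mutually singular. This is absurd
as soon as the two laws are comparable on an event of positive probability, a localised substitute
for the strong Feller property (`measure_goodSet_inter_le`).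

The comparison transfers a change of initial condition to a change of noise. Along `u_x = u + x (u'
- u)` one solves `h' = A_1^{(1)}(u_x, τ(h, ξ)) (u' - u)`, `h_0 = 0`. The relation `DΦ + 𝒟Φ A = 0`
says formally that `Φ(u_x, τ(h_x, ξ))` does not depend on `x`, so `u` with noise `ξ` and `u'` with
noise `τ(h_1, ξ)` end at the same point (`exists_shift_of_mem_goodSet`). As `Φ` is only separately
differentiable in `u` and `h`, the chain rule is not available; `le_of_transport_equation` replaces
it by doubling the variables. The equation is solvable on the sets `goodSet`, which exhaust the
event of survival from `0`.

It remains to control the law of the shifted noise. The restriction of `A_1^{(1)}` to `[0, s]` is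
`A_1^{(s)}`, which is `𝓕_s`-measurable, so the shift is adapted and a Girsanov argument applies.
Stochastic integration is avoided: an Euler iterate of the equation is delayed by `1/N`, cut into
blocks and rounded to countably many values. For such shifts Girsanov's formula is a finite
iteration of the Cameron-Martin formula (`IsAdaptedShift.lintegral_girsanov`), and Cauchy-Schwarz
gives `P(shifted noise in S) ≤ C P(S)^{1/2}` with `C` depending only on an energy bound. Such bounds
pass to the limit on open target sets. Adaptedness enters only through `pastSigmaAlgebra_add`:
events of the past are, up to null sets, invariant under shifts of the future. -/

namespace RandomDynamics

/-! ### A variational principle and transport along characteristics -/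

/-- **Ekeland's variational principle** for continuous functions. -/
theorem exists_forall_le_add_mul_dist {Y : Type*} [MetricSpace Y] [CompleteSpace Y] {f : Y → ℝ}
    (hf : Continuous f) (hb : BddAbove (range f)) (y₀ : Y) {κ : ℝ} (hκ : 0 < κ) :
    ∃ y, ∀ z, f z ≤ f y + κ * dist y z := by
  -- `z ∈ S y` means that `z` lies above the cone of slope `κ` with vertex at `y`. The relation is
  -- transitive, and a greedy choice of almost maximal points makes the nested sets shrink to a
  -- point.
  set S : Y → Set Y := fun y => {z | f y + κ * dist y z ≤ f z} with hS
  have self : ∀ y, y ∈ S y := fun y => by simp [hS]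
  have step : ∀ n : ℕ, ∀ y, ∃ y' ∈ S y, ∀ z ∈ S y, f z ≤ f y' + (1 / 2 : ℝ) ^ n := by
    intro n y
    have hne : (f '' S y).Nonempty := ⟨_, mem_image_of_mem f (self y)⟩
    have hbd : BddAbove (f '' S y) := hb.mono (image_subset_range _ _)
    obtain ⟨_, ⟨y', hy', rfl⟩, hlt⟩ :=
      exists_lt_of_lt_csSup hne (sub_lt_self (sSup (f '' S y)) (by positivity : (0 : ℝ) < (1 / 2) ^ n))
    refine ⟨y', hy', fun z hz => ?_⟩
    have := le_csSup hbd (mem_image_of_mem f hz)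
    linarith
  choose g hgS hg using step
  let s : ℕ → Y := fun n => Nat.rec y₀ (fun n y => g n y) n
  have hs : ∀ n, s (n + 1) = g n (s n) := fun n => rfl
  have trans : ∀ {a b c}, b ∈ S a → c ∈ S b → c ∈ S a := by
    intro a b c hab hbc
    simp only [hS, mem_ofPred_eq] at *
    have := mul_le_mul_of_nonneg_left (dist_triangle a b c) hκ.le
    linarith
  have mono : ∀ n m, n ≤ m → s m ∈ S (s n) := by
    intro n m hnm
    induction hnm with
    | refl => exact self _
    | step _ ih => exact trans ih (by rw [hs]; exact hgS _ _)
  have close : ∀ n, ∀ z ∈ S (s (n + 1)), dist (s (n + 1)) z ≤ (1 / 2 : ℝ) ^ n / κ := by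
    intro n z hz
    have h1 : z ∈ S (s n) := trans (mono n (n + 1) n.le_succ) hz
    have h2 := hg n (s n) z h1
    rw [← hs] at h2
    simp only [hS, mem_ofPred_eq] at hz
    rw [le_div_iff₀ hκ]
    linarith
  have hlim : Tendsto (fun n : ℕ => (1 / 2 : ℝ) ^ n / κ) atTop (𝓝 0) := by
    simpa using (tendsto_pow_atTop_nhds_zero_of_lt_one (by norm_num : (0 : ℝ) ≤ 1 / 2)
      (by norm_num)).div_const κ
  have hcau : CauchySeq (fun n => s (n + 1)) :=
    cauchySeq_of_le_tendsto_0 (fun n => 2 * ((1 / 2 : ℝ) ^ n / κ)) (fun n m N hn hm => by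
      have h1 := close N _ (mono (N + 1) (n + 1) (by omega))
      have h2 := close N _ (mono (N + 1) (m + 1) (by omega))
      have := dist_triangle_left (s (n + 1)) (s (m + 1)) (s (N + 1))
      linarith) (by simpa using hlim.const_mul 2)
  obtain ⟨y, hy⟩ := cauchySeq_tendsto_of_complete hcau
  have hyS : ∀ n, y ∈ S (s n) := by
    intro n
    have hcl : IsClosed (S (s n)) := isClosed_le (by fun_prop) hf
    refine hcl.mem_of_tendsto hy (eventually_atTop.2 ⟨n, fun m hm => mono n (m + 1) (by omega)⟩)
  refine ⟨y, fun z => ?_⟩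
  -- A violating `z` would lie in every `S (s n)`, hence be the limit `y` itself.
  by_contra! hlt
  have hz : z ∈ S y := hlt.le
  have : Tendsto (fun n => s (n + 1)) atTop (𝓝 z) := by
    refine tendsto_iff_dist_tendsto_zero.2 (squeeze_zero (fun _ => dist_nonneg)
      (fun n => close n z (trans (hyS (n + 1)) hz)) hlim)
  have := tendsto_nhds_unique this hy
  subst this
  simp at hlt

/-- Only one of the two points has to lie in the compact set. This replaces uniform continuity on
balls, which are not compact in infinite dimensions; `K` will be the graph of an integral curve. -/
theorem exists_forall_abs_sub_le_near_compact {X : Type*} [MetricSpace X] {f : X → ℝ}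
    {S K : Set X} (hf : ContinuousOn f S) (hK : IsCompact K) (hKS : K ⊆ S) {σ : ℝ} (hσ : 0 < σ) :
    ∃ r > 0, ∀ k ∈ K, ∀ x ∈ S, dist k x ≤ r → |f x - f k| ≤ σ := by
  have hK' : IsCompact ((↑) ⁻¹' K : Set S) := by
    rw [Subtype.isCompact_iff, Subtype.image_preimage_coe, inter_eq_right.2 hKS]
    exact hK
  have hf' : Continuous (S.domRestrict f) := continuousOn_iff_continuous_domRestrict.1 hf
  have := hK'.uniformContinuousAt_of_continuousAt (S.domRestrict f) (fun a _ => hf'.continuousAt)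
    (Metric.dist_mem_uniformity hσ)
  obtain ⟨r, hr, h⟩ := Metric.mem_uniformity_dist.1 this
  refine ⟨r / 2, by positivity, fun k hk x hx hd => ?_⟩
  have := h (a := ⟨k, hKS hk⟩) (b := ⟨x, hx⟩) (by simp only [Subtype.dist_eq]; linarith) hk
  simp only [domRestrict_apply, mem_ofPred_eq, Real.dist_eq] at this
  rw [abs_sub_comm]
  exact this.le

/-- First-order condition at an approximate maximum. Using only points to the left allows `x` to be
the right endpoint of the time interval. -/
theorem neg_le_deriv_of_forall_le {φ : ℝ → ℝ} {φ' a x κ : ℝ} (hax : a < x)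
    (hφ : HasDerivWithinAt φ φ' (Icc a x) x) (h : ∀ y ∈ Icc a x, φ y ≤ φ x + κ * (x - y)) :
    -κ ≤ φ' := by
  have hs := (hasDerivWithinAt_iff_tendsto_slope.1 hφ)
  have : Icc a x \ {x} = Ico a x := by ext; simp [le_iff_lt_or_eq]
  rw [this] at hs
  have : (𝓝[Ico a x] x).NeBot := by
    rw [nhdsWithin_Ico_eq_nhdsLT hax]
    infer_instance
  refine ge_of_tendsto hs (eventually_nhdsWithin_of_forall fun y hy => ?_)
  rw [slope_def_field, ← neg_div_neg_eq, le_div_iff₀ (by linarith [hy.2])]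
  have := h y ⟨hy.1, hy.2.le⟩
  linarith

variable {E : Type*} [NormedAddCommGroup E] [NormedSpace ℝ E]

/-- The square of a Banach norm need not be differentiable. Along a line it is bounded above by a
quadratic polynomial that touches it at the base point, which suffices for a first-order condition.
-/
theorem penalty_le (q : ℝ) {ε s b e m : ℝ} (hε : 0 < ε) (hm : 0 ≤ m) (h : m ≤ b + -s * e) :
    (q + m ^ 2) / ε ≤ (q + b ^ 2) / ε + 2 * b / ε * (-s * e) + s ^ 2 * (e ^ 2 / ε) := by
  have : (q + b ^ 2) / ε + 2 * b / ε * (-s * e) + s ^ 2 * (e ^ 2 / ε)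
      = (q + (b + -s * e) ^ 2) / ε := by
    field_simp
    ring
  rw [this]
  gcongr

theorem slope_penalty_le {t w ε : ℝ} (hε : 0 < ε) :
    2 * w / ε * (t + w) ≤ 3 * ((t ^ 2 + w ^ 2) / ε) := by
  rw [div_mul_eq_mul_div, ← mul_div_assoc, div_le_div_iff_of_pos_right hε]
  nlinarith [sq_nonneg (t - w), sq_nonneg t]

-- Formally `G(y, c y)` has derivative `∂_x G + D_h G · a = 0`, but separate differentiability does
-- not justify the chain rule. Instead, `J(x, y, w) = G(x, c y + w) - η x - ((x - y)² + ‖w‖²)/ε` is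
-- maximised approximately. The conditions in `x` and in `y` add up to `g(a(x, c y + w) - a(y, c y))
-- ≤ 2σ - η`, while the condition in `w` bounds `g` by `2‖w‖/ε + σ`. The Lipschitz bound on `a` and
-- the smallness of the penalty then contradict `η > 0`. Ekeland's principle supplies the
-- approximate maximum in the absence of compactness.
set_option maxHeartbeats 1000000 in
theorem le_of_transport_equation [CompleteSpace E] {G : ℝ → E → ℝ} {a : ℝ → E → E} {c : ℝ → E}
    {ρ L : ℝ} (hρ : 0 < ρ) (hL : 0 ≤ L)
    (hc : ∀ y ∈ Icc (0 : ℝ) 1, HasDerivWithinAt c (a y (c y)) (Icc 0 1) y)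
    (hcρ : ∀ y ∈ Icc (0 : ℝ) 1, ‖c y‖ ≤ ρ)
    (ha : ∀ x ∈ Icc (0 : ℝ) 1, ∀ y ∈ Icc (0 : ℝ) 1, ∀ h k : E, ‖h‖ ≤ 2 * ρ → ‖k‖ ≤ 2 * ρ →
      ‖a x h - a y k‖ ≤ L * (|x - y| + ‖h - k‖))
    (hG : ContinuousOn (fun q : ℝ × E => G q.1 q.2) (Icc 0 1 ×ˢ Metric.closedBall 0 (2 * ρ)))
    (hGd : ∀ x ∈ Icc (0 : ℝ) 1, ∀ h : E, ‖h‖ < 2 * ρ → ∃ g : E →L[ℝ] ℝ,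
      HasFDerivAt (G x) g h ∧ HasDerivAt (fun x => G x h) (-(g (a x h))) x) :
    G 1 (c 1) ≤ G 0 (c 0) := by
  by_contra! hlt
  set η : ℝ := (G 1 (c 1) - G 0 (c 0)) / 2 with hη
  have hη0 : 0 < η := by simp only [hη]; linarith
  have hcc : ContinuousOn c (Icc 0 1) := fun y hy => (hc y hy).continuousWithinAt
  -- The errors at the end amount to `8Lσ + 2σ`, which has to stay below `η`.
  obtain ⟨σ, hσ, hση⟩ : ∃ σ > 0, σ * (10 * (L + 1)) = η :=
    ⟨η / (10 * (L + 1)), by positivity, by field_simp⟩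
  have hLσ : 0 ≤ L * σ := by positivity
  -- the graph of `c` and uniform closeness
  have hKc : IsCompact ((fun y => (y, c y)) '' Icc (0 : ℝ) 1) :=
    isCompact_Icc.image_of_continuousOn (continuousOn_id.prodMk hcc)
  obtain ⟨r₀, hr₀, hclose⟩ := exists_forall_abs_sub_le_near_compact hG hKc
    (by
      rintro _ ⟨y, hy, rfl⟩
      refine ⟨hy, ?_⟩
      have := hcρ y hy
      simp only [Metric.mem_closedBall, dist_zero_right]
      linarith) hσ
  have huc : UniformContinuousOn c (Icc 0 1) := isCompact_Icc.uniformContinuousOn_of_continuous hcc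
  obtain ⟨r₁, hr₁, hucr⟩ := Metric.uniformContinuousOn_iff_le.1 huc (r₀ / 2) (by positivity)
  obtain ⟨r, hr, hr0, hr1, hrρ, hrone⟩ : ∃ r > 0, r ≤ r₀ / 2 ∧ r ≤ r₁ ∧ r < ρ ∧ r ≤ 1 :=
    ⟨min (min (r₀ / 2) r₁) (min (ρ / 2) 1), by positivity, by simp, by simp,
      lt_of_le_of_lt ((min_le_right _ _).trans (min_le_left _ _)) (by linarith), by simp⟩
  have near : ∀ x ∈ Icc (0 : ℝ) 1, ∀ y ∈ Icc (0 : ℝ) 1, ∀ z ∈ Icc (0 : ℝ) 1, ∀ w : E,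
      |z - x| ≤ r → |z - y| ≤ r → ‖w‖ ≤ r → |G x (c y + w) - G z (c z)| ≤ σ := by
    intro x hx y hy z hz w hzx hzy hw
    refine hclose (z, c z) ⟨z, hz, rfl⟩ (x, c y + w) ⟨hx, ?_⟩ ?_
    · have := norm_add_le (c y) w
      have := hcρ y hy
      simp only [Metric.mem_closedBall, dist_zero_right]
      linarith
    · rw [Prod.dist_eq]
      refine max_le ?_ ?_
      · rw [Real.dist_eq]; linarith
      · have h1 := hucr z hz y hy (by rw [Real.dist_eq]; linarith)
        rw [dist_eq_norm] at h1 ⊢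
        have : c z - (c y + w) = (c z - c y) - w := by abel
        rw [this]
        have := norm_sub_le (c z - c y) w
        linarith
  -- With this `ε` a penalty of at most `2σ` forces `(x - y)² + ‖w‖² ≤ r²/2`, so the approximate
  -- maximum stays off the artificial boundary of `D`.
  set ε : ℝ := r ^ 2 / (4 * σ) with hε
  have hε0 : 0 < ε := by positivity
  have hεr : 2 * σ * ε < r ^ 2 := by
    have : 2 * σ * ε = r ^ 2 / 2 := by simp only [hε]; field_simp; norm_num
    have : 0 < r ^ 2 := by positivity
    linarith
  -- the doubled functional
  set D : Set (ℝ × ℝ × E) := {q | q.1 ∈ Icc (0 : ℝ) 1 ∧ q.2.1 ∈ Icc (0 : ℝ) 1 ∧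
    |q.1 - q.2.1| ≤ r ∧ ‖q.2.2‖ ≤ r} with hD
  have hDcl : IsClosed D := by
    refine (isClosed_Icc.preimage continuous_fst).inter
      ((isClosed_Icc.preimage (continuous_fst.comp continuous_snd)).inter
        ((isClosed_le (f := fun q : ℝ × ℝ × E => |q.1 - q.2.1|) (by fun_prop)
          continuous_const).inter
          (isClosed_le (f := fun q : ℝ × ℝ × E => ‖q.2.2‖) (by fun_prop) continuous_const)))
  set J : ℝ × ℝ × E → ℝ := fun q => G q.1 (c q.2.1 + q.2.2) - η * q.1
    - ((q.1 - q.2.1) ^ 2 + ‖q.2.2‖ ^ 2) / ε with hJ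
  have hJc : ContinuousOn J D := by
    have h1 : ContinuousOn (fun q : ℝ × ℝ × E => c q.2.1 + q.2.2) D :=
      (hcc.comp (by fun_prop) (fun q hq => hq.2.1)).add (by fun_prop)
    have h2 : ContinuousOn (fun q : ℝ × ℝ × E => G q.1 (c q.2.1 + q.2.2)) D := by
      refine hG.comp (f := fun q : ℝ × ℝ × E => (q.1, c q.2.1 + q.2.2))
        (continuousOn_fst.prodMk h1) (fun q hq => ⟨hq.1, ?_⟩)
      have := norm_add_le (c q.2.1) q.2.2
      have := hcρ q.2.1 hq.2.1
      have := hq.2.2.2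
      simp only [Metric.mem_closedBall, dist_zero_right]
      linarith
    exact (h2.sub (by fun_prop)).sub (by fun_prop)
  have : CompleteSpace D := hDcl.isComplete.completeSpace_coe
  have hdiag : ∀ y ∈ Icc (0 : ℝ) 1, ((y, y, 0) : ℝ × ℝ × E) ∈ D := fun y hy => by
    simp [hD, hy.1, hy.2, hr.le]
  obtain ⟨B, hB⟩ := isCompact_Icc.exists_bound_of_continuousOn
    (f := fun y => G y (c y)) (s := Icc (0 : ℝ) 1)
    (hG.comp (f := fun y => (y, c y)) (continuousOn_id.prodMk hcc)
      (fun y hy => ⟨hy, by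
        have := hcρ y hy
        simp only [Metric.mem_closedBall, dist_zero_right]
        linarith⟩))
  have hbdd : BddAbove (range (D.domRestrict J)) := by
    refine ⟨B + σ, ?_⟩
    rintro _ ⟨⟨⟨x, y, w⟩, hx, hy, hxy, hw⟩, rfl⟩
    simp only at hx hy hxy hw
    have h1 := near x hx y hy y hy w (by rwa [abs_sub_comm]) (by simpa using hr.le) hw
    have h2 := hB y hy
    rw [Real.norm_eq_abs] at h2
    have h3 := (abs_le.1 h1).2
    have h4 := (abs_le.1 h2).2
    have h5 : 0 ≤ η * x := mul_nonneg hη0.le hx.1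
    have h6 : 0 ≤ ((x - y) ^ 2 + ‖w‖ ^ 2) / ε := by positivity
    change G x (c y + w) - η * x - ((x - y) ^ 2 + ‖w‖ ^ 2) / ε ≤ B + σ
    linarith
  obtain ⟨⟨⟨x, y, w⟩, hmem⟩, hmax⟩ := exists_forall_le_add_mul_dist
    (continuousOn_iff_continuous_domRestrict.1 hJc) hbdd ⟨(0, 0, 0), hdiag 0 (by simp)⟩ hσ
  have hmax' : ∀ x' y' w', ((x', y', w') : ℝ × ℝ × E) ∈ D → J (x', y', w') ≤ J (x, y, w)
      + σ * max |x - x'| (max |y - y'| ‖w - w'‖) := by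
    intro x' y' w' h
    have := hmax ⟨_, h⟩
    simpa [Subtype.dist_eq, Prod.dist_eq, Real.dist_eq, dist_eq_norm] using this
  obtain ⟨hx, hy, hxy, hw⟩ := hmem
  simp only at hx hy hxy hw
  have dist_le : ∀ z ∈ Icc (0 : ℝ) 1, max |x - z| (max |y - z| ‖w - 0‖) ≤ 1 := by
    intro z hz
    refine max_le ?_ (max_le ?_ ?_)
    · rw [abs_le]; constructor <;> linarith [hx.1, hx.2, hz.1, hz.2]
    · rw [abs_le]; constructor <;> linarith [hy.1, hy.2, hz.1, hz.2]
    · rw [sub_zero]; linarith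
  have hdiagle : ∀ z ∈ Icc (0 : ℝ) 1, G z (c z) - η * z ≤ J (x, y, w) + σ := by
    intro z hz
    have h1 := hmax' z z 0 (hdiag z hz)
    have h2 := mul_le_mul_of_nonneg_left (dist_le z hz) hσ.le
    simp only [hJ] at h1 ⊢
    simp at h1 h2 ⊢
    linarith
  -- The competitor is the diagonal point `(x, x, 0)`: the gain in `G` from leaving the diagonal is
  -- at most `σ`, and Ekeland's slope costs another `σ`.
  have hpen : ((x - y) ^ 2 + ‖w‖ ^ 2) / ε ≤ 2 * σ := by
    have h1 := hdiagle x hx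
    have h2 := (abs_le.1 (near x hx y hy x hx w (by simpa using hr.le) hxy hw)).2
    simp only [hJ] at h1
    linarith
  have hpen0 : 0 ≤ ((x - y) ^ 2 + ‖w‖ ^ 2) / ε := by positivity
  have hsq : (x - y) ^ 2 + ‖w‖ ^ 2 < r ^ 2 := by
    rw [div_le_iff₀ hε0] at hpen
    linarith
  have hxy' : |x - y| < r := by
    refine abs_lt_of_sq_lt_sq ?_ hr.le
    nlinarith [sq_nonneg ‖w‖]
  have hw' : ‖w‖ < r := by
    have := abs_lt_of_sq_lt_sq (a := ‖w‖) (b := r) (by nlinarith [sq_nonneg (x - y)]) hr.le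
    rwa [abs_norm] at this
  have hJ1 := hdiagle 1 (by simp)
  have hση' : 10 * σ ≤ η := by nlinarith
  -- At `x = 0` (and likewise at `y = 0` below) the value of `J` is at most `G 0 (c 0) + σ`, whereas
  -- the diagonal point at time `1` gives `G 1 (c 1) - η = G 0 (c 0) + η`. So there is room to move
  -- to the left.
  have hx0 : 0 < x := by
    refine lt_of_le_of_ne hx.1 (fun h => ?_)
    have h2 := (abs_le.1 (near x hx y hy 0 (by simp) w (by simp [← h, hr.le])
      (by rwa [← h] at hxy) hw)).2
    simp only [hJ] at hJ1
    have : η * x = 0 := by rw [← h, mul_zero]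
    linarith
  have hy0 : 0 < y := by
    refine lt_of_le_of_ne hy.1 (fun h => ?_)
    have h2 := (abs_le.1 (near x hx y hy 0 (by simp) w (by rw [abs_sub_comm]; rwa [← h] at hxy)
      (by simp [← h, hr.le]) hw)).2
    simp only [hJ] at hJ1
    have : 0 ≤ η * x := mul_nonneg hη0.le hx.1
    linarith
  -- derivatives at the maximum
  have hcyw : ‖c y + w‖ < 2 * ρ := by
    have := norm_add_le (c y) w
    have := hcρ y hy
    linarith
  obtain ⟨g, hg, hgx⟩ := hGd x hx (c y + w) hcyw
  obtain ⟨δ, hδ, hδx, hδy, hδr⟩ : ∃ δ > 0, δ ≤ x ∧ δ ≤ y ∧ |x - y| + δ ≤ r :=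
    ⟨min (min x y) (r - |x - y|), by
      have : 0 < r - |x - y| := by linarith
      positivity, by simp, by simp, by linarith [min_le_right (min x y) (r - |x - y|)]⟩
  have habs : ∀ s : ℝ, 0 ≤ s → s ≤ δ → |x - s - y| ≤ r ∧ |x - (y - s)| ≤ r := by
    intro s h1 h2
    have h3 := abs_le.1 (le_refl |x - y|)
    constructor <;> rw [abs_le] <;> constructor <;> linarith [h3.1, h3.2]
  have Dx : -σ ≤ -(g (a x (c y + w))) - η - 2 * (x - y) / ε := by
    refine neg_le_deriv_of_forall_le (a := x - δ) (x := x)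
      (φ := fun s => J (s, y, w)) (by linarith) ?_ ?_
    · have h1 := ((hgx.sub ((hasDerivAt_id x).const_mul η)).sub
        (((((hasDerivAt_id x).sub_const y).pow 2).add_const (‖w‖ ^ 2)).div_const ε))
      refine (h1.congr_deriv ?_).hasDerivWithinAt
      simp
    · intro s hs
      have h1 := hmax' s y w ⟨⟨by simp only; linarith [hs.1], hs.2.trans hx.2⟩, hy, by
        have := (habs (x - s) (by linarith [hs.2]) (by linarith [hs.1])).1
        rwa [sub_sub_cancel] at this, hw⟩
      rwa [sub_self, sub_self, norm_zero, abs_zero, max_self,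
        max_eq_left (abs_nonneg _), abs_of_nonneg (by linarith [hs.2])] at h1
  have Dy : -σ ≤ g (a y (c y)) + 2 * (x - y) / ε := by
    refine neg_le_deriv_of_forall_le (a := y - δ) (x := y)
      (φ := fun s => J (x, s, w)) (by linarith) ?_ ?_
    · have hsub : Icc (y - δ) y ⊆ Icc 0 1 := Icc_subset_Icc (by linarith) hy.2
      have h0 : HasDerivWithinAt (fun s => G x (c s + w)) (g (a y (c y))) (Icc (y - δ) y) y :=
        hg.comp_hasDerivWithinAt y (((hc y hy).mono hsub).add_const w)
      have h1 := ((h0.sub_const (η * x)).sub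
        (((((hasDerivWithinAt_id y _).const_sub x).pow 2).add_const (‖w‖ ^ 2)).div_const ε))
      refine h1.congr_deriv ?_
      simp
      ring
    · intro s hs
      have h1 := hmax' x s w ⟨hx, ⟨by simp only; linarith [hs.1], hs.2.trans hy.2⟩, by
        have := (habs (y - s) (by linarith [hs.2]) (by linarith [hs.1])).2
        rwa [sub_sub_cancel] at this, hw⟩
      rwa [sub_self, sub_self, norm_zero, abs_zero,
        max_eq_left (abs_nonneg (y - s)), max_eq_right (abs_nonneg _),
        abs_of_nonneg (by linarith [hs.2])] at h1
  have De : ∀ e : E, -((2 * ‖w‖ / ε + σ) * ‖e‖) ≤ g e := by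
    intro e
    obtain ⟨t, ht, hte⟩ : ∃ t > 0, t * ‖e‖ ≤ r - ‖w‖ :=
      ⟨(r - ‖w‖) / (‖e‖ + 1), div_pos (by linarith) (by positivity), by
        rw [div_mul_eq_mul_div, div_le_iff₀ (by positivity)]
        nlinarith [norm_nonneg e]⟩
    refine neg_le_deriv_of_forall_le (a := -t) (x := 0)
      (φ := fun s => G x (c y + w + s • e) - s ^ 2 * (‖e‖ ^ 2 / ε)) (by linarith) ?_ ?_
    · have h0 : HasDerivAt (fun s : ℝ => c y + w + s • e) e 0 := by
        simpa using ((hasDerivAt_id (0 : ℝ)).smul_const e).const_add (c y + w)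
      have h1 : HasDerivAt (fun s : ℝ => G x (c y + w + s • e)) (g e) 0 :=
        HasFDerivAt.comp_hasDerivAt (0 : ℝ) (by simpa using hg) h0
      refine ((h1.sub (((hasDerivAt_id (0 : ℝ)).pow 2).mul_const (‖e‖ ^ 2 / ε))).congr_deriv
        ?_).hasDerivWithinAt
      simp
    · intro s hs
      have hs0 : |s| = -s := abs_of_nonpos hs.2
      have hse : ‖w + s • e‖ ≤ ‖w‖ + -s * ‖e‖ := by
        refine (norm_add_le _ _).trans ?_
        rw [norm_smul, Real.norm_eq_abs, hs0]
      have hser : ‖w + s • e‖ ≤ r := by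
        have : -s * ‖e‖ ≤ t * ‖e‖ := mul_le_mul_of_nonneg_right (by linarith [hs.1]) (norm_nonneg e)
        linarith
      have h1 := hmax' x y (w + s • e) ⟨hx, hy, hxy, hser⟩
      rw [sub_self, sub_self, abs_zero, sub_add_cancel_left, norm_neg, norm_smul, Real.norm_eq_abs,
        hs0, max_eq_right (mul_nonneg (by linarith [hs.2]) (norm_nonneg e)),
        max_eq_right (mul_nonneg (by linarith [hs.2]) (norm_nonneg e))] at h1
      simp only [hJ] at h1
      have h3 := penalty_le ((x - y) ^ 2) hε0 (norm_nonneg _) hse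
      simp only [zero_smul, add_zero, zero_sub, ← add_assoc] at h1 ⊢
      norm_num
      linarith
  have hfin := De (a x (c y + w) - a y (c y))
  rw [map_sub] at hfin
  have hax := ha x hx y hy (c y + w) (c y) hcyw.le (by linarith [hcρ y hy])
  rw [add_sub_cancel_left] at hax
  have h1 : (2 * ‖w‖ / ε + σ) * ‖a x (c y + w) - a y (c y)‖
      ≤ (2 * ‖w‖ / ε + σ) * (L * (|x - y| + ‖w‖)) := by gcongr
  have h2 : 2 * ‖w‖ / ε * (|x - y| + ‖w‖) ≤ 6 * σ := by
    have := slope_penalty_le hε0 (t := |x - y|) (w := ‖w‖)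
    rw [sq_abs] at this
    linarith
  have h3 : σ * (|x - y| + ‖w‖) ≤ 2 * σ := by nlinarith
  have h4 : (2 * ‖w‖ / ε + σ) * (L * (|x - y| + ‖w‖)) ≤ L * (8 * σ) := by
    have : (2 * ‖w‖ / ε + σ) * (L * (|x - y| + ‖w‖))
      = L * (2 * ‖w‖ / ε * (|x - y| + ‖w‖) + σ * (|x - y| + ‖w‖)) := by ring
    rw [this]
    gcongr
    linarith
  have h5 : L * (8 * σ) + 2 * σ < η := by linarith
  have h6 : 2 * (x - y) / ε - 2 * (x - y) / ε = 0 := sub_self _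
  linarith

theorem eq_of_transport_equation [CompleteSpace E] {G : ℝ → E → ℝ} {a : ℝ → E → E} {c : ℝ → E}
    {ρ L : ℝ} (hρ : 0 < ρ) (hL : 0 ≤ L)
    (hc : ∀ y ∈ Icc (0 : ℝ) 1, HasDerivWithinAt c (a y (c y)) (Icc 0 1) y)
    (hcρ : ∀ y ∈ Icc (0 : ℝ) 1, ‖c y‖ ≤ ρ)
    (ha : ∀ x ∈ Icc (0 : ℝ) 1, ∀ y ∈ Icc (0 : ℝ) 1, ∀ h k : E, ‖h‖ ≤ 2 * ρ → ‖k‖ ≤ 2 * ρ →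
      ‖a x h - a y k‖ ≤ L * (|x - y| + ‖h - k‖))
    (hG : ContinuousOn (fun q : ℝ × E => G q.1 q.2) (Icc 0 1 ×ˢ Metric.closedBall 0 (2 * ρ)))
    (hGd : ∀ x ∈ Icc (0 : ℝ) 1, ∀ h : E, ‖h‖ < 2 * ρ → ∃ g : E →L[ℝ] ℝ,
      HasFDerivAt (G x) g h ∧ HasDerivAt (fun x => G x h) (-(g (a x h))) x) :
    G 1 (c 1) = G 0 (c 0) := by
  refine le_antisymm (le_of_transport_equation hρ hL hc hcρ ha hG hGd) ?_
  have := le_of_transport_equation (G := fun x h => -G x h) hρ hL hc hcρ ha hG.neg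
    (fun x hx h hh => by
      obtain ⟨g, h1, h2⟩ := hGd x hx h hh
      exact ⟨-g, h1.neg, h2.neg⟩)
  linarith

/-! ### Integral curves and their Euler approximation -/

variable {E : Type*} [NormedAddCommGroup E] [NormedSpace ℝ E]

/-- The points of the explicit Euler scheme with `n` steps on `[0, 1]`, started at `0`. -/
noncomputable def eulerPoint (a : ℝ → E → E) (n : ℕ) : ℕ → E
  | 0 => 0
  | i + 1 => eulerPoint a n i + (1 / n : ℝ) • a (i / n) (eulerPoint a n i)

theorem norm_eulerPoint_le {a : ℝ → E → E} {ρ K : ℝ} (hK : 0 ≤ K) (hKρ : K ≤ ρ)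
    (hb : ∀ x ∈ Icc (0 : ℝ) 1, ∀ h, ‖h‖ ≤ ρ → ‖a x h‖ ≤ K) {n i : ℕ} (hin : i ≤ n) :
    ‖eulerPoint a n i‖ ≤ i / n * K := by
  induction i with
  | zero => simp [eulerPoint]
  | succ i ih =>
    have hn : (0 : ℝ) < n := by exact_mod_cast (by omega : 0 < n)
    have hi : (i : ℝ) ≤ n := by exact_mod_cast (by omega : i ≤ n)
    have h1 := ih (by omega)
    have hx : (i / n : ℝ) ∈ Icc (0 : ℝ) 1 := ⟨by positivity, (div_le_one hn).2 hi⟩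
    have h2 := hb (i / n) hx (eulerPoint a n i)
      (h1.trans ((mul_le_of_le_one_left hK hx.2).trans hKρ))
    calc ‖eulerPoint a n (i + 1)‖ ≤ ‖eulerPoint a n i‖ + ‖(1 / n : ℝ) • a (i / n) (eulerPoint a n i)‖ :=
          norm_add_le _ _
      _ ≤ i / n * K + 1 / n * K := by
          rw [norm_smul, Real.norm_of_nonneg (by positivity)]
          gcongr
      _ = _ := by push_cast; ring

/-- Picard-Lindelöf, with `K ≤ ρ` keeping the curve in the ball for the whole unit of time. The
fixed point of the Picard map is used directly because it retains the bound by `ρ`. -/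
theorem exists_integral_curve [CompleteSpace E] {a : ℝ → E → E} {ρ K L : ℝ} (hK : 0 ≤ K)
    (hKρ : K ≤ ρ) (hL : 0 ≤ L)
    (hb : ∀ x ∈ Icc (0 : ℝ) 1, ∀ h, ‖h‖ ≤ ρ → ‖a x h‖ ≤ K)
    (ha : ∀ x ∈ Icc (0 : ℝ) 1, ∀ y ∈ Icc (0 : ℝ) 1, ∀ h k : E, ‖h‖ ≤ ρ → ‖k‖ ≤ ρ →
      ‖a x h - a y k‖ ≤ L * (|x - y| + ‖h - k‖)) :
    ∃ c : ℝ → E, c 0 = 0 ∧ (∀ y ∈ Icc (0 : ℝ) 1, ‖c y‖ ≤ ρ) ∧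
      ∀ y ∈ Icc (0 : ℝ) 1, HasDerivWithinAt c (a y (c y)) (Icc 0 1) y := by
  lift ρ to NNReal using hK.trans hKρ
  lift K to NNReal using hK
  lift L to NNReal using hL
  have hpl : IsPicardLindelof a (tmin := 0) (tmax := 1) ⟨0, by simp⟩ (0 : E) ρ 0 K L := by
    refine ⟨fun t ht => LipschitzOnWith.of_dist_le_mul fun h hh k hk => ?_, fun h hh => ?_,
      fun t ht h hh => hb t ht h (by simpa using hh), by simpa using hKρ⟩
    · simpa [dist_eq_norm] using ha t ht t ht h k (by simpa using hh) (by simpa using hk)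
    · refine LipschitzOnWith.continuousOn (K := L) (LipschitzOnWith.of_dist_le_mul fun s hs t ht => ?_)
      simpa [dist_eq_norm] using ha s hs t ht h h (by simpa using hh) (by simpa using hh)
  have hx : (0 : E) ∈ Metric.closedBall (0 : E) ((0 : NNReal) : ℝ) := by simp
  obtain ⟨α, hα⟩ := ODE.FunSpace.exists_isFixedPt_next hpl hx
  have hmem : ∀ t, ‖α.compProj t‖ ≤ ρ := fun t => by
    simpa using α.compProj_mem_closedBall hpl.mul_max_le (t := t)
  have hp : ∀ t ∈ Icc (0 : ℝ) 1, α.compProj t = ODE.picard a 0 0 α.compProj t := by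
    intro t ht
    conv_lhs => rw [← hα]
    rw [ODE.FunSpace.compProj_apply, ODE.FunSpace.next_apply, projIcc_of_mem _ ht]
  refine ⟨α.compProj, ?_, fun t _ => hmem t, fun t ht => ?_⟩
  · rw [hp 0 (by simp)]; simp
  · refine (ODE.hasDerivWithinAt_picard_Icc (t₀ := 0) (by simp) hpl.continuousOn_uncurry
      α.continuous_compProj.continuousOn (fun s _ => by simpa using hmem s) 0 ht).congr hp (hp t ht)

/-- Euler points are explicit compositions of the field, so measurability and adaptedness can be
read off them and need not be proved for the curve. Convergence is consistency plus discrete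
Gronwall: local errors `C/n²` accumulate with growth factor `1 + L/n ≤ exp(L/n)`. -/
theorem tendsto_eulerPoint {a : ℝ → E → E} {c : ℝ → E} {ρ K L : ℝ} (hK : 0 ≤ K)
    (hKρ : K ≤ ρ) (hL : 0 ≤ L)
    (hb : ∀ x ∈ Icc (0 : ℝ) 1, ∀ h, ‖h‖ ≤ ρ → ‖a x h‖ ≤ K)
    (ha : ∀ x ∈ Icc (0 : ℝ) 1, ∀ y ∈ Icc (0 : ℝ) 1, ∀ h k : E, ‖h‖ ≤ ρ → ‖k‖ ≤ ρ →
      ‖a x h - a y k‖ ≤ L * (|x - y| + ‖h - k‖))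
    (hc0 : c 0 = 0) (hcρ : ∀ y ∈ Icc (0 : ℝ) 1, ‖c y‖ ≤ ρ)
    (hc : ∀ y ∈ Icc (0 : ℝ) 1, HasDerivWithinAt c (a y (c y)) (Icc 0 1) y) :
    Tendsto (fun n => eulerPoint a n n) atTop (𝓝 (c 1)) := by
  have hlip : ∀ x ∈ Icc (0 : ℝ) 1, ∀ y ∈ Icc (0 : ℝ) 1, ‖c y - c x‖ ≤ K * |y - x| := by
    intro x hx y hy
    exact (convex_Icc (0 : ℝ) 1).norm_image_sub_le_of_norm_hasDerivWithin_le hc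
      (fun z hz => hb z hz _ (hcρ z hz)) hx hy
  set C : ℝ := L * (1 + K) with hC
  have hC0 : 0 ≤ C := by positivity
  have hloc : ∀ x ∈ Icc (0 : ℝ) 1, ∀ y ∈ Icc (0 : ℝ) 1, x ≤ y →
      ‖c y - c x - (y - x) • a x (c x)‖ ≤ C * (y - x) ^ 2 := by
    intro x hx y hy hxy
    have hsub : Icc x y ⊆ Icc 0 1 := Icc_subset_Icc hx.1 hy.2
    have h1 := (convex_Icc x y).norm_image_sub_le_of_norm_hasDerivWithin_le
      (f := fun z => c z - z • a x (c x)) (f' := fun z => a z (c z) - (1 : ℝ) • a x (c x))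
      (C := C * (y - x))
      (fun z hz => ((hc z (hsub hz)).mono hsub).sub ((hasDerivWithinAt_id z _).smul_const _))
      (fun z hz => by
        rw [one_smul]
        refine (ha z (hsub hz) x hx _ _ (hcρ z (hsub hz)) (hcρ x hx)).trans ?_
        have h2 := hlip x hx z (hsub hz)
        have h3 : |z - x| ≤ y - x := by rw [abs_of_nonneg] <;> linarith [hz.1, hz.2]
        calc L * (|z - x| + ‖c z - c x‖) ≤ L * ((y - x) + K * (y - x)) := by
              gcongr
              exact h2.trans (by gcongr)
          _ = _ := by rw [hC]; ring)
      (left_mem_Icc.2 hxy) (right_mem_Icc.2 hxy)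
    have h4 : c y - y • a x (c x) - (c x - x • a x (c x)) = c y - c x - (y - x) • a x (c x) := by
      rw [sub_smul]; abel
    rw [h4, Real.norm_of_nonneg (by linarith)] at h1
    linarith
  have herr : ∀ n : ℕ, 0 < n → ∀ i ≤ n, ‖c (i / n) - eulerPoint a n i‖
      ≤ i / n * (C / n) * Real.exp (L * (i / n)) := by
    intro n hn i
    have hn' : (0 : ℝ) < n := by exact_mod_cast hn
    induction i with
    | zero => simp [eulerPoint, hc0]
    | succ i ih =>
      intro hi
      have ih := ih (by omega)
      have hmem : ∀ k : ℕ, k ≤ n → (k / n : ℝ) ∈ Icc (0 : ℝ) 1 := fun k hk =>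
        ⟨by positivity, (div_le_one hn').2 (by exact_mod_cast hk)⟩
      have hx := hmem i (by omega)
      have hy := hmem (i + 1) hi
      have hstep : (((i + 1 : ℕ) : ℝ) / n) - i / n = 1 / n := by push_cast; ring
      have h1 := hloc _ hx _ hy (by rw [← sub_nonneg, hstep]; positivity)
      rw [hstep] at h1
      have h2 := ha _ hx _ hx _ _ (hcρ _ hx)
        ((norm_eulerPoint_le hK hKρ hb (by omega : i ≤ n)).trans
          ((mul_le_of_le_one_left hK hx.2).trans hKρ))
      rw [sub_self, abs_zero, zero_add] at h2
      have h3 : c ((i + 1 : ℕ) / n) - eulerPoint a n (i + 1)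
          = (c ((i + 1 : ℕ) / n) - c (i / n) - (1 / n : ℝ) • a (i / n) (c (i / n)))
            + (c (i / n) - eulerPoint a n i)
            + (1 / n : ℝ) • (a (i / n) (c (i / n)) - a (i / n) (eulerPoint a n i)) := by
        simp only [eulerPoint, smul_sub]; abel
      rw [h3]
      have h4 : 1 + L / n ≤ Real.exp (L / n) := by linarith [Real.add_one_le_exp (L / n)]
      have h5 : Real.exp (L * (((i + 1 : ℕ) : ℝ) / n)) = Real.exp (L * (i / n)) * Real.exp (L / n) := by
        rw [← Real.exp_add]; congr 1; push_cast; ring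
      have h6 : (1 : ℝ) ≤ Real.exp (L * (i / n)) * Real.exp (L / n) := by
        rw [← Real.exp_add]; exact Real.one_le_exp (by positivity)
      calc _ ≤ C * (1 / n) ^ 2 + ‖c (i / n) - eulerPoint a n i‖
              + 1 / n * (L * ‖c (i / n) - eulerPoint a n i‖) := by
            refine (norm_add₃_le).trans ?_
            rw [norm_smul, Real.norm_of_nonneg (by positivity : (0 : ℝ) ≤ 1 / n)]
            gcongr
        _ = 1 / n * (C / n) * 1 + (1 + L / n) * ‖c (i / n) - eulerPoint a n i‖ := by ring
        _ ≤ 1 / n * (C / n) * (Real.exp (L * (i / n)) * Real.exp (L / n))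
              + Real.exp (L / n) * (i / n * (C / n) * Real.exp (L * (i / n))) := by gcongr
        _ = _ := by rw [h5]; push_cast; ring
  refine tendsto_iff_norm_sub_tendsto_zero.2 ?_
  have hlim : Tendsto (fun n : ℕ => C / n * Real.exp L) atTop (𝓝 0) := by
    simpa using (tendsto_const_div_atTop_nhds_zero_nat C).mul_const (Real.exp L)
  refine squeeze_zero' (Eventually.of_forall fun _ => norm_nonneg _) ?_ hlim
  filter_upwards [eventually_gt_atTop 0] with n hn
  have h := herr n hn n le_rfl
  have hn' : (n : ℝ) ≠ 0 := by exact_mod_cast hn.ne'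
  rw [div_self hn', one_mul, mul_one] at h
  rwa [norm_sub_rev]

/-! ### The Paley-Wiener map and the Cameron-Martin formula -/

theorem inner_eq_integral {Ω : Type*} [MeasurableSpace Ω] (P : Measure Ω) (f g : Lp ℝ 2 P) :
    inner ℝ f g = ∫ ω, f ω * g ω ∂P := by
  rw [L2.inner_def]
  simp [mul_comm]

/-- Continuity in `L²` of the characteristic functional, by `|e^{ia} - e^{ib}| ≤ |a - b|`; it
carries Gaussianity from the dual to its closure. -/
theorem norm_integral_cexp_sub_le {Ω : Type*} [MeasurableSpace Ω] {P : Measure Ω} [IsProbabilityMeasure P] (f g : Lp ℝ 2 P) :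
    ‖∫ ω, Complex.exp (f ω * Complex.I) ∂P - ∫ ω, Complex.exp (g ω * Complex.I) ∂P‖
      ≤ ‖f - g‖ := by
  have hint : ∀ k : Lp ℝ 2 P, Integrable (fun ω => Complex.exp (k ω * Complex.I)) P := by
    intro k
    refine Integrable.of_bound (C := 1) ?_ (Eventually.of_forall fun ω => ?_)
    · have := (Lp.stronglyMeasurable k).measurable
      exact Measurable.aestronglyMeasurable (by fun_prop)
    · rw [Complex.norm_exp_ofReal_mul_I]
  rw [← integral_sub (hint f) (hint g)]
  have h1 : ∀ ω, ‖Complex.exp (f ω * Complex.I) - Complex.exp (g ω * Complex.I)‖ₑ ≤ ‖f ω - g ω‖ₑ := by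
    intro ω
    have : Complex.exp (f ω * Complex.I) - Complex.exp (g ω * Complex.I)
        = Complex.exp (g ω * Complex.I) * (Complex.exp (Complex.I * ((f ω - g ω : ℝ) : ℂ)) - 1) := by
      rw [mul_sub, ← Complex.exp_add, mul_one]; congr 2; push_cast; ring
    rw [this, enorm_mul, ← ofReal_norm, Complex.norm_exp_ofReal_mul_I, ENNReal.ofReal_one, one_mul,
      enorm_le_iff_norm_le]
    exact Real.norm_exp_I_mul_ofReal_sub_one_le
  have h2 := calc
      ‖∫ ω, (Complex.exp (f ω * Complex.I) - Complex.exp (g ω * Complex.I)) ∂P‖ₑ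
        ≤ ∫⁻ ω, ‖Complex.exp (f ω * Complex.I) - Complex.exp (g ω * Complex.I)‖ₑ ∂P :=
          enorm_integral_le_lintegral_enorm _
      _ ≤ ∫⁻ ω, ‖f ω - g ω‖ₑ ∂P := lintegral_mono h1
      _ = eLpNorm (⇑(f - g)) 1 P := by
          rw [eLpNorm_one_eq_lintegral_enorm]
          refine lintegral_congr_ae ?_
          filter_upwards [Lp.coeFn_sub f g] with ω h
          rw [h, Pi.sub_apply]
      _ ≤ eLpNorm (⇑(f - g)) 2 P :=
          eLpNorm_le_eLpNorm_of_exponent_le (by norm_num) (Lp.aestronglyMeasurable _)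
      _ = ‖f - g‖ₑ := (Lp.enorm_def _).symm
  exact enorm_le_iff_norm_le.1 h2

theorem measurable_Lp {Ω : Type*} [MeasurableSpace Ω] {P : Measure Ω} (g : Lp ℝ 2 P) : Measurable g :=
  (Lp.stronglyMeasurable g).measurable

section PaleyWiener

variable {Ω H₀ : Type*} [NormedAddCommGroup Ω] [NormedSpace ℝ Ω] [MeasurableSpace Ω] [BorelSpace Ω]
  [NormedAddCommGroup H₀] [InnerProductSpace ℝ H₀]

/-- A continuous linear functional as an element of `L²(P)`. -/
noncomputable def dualToL2 (P : Measure Ω) [IsGaussian P] : StrongDual ℝ Ω →ₗ[ℝ] Lp ℝ 2 P where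
  toFun ℓ := (IsGaussian.memLp_dual P ℓ 2 (by simp)).toLp ℓ
  map_add' _ _ := MemLp.toLp_add _ _
  map_smul' c ℓ := MemLp.toLp_const_smul c (IsGaussian.memLp_dual P ℓ 2 (by simp))

theorem coeFn_dualToL2 (P : Measure Ω) [IsGaussian P] (ℓ : StrongDual ℝ Ω) :
    dualToL2 P ℓ =ᵐ[P] ℓ :=
  (IsGaussian.memLp_dual P ℓ 2 (by simp)).coeFn_toLp

/-- The closure of the dual of `Ω` in `L²(P)`. -/
noncomputable def gaussianHilbert (P : Measure Ω) [IsGaussian P] : Submodule ℝ (Lp ℝ 2 P) :=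
  (LinearMap.range (dualToL2 P)).topologicalClosure

theorem norm_dualToL2_sq (P : Measure Ω) [IsGaussian P] (ℓ : StrongDual ℝ Ω) :
    ‖dualToL2 P ℓ‖ ^ 2 = ∫ ω, (ℓ ω) ^ 2 ∂P := by
  rw [← real_inner_self_eq_norm_sq, inner_eq_integral]
  refine integral_congr_ae ?_
  filter_upwards [coeFn_dualToL2 P ℓ] with ω h
  rw [h, sq]

theorem IsCameronMartin.apply_le {P : Measure Ω} [IsGaussian P] {ι : NoiseSpace H₀ →L[ℝ] Ω}
    {x : NoiseSpace H₀} {b : ℝ}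
    (hb : b ∈ upperBounds {a : ℝ | ∃ ℓ : StrongDual ℝ Ω, ∫ ω', (ℓ ω') ^ 2 ∂P ≤ 1 ∧ a = ℓ (ι x)})
    (ℓ : StrongDual ℝ Ω) : ℓ (ι x) ≤ b * ‖dualToL2 P ℓ‖ := by
  have key : ∀ k : StrongDual ℝ Ω, ‖dualToL2 P k‖ ≤ 1 → k (ι x) ≤ b := by
    intro k hk
    refine hb ⟨k, ?_, rfl⟩
    rw [← norm_dualToL2_sq]
    exact pow_le_one₀ (norm_nonneg _) hk
  -- If `ℓ` vanishes in `L²(P)`, all multiples `n • ℓ` are admissible in the supremum, which forces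
  -- `ℓ (ι x) ≤ 0`.
  rcases (norm_nonneg (dualToL2 P ℓ)).eq_or_lt' with h0 | h0
  · rw [h0, mul_zero]
    by_contra! hpos
    obtain ⟨n, hn⟩ := exists_nat_gt (b / ℓ (ι x))
    have := key ((n : ℝ) • ℓ) (by rw [map_smul, norm_smul, h0]; simp)
    rw [div_lt_iff₀ hpos] at hn
    simp only [_root_.smul_apply, smul_eq_mul] at this
    linarith
  · have := key (‖dualToL2 P ℓ‖⁻¹ • ℓ) (by
      rw [map_smul, norm_smul, norm_inv, norm_norm, inv_mul_cancel₀ h0.ne'])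
    simp only [_root_.smul_apply, smul_eq_mul] at this
    rwa [inv_mul_le_iff₀ h0, mul_comm] at this

theorem IsCameronMartin.abs_apply_le {P : Measure Ω} [IsGaussian P] {ι : NoiseSpace H₀ →L[ℝ] Ω}
    (hι : IsCameronMartin P ι) (x : NoiseSpace H₀) (ℓ : StrongDual ℝ Ω) :
    |ℓ (ι x)| ≤ ‖x‖ * ‖dualToL2 P ℓ‖ := by
  rw [abs_le']
  refine ⟨apply_le (hι.norm_eq x).1 ℓ, ?_⟩
  have := apply_le (hι.norm_eq x).1 (-ℓ)
  rwa [map_neg, norm_neg] at this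

theorem dualToL2_mem (P : Measure Ω) [IsGaussian P] (ℓ : StrongDual ℝ Ω) :
    dualToL2 P ℓ ∈ gaussianHilbert P :=
  Submodule.le_topologicalClosure _ ⟨ℓ, rfl⟩

theorem gaussianHilbert_induction {P : Measure Ω} [IsGaussian P] {p : Lp ℝ 2 P → Prop}
    (hp : IsClosed {g | p g}) (h : ∀ ℓ, p (dualToL2 P ℓ)) {g : Lp ℝ 2 P}
    (hg : g ∈ gaussianHilbert P) : p g := by
  have : closure (LinearMap.range (dualToL2 P) : Set (Lp ℝ 2 P)) ⊆ {g | p g} :=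
    closure_minimal (by rintro _ ⟨ℓ, rfl⟩; exact h ℓ) hp
  exact this hg

theorem eq_of_forall_inner_dualToL2 {P : Measure Ω} [IsGaussian P] {f g : Lp ℝ 2 P}
    (hf : f ∈ gaussianHilbert P) (hg : g ∈ gaussianHilbert P)
    (h : ∀ ℓ, inner ℝ f (dualToL2 P ℓ) = inner ℝ g (dualToL2 P ℓ)) : f = g := by
  have h1 : ∀ k ∈ gaussianHilbert P, inner ℝ (f - g) k = 0 := fun k hk =>
    gaussianHilbert_induction (p := fun k => inner ℝ (f - g) k = 0)
      (isClosed_eq (by fun_prop) (by fun_prop)) (fun ℓ => by rw [inner_sub_left, h, sub_self]) hk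
  rw [← sub_eq_zero]
  exact inner_self_eq_zero.1 (h1 _ (Submodule.sub_mem _ hf hg))

/-- By `abs_apply_le`, evaluation at `ι x` factors through `L²(P)` and is bounded there. Hahn-Banach
and Riesz represent it; projecting to the closure of the dual does not change the pairings. -/
theorem IsCameronMartin.exists_representative {P : Measure Ω} [IsGaussian P]
    {ι : NoiseSpace H₀ →L[ℝ] Ω} (hι : IsCameronMartin P ι) (x : NoiseSpace H₀) :
    ∃ g ∈ gaussianHilbert P, ∀ ℓ, inner ℝ g (dualToL2 P ℓ) = ℓ (ι x) := by
  obtain ⟨s, hs⟩ := LinearMap.exists_rightInverse_of_surjective (dualToL2 P).rangeRestrict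
    (LinearMap.range_rangeRestrict _)
  have hs' : ∀ k, dualToL2 P (s k) = k := fun k => congrArg Subtype.val (LinearMap.congr_fun hs k)
  let ev : StrongDual ℝ Ω →ₗ[ℝ] ℝ :=
    { toFun := fun ℓ => ℓ (ι x), map_add' := fun _ _ => rfl, map_smul' := fun _ _ => rfl }
  let φ : StrongDual ℝ (LinearMap.range (dualToL2 P)) :=
    LinearMap.mkContinuous (ev ∘ₗ s) ‖x‖ (fun k => by
      have := hι.abs_apply_le x (s k)
      rw [hs'] at this
      exact this)
  obtain ⟨ψ, hψ, -⟩ := exists_extension_norm_eq _ φ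
  set g₀ := (InnerProductSpace.toDual ℝ (Lp ℝ 2 P)).symm ψ with hg₀
  have : CompleteSpace (gaussianHilbert P) :=
    (Submodule.isClosed_topologicalClosure _).completeSpace_coe
  refine ⟨(gaussianHilbert P).orthogonalProjectionOnto g₀, Submodule.coe_mem _, fun ℓ => ?_⟩
  have h1 : inner ℝ ((gaussianHilbert P).orthogonalProjectionOnto g₀ : Lp ℝ 2 P) (dualToL2 P ℓ)
      = inner ℝ g₀ (dualToL2 P ℓ) := by
    have := Submodule.starProjection_inner_eq_zero (K := gaussianHilbert P) g₀ _ (dualToL2_mem P ℓ)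
    rw [inner_sub_left, sub_eq_zero] at this
    exact this.symm
  rw [h1, hg₀, InnerProductSpace.toDual_symm_apply]
  have h2 := hψ ⟨dualToL2 P ℓ, ℓ, rfl⟩
  rw [h2]
  -- Independence of the section `s`: functionals that agree in `L²(P)` agree at `ι x`.
  have h3 := hι.abs_apply_le x (s ⟨dualToL2 P ℓ, ℓ, rfl⟩ - ℓ)
  rw [map_sub, hs', sub_self, norm_zero, mul_zero] at h3
  exact sub_eq_zero.1 (abs_nonpos_iff.1 h3)

/-- Both norms are least upper bounds of the same set, one by definition of the Cameron-Martin norm,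
the other by density of the dual in its closure. -/
theorem IsCameronMartin.norm_representative {P : Measure Ω} [IsGaussian P]
    {ι : NoiseSpace H₀ →L[ℝ] Ω} (hι : IsCameronMartin P ι) {x : NoiseSpace H₀} {g : Lp ℝ 2 P}
    (hg : g ∈ gaussianHilbert P) (h : ∀ ℓ, inner ℝ g (dualToL2 P ℓ) = ℓ (ι x)) : ‖g‖ = ‖x‖ := by
  refine IsLUB.unique (s := {a : ℝ | ∃ ℓ : StrongDual ℝ Ω, ∫ ω', (ℓ ω') ^ 2 ∂P ≤ 1 ∧ a = ℓ (ι x)})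
    ⟨?_, fun b hb => ?_⟩ (hι.norm_eq x)
  · rintro _ ⟨ℓ, hℓ, rfl⟩
    rw [← h]
    rw [← norm_dualToL2_sq, sq_le_one_iff₀ (norm_nonneg _)] at hℓ
    exact (real_inner_le_norm _ _).trans (mul_le_of_le_one_right (norm_nonneg _) hℓ)
  · have hb0 : 0 ≤ b := hb ⟨0, by simp, by simp⟩
    have h1 := gaussianHilbert_induction (p := fun k => inner ℝ g k ≤ b * ‖k‖)
      (isClosed_le (by fun_prop) (by fun_prop)) (fun ℓ => by rw [h]; exact apply_le hb ℓ) hg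
    rw [real_inner_self_eq_norm_sq, sq] at h1
    rcases (norm_nonneg g).eq_or_lt' with h0 | h0
    · rwa [h0]
    · exact le_of_mul_le_mul_right h1 h0

theorem IsCameronMartin.exists_paleyWiener {P : Measure Ω} [IsGaussian P]
    {ι : NoiseSpace H₀ →L[ℝ] Ω} (hι : IsCameronMartin P ι) :
    ∃ W : NoiseSpace H₀ →ₗᵢ[ℝ] Lp ℝ 2 P, ∀ x, W x ∈ gaussianHilbert P ∧
      ∀ ℓ, inner ℝ (W x) (dualToL2 P ℓ) = ℓ (ι x) := by
  choose g hg hgℓ using hι.exists_representative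
  refine ⟨⟨⟨⟨g, fun x y => ?_⟩, fun c x => ?_⟩, fun x => hι.norm_representative (hg x) (hgℓ x)⟩,
    fun x => ⟨hg x, hgℓ x⟩⟩
  · refine eq_of_forall_inner_dualToL2 (hg _) (Submodule.add_mem _ (hg _) (hg _)) fun ℓ => ?_
    rw [inner_add_left, hgℓ, hgℓ, hgℓ, map_add, map_add]
  · refine eq_of_forall_inner_dualToL2 (hg _) (Submodule.smul_mem _ _ (hg _)) fun ℓ => ?_
    rw [real_inner_smul_left, hgℓ, hgℓ, map_smul, map_smul, smul_eq_mul, RingHom.id_apply]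

/-- The Paley-Wiener map, sending a Cameron-Martin vector to its measurable linear functional. -/
noncomputable def paleyWiener {P : Measure Ω} [IsGaussian P]
    {ι : NoiseSpace H₀ →L[ℝ] Ω} (hι : IsCameronMartin P ι) : NoiseSpace H₀ →ₗᵢ[ℝ] Lp ℝ 2 P :=
  hι.exists_paleyWiener.choose

theorem paleyWiener_mem {P : Measure Ω} [IsGaussian P] {ι : NoiseSpace H₀ →L[ℝ] Ω}
    (hι : IsCameronMartin P ι) (x : NoiseSpace H₀) : paleyWiener hι x ∈ gaussianHilbert P :=
  (hι.exists_paleyWiener.choose_spec x).1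

theorem inner_paleyWiener_dualToL2 {P : Measure Ω} [IsGaussian P] {ι : NoiseSpace H₀ →L[ℝ] Ω}
    (hι : IsCameronMartin P ι) (x : NoiseSpace H₀) (ℓ : StrongDual ℝ Ω) :
    inner ℝ (paleyWiener hι x) (dualToL2 P ℓ) = ℓ (ι x) :=
  (hι.exists_paleyWiener.choose_spec x).2 ℓ

/-! #### Gaussianity of the closure of the dual -/

theorem integral_cexp_gaussianHilbert {P : Measure Ω} [IsGaussian P]
    (hP : ∀ ℓ : StrongDual ℝ Ω, ∫ ω, ℓ ω ∂P = 0) {g : Lp ℝ 2 P} (hg : g ∈ gaussianHilbert P) :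
    ∫ ω, Complex.exp (g ω * Complex.I) ∂P = Complex.exp (-(‖g‖ ^ 2 / 2 : ℝ)) := by
  refine gaussianHilbert_induction
    (p := fun g => ∫ ω, Complex.exp (g ω * Complex.I) ∂P = Complex.exp (-(‖g‖ ^ 2 / 2 : ℝ)))
    (isClosed_eq ?_ (by fun_prop)) (fun ℓ => ?_) hg
  · refine (LipschitzWith.of_dist_le_mul (K := 1) fun f g => ?_).continuous
    rw [dist_eq_norm, dist_eq_norm, NNReal.coe_one, one_mul]
    exact norm_integral_cexp_sub_le f g
  · have h1 : ∫ ω, Complex.exp (dualToL2 P ℓ ω * Complex.I) ∂P = charFunDual P ℓ := by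
      rw [charFunDual_apply]
      refine integral_congr_ae ?_
      filter_upwards [coeFn_dualToL2 P ℓ] with ω h
      rw [h]
    rw [h1, IsGaussian.charFunDual_eq, integral_complex_ofReal, hP,
      variance_of_integral_eq_zero (by fun_prop) (hP ℓ), norm_dualToL2_sq]
    push_cast
    congr 1
    ring

theorem integral_cexp_smul_gaussianHilbert {P : Measure Ω} [IsGaussian P]
    (hP : ∀ ℓ : StrongDual ℝ Ω, ∫ ω, ℓ ω ∂P = 0) {f g : Lp ℝ 2 P} (hf : f ∈ gaussianHilbert P)
    (hg : g ∈ gaussianHilbert P) (s t : ℝ) :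
    ∫ ω, Complex.exp ((s * f ω + t * g ω : ℝ) * Complex.I) ∂P
      = Complex.exp (-(‖s • f + t • g‖ ^ 2 / 2 : ℝ)) := by
  rw [← integral_cexp_gaussianHilbert hP
    (Submodule.add_mem _ (Submodule.smul_mem _ s hf) (Submodule.smul_mem _ t hg))]
  refine integral_congr_ae ?_
  filter_upwards [Lp.coeFn_add (s • f) (t • g), Lp.coeFn_smul s f, Lp.coeFn_smul t g]
    with ω h1 h2 h3
  rw [h1, Pi.add_apply, h2, h3]
  simp

theorem map_gaussianHilbert {P : Measure Ω} [IsGaussian P]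
    (hP : ∀ ℓ : StrongDual ℝ Ω, ∫ ω, ℓ ω ∂P = 0) {g : Lp ℝ 2 P} (hg : g ∈ gaussianHilbert P) :
    P.map g = gaussianReal 0 (‖g‖₊ ^ 2) := by
  have := Measure.isFiniteMeasure_map P g
  refine Measure.ext_of_charFun (funext fun t => ?_)
  rw [charFun_gaussianReal, charFun_apply_real,
    integral_map (measurable_Lp g).aemeasurable (Measurable.aestronglyMeasurable (by fun_prop))]
  have := integral_cexp_smul_gaussianHilbert hP hg hg t 0
  simp only [zero_mul, add_zero, zero_smul, norm_smul] at this
  push_cast at this ⊢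
  rw [this]
  congr 1
  rw [mul_pow, ← Complex.ofReal_pow, ← Complex.ofReal_pow, Real.norm_eq_abs, sq_abs]
  push_cast
  ring

theorem indepFun_gaussianHilbert {P : Measure Ω} [IsGaussian P]
    (hP : ∀ ℓ : StrongDual ℝ Ω, ∫ ω, ℓ ω ∂P = 0) {f g : Lp ℝ 2 P} (hf : f ∈ gaussianHilbert P)
    (hg : g ∈ gaussianHilbert P) (hfg : inner ℝ f g = 0) : IndepFun f g P := by
  have mf := measurable_Lp f
  have mg := measurable_Lp g
  rw [indepFun_iff_charFun_prod mf.aemeasurable mg.aemeasurable]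
  intro t
  have h0 : ‖t.ofLp.1 • f + t.ofLp.2 • g‖ ^ 2 = ‖t.ofLp.1 • f‖ ^ 2 + ‖t.ofLp.2 • g‖ ^ 2 := by
    rw [norm_add_sq_real, real_inner_smul_left, real_inner_smul_right, hfg]; ring
  have h1 := integral_cexp_smul_gaussianHilbert hP hf hg t.ofLp.1 t.ofLp.2
  have h2 := integral_cexp_smul_gaussianHilbert hP hf hg t.ofLp.1 0
  have h3 := integral_cexp_smul_gaussianHilbert hP hf hg 0 t.ofLp.2
  rw [charFun_apply, charFun_apply_real, charFun_apply_real,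
    integral_map (by fun_prop) (Measurable.aestronglyMeasurable (by fun_prop)),
    integral_map (by fun_prop) (Measurable.aestronglyMeasurable (by fun_prop)),
    integral_map (by fun_prop) (Measurable.aestronglyMeasurable (by fun_prop))]
  rw [h0] at h1
  simp only [zero_mul, add_zero, zero_add, zero_smul] at h2 h3
  have e1 : ∀ ω, Complex.exp (((inner ℝ (WithLp.toLp 2 (f ω, g ω)) t : ℝ) : ℂ) * Complex.I)
      = Complex.exp ((t.ofLp.1 * f ω + t.ofLp.2 * g ω : ℝ) * Complex.I) := fun ω => by
    rw [WithLp.prod_inner_apply]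
    simp
  simp_rw [e1]
  simp_rw [Complex.ofReal_mul] at h2 h3
  rw [h1, h2, h3, ← Complex.exp_add]
  congr 1
  push_cast
  ring

/-- Splitting `f = y + c g` with `y ⟂ g` turns orthogonality into independence, and leaves a
one-dimensional Gaussian moment generating function at the complex point `1 + c i`. -/
theorem integral_cexp_dual_mul_exp {P : Measure Ω} [IsGaussian P]
    (hP : ∀ ℓ : StrongDual ℝ Ω, ∫ ω, ℓ ω ∂P = 0) {f g : Lp ℝ 2 P} (hf : f ∈ gaussianHilbert P)
    (hg : g ∈ gaussianHilbert P) :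
    ∫ ω, Complex.exp (f ω * Complex.I + g ω) ∂P
      = Complex.exp (-(‖f‖ ^ 2 / 2 : ℝ) + (‖g‖ ^ 2 / 2 : ℝ) + (inner ℝ f g : ℝ) * Complex.I) := by
  obtain ⟨c, hc⟩ : ∃ c : ℝ, inner ℝ f g = c * ‖g‖ ^ 2 := by
    rcases eq_or_ne g 0 with rfl | h
    · exact ⟨0, by simp⟩
    · exact ⟨inner ℝ f g / ‖g‖ ^ 2, by field_simp⟩
  set y : Lp ℝ 2 P := f - c • g with hy
  have hyR : y ∈ gaussianHilbert P := Submodule.sub_mem _ hf (Submodule.smul_mem _ c hg)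
  have hyg : inner ℝ y g = 0 := by
    rw [hy, inner_sub_left, real_inner_smul_left, real_inner_self_eq_norm_sq, hc, sub_self]
  have hind := indepFun_gaussianHilbert hP hyR hg hyg
  have mg := measurable_Lp g
  have my := measurable_Lp y
  have h1 : ∫ ω, Complex.exp (f ω * Complex.I + g ω) ∂P
      = ∫ ω, Complex.exp (y ω * Complex.I) * Complex.exp ((1 + c * Complex.I) * g ω) ∂P := by
    refine integral_congr_ae ?_
    filter_upwards [Lp.coeFn_sub f (c • g), Lp.coeFn_smul c g] with ω h2 h3
    rw [hy, h2, Pi.sub_apply, h3, ← Complex.exp_add]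
    congr 1
    simp
    ring
  have h2 : IndepFun (fun ω => Complex.exp (y ω * Complex.I))
      (fun ω => Complex.exp ((1 + c * Complex.I) * g ω)) P :=
    hind.comp (φ := fun s : ℝ => Complex.exp (s * Complex.I))
      (ψ := fun s : ℝ => Complex.exp ((1 + c * Complex.I) * s)) (by fun_prop) (by fun_prop)
  rw [h1, h2.integral_fun_mul_eq_mul_integral (Measurable.aestronglyMeasurable (by fun_prop))
    (Measurable.aestronglyMeasurable (by fun_prop)), integral_cexp_gaussianHilbert hP hyR]
  have h3 := complexMGF_gaussianReal (map_gaussianHilbert hP hg) (1 + c * Complex.I)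
  rw [complexMGF] at h3
  rw [h3, ← Complex.exp_add]
  have h4 : ‖f‖ ^ 2 = ‖y‖ ^ 2 + c ^ 2 * ‖g‖ ^ 2 := by
    have : f = y + c • g := by rw [hy]; abel
    rw [this, norm_add_sq_real, real_inner_smul_right, hyg, norm_smul, mul_pow, Real.norm_eq_abs,
      sq_abs]
    ring
  rw [h4, hc]
  congr 1
  push_cast
  have hI : Complex.I ^ 2 = -1 := Complex.I_sq
  linear_combination (c : ℂ) ^ 2 * (‖g‖ : ℂ) ^ 2 / 2 * hI

/-! ### The Cameron-Martin formula and the action of shifts on the past -/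

/-- **Cameron-Martin formula.** -/
theorem IsCameronMartin.map_add_eq_withDensity [SecondCountableTopology Ω] [CompleteSpace Ω]
    {P : Measure Ω} [IsGaussian P] {ι : NoiseSpace H₀ →L[ℝ] Ω} (hι : IsCameronMartin P ι)
    (x : NoiseSpace H₀) :
    P.map (fun ω => ω + ι x)
      = P.withDensity fun ω => ENNReal.ofReal (Real.exp (paleyWiener hι x ω - ‖x‖ ^ 2 / 2)) := by
  set g := paleyWiener hι x with hg
  have hgR : g ∈ gaussianHilbert P := paleyWiener_mem hι x
  have hgx : ‖g‖ = ‖x‖ := (paleyWiener hι).norm_map x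
  have mg := measurable_Lp g
  have hcexp := integral_cexp_dual_mul_exp hι.centered hgR hgR
  have hint : Integrable (fun ω => Real.exp (g ω - ‖x‖ ^ 2 / 2)) P := by
    have h1 := integrable_exp_mul_gaussianReal (μ := 0) (v := ‖g‖₊ ^ 2) 1
    rw [← map_gaussianHilbert hι.centered hgR, integrable_map_measure
      (Measurable.aestronglyMeasurable (by fun_prop)) (by fun_prop)] at h1
    simp_rw [Real.exp_sub]
    refine Integrable.div_const ?_ _
    simpa [Function.comp_def] using h1
  have := isFiniteMeasure_withDensity_ofReal hint.2
  have := Measure.isFiniteMeasure_map P (fun ω => ω + ι x)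
  refine Measure.ext_of_charFunDual (funext fun ℓ => ?_)
  rw [charFunDual_map_add_const, charFunDual_apply, charFunDual_apply,
    integral_withDensity_eq_integral_toReal_smul₀ (by fun_prop) (by simp)]
  have h1 : ∫ ω, (ENNReal.ofReal (Real.exp (g ω - ‖x‖ ^ 2 / 2))).toReal •
      Complex.exp ((ℓ ω : ℂ) * Complex.I) ∂P
      = ∫ ω, Complex.exp (-(‖x‖ ^ 2 / 2 : ℝ)) * Complex.exp (dualToL2 P ℓ ω * Complex.I + g ω) ∂P := by
    refine integral_congr_ae ?_
    filter_upwards [coeFn_dualToL2 P ℓ] with ω h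
    rw [h, ENNReal.toReal_ofReal (Real.exp_pos _).le, Complex.real_smul, Complex.ofReal_exp,
      ← Complex.exp_add, ← Complex.exp_add]
    congr 1
    push_cast
    ring
  have h2 : ∫ ω, Complex.exp ((ℓ ω : ℂ) * Complex.I) ∂P
      = ∫ ω, Complex.exp (dualToL2 P ℓ ω * Complex.I) ∂P := by
    refine integral_congr_ae ?_
    filter_upwards [coeFn_dualToL2 P ℓ] with ω h
    rw [h]
  rw [h1, h2, integral_const_mul, integral_cexp_dual_mul_exp hι.centered (dualToL2_mem P ℓ) hgR,
    integral_cexp_gaussianHilbert hι.centered (dualToL2_mem P ℓ), ← Complex.exp_add,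
    ← Complex.exp_add, real_inner_comm, hg, inner_paleyWiener_dualToL2, ← hg, hgx]
  congr 1
  push_cast
  ring

theorem IsCameronMartin.lintegral_add [SecondCountableTopology Ω] [CompleteSpace Ω]
    {P : Measure Ω} [IsGaussian P] {ι : NoiseSpace H₀ →L[ℝ] Ω} (hι : IsCameronMartin P ι)
    (x : NoiseSpace H₀) {f : Ω → ℝ≥0∞} (hf : Measurable f) :
    ∫⁻ ω, f (ω + ι x) ∂P
      = ∫⁻ ω, ENNReal.ofReal (Real.exp (paleyWiener hι x ω - ‖x‖ ^ 2 / 2)) * f ω ∂P := by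
  have mg := measurable_Lp (paleyWiener hι x)
  rw [← lintegral_map hf (by fun_prop), hι.map_add_eq_withDensity,
    lintegral_withDensity_eq_lintegral_mul _ (by fun_prop) hf]
  rfl

theorem IsCameronMartin.quasiMeasurePreserving_add [SecondCountableTopology Ω] [CompleteSpace Ω]
    {P : Measure Ω} [IsGaussian P] {ι : NoiseSpace H₀ →L[ℝ] Ω} (hι : IsCameronMartin P ι)
    (x : NoiseSpace H₀) : Measure.QuasiMeasurePreserving (fun ω => ω + ι x) P P :=
  ⟨by fun_prop, by
    rw [hι.map_add_eq_withDensity]; exact withDensity_absolutelyContinuous _ _⟩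

theorem ae_tendsto_of_mem_gaussianHilbert {P : Measure Ω} [IsGaussian P] {g : Lp ℝ 2 P}
    (hg : g ∈ gaussianHilbert P) : ∃ ℓ : ℕ → StrongDual ℝ Ω,
      Tendsto (fun n => dualToL2 P (ℓ n)) atTop (𝓝 g) ∧
      ∀ᵐ ω ∂P, Tendsto (fun n => ℓ n ω) atTop (𝓝 (g ω)) := by
  obtain ⟨u, hu, hlim⟩ := mem_closure_iff_seq_limit.1
    (show g ∈ closure (LinearMap.range (dualToL2 P) : Set (Lp ℝ 2 P)) from hg)
  choose ℓ hℓ using hu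
  obtain rfl : (fun n => dualToL2 P (ℓ n)) = u := funext hℓ
  have h1 := (Lp.tendsto_Lp_iff_tendsto_eLpNorm' _ _).1 hlim
  obtain ⟨ns, hns, hae⟩ := (tendstoInMeasure_of_tendsto_eLpNorm (by norm_num)
    (fun n => Lp.aestronglyMeasurable _) (Lp.aestronglyMeasurable _) h1).exists_seq_tendsto_ae
  refine ⟨fun n => ℓ (ns n), hlim.comp hns.tendsto_atTop, ?_⟩
  have h2 : ∀ᵐ ω ∂P, ∀ n, dualToL2 P (ℓ n) ω = ℓ n ω := ae_all_iff.2 fun n => coeFn_dualToL2 P _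
  filter_upwards [hae, h2] with ω h3 h4
  simpa only [h4] using h3

/-- The identity is exact for continuous functionals and passes to an almost sure limit. Convergence
at `ω + ι x` uses that shifts preserve null sets. -/
theorem IsCameronMartin.paleyWiener_add [SecondCountableTopology Ω] [CompleteSpace Ω]
    {P : Measure Ω} [IsGaussian P] {ι : NoiseSpace H₀ →L[ℝ] Ω} (hι : IsCameronMartin P ι)
    (x y : NoiseSpace H₀) :
    ∀ᵐ ω ∂P, paleyWiener hι y (ω + ι x) = paleyWiener hι y ω + inner ℝ x y := by
  obtain ⟨ℓ, hlim, hae⟩ := ae_tendsto_of_mem_gaussianHilbert (paleyWiener_mem hι y)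
  have h1 : Tendsto (fun n => ℓ n (ι x)) atTop (𝓝 (inner ℝ x y)) := by
    rw [← (paleyWiener hι).inner_map_map]
    simp_rw [← inner_paleyWiener_dualToL2 hι]
    exact tendsto_const_nhds.inner hlim
  filter_upwards [hae, (hι.quasiMeasurePreserving_add x).ae hae] with ω h2 h3
  refine tendsto_nhds_unique h3 ?_
  simpa only [map_add] using h2.add h1

theorem IsMeasurableFunctional.ae_eq_paleyWiener {P : Measure Ω} [IsGaussian P]
    {ι : NoiseSpace H₀ →L[ℝ] Ω} (hι : IsCameronMartin P ι) {h : NoiseSpace H₀} {f : Ω → ℝ}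
    (hf : IsMeasurableFunctional P ι h f) : f =ᵐ[P] paleyWiener hι h := by
  obtain ⟨ℓ, hℓ⟩ := hf.mem_closure
  have hL2 : MemLp f 2 P := by
    obtain ⟨n, hn⟩ := (hℓ.eventually (gt_mem_nhds (by norm_num : (0 : ℝ≥0∞) < 1))).exists
    have h1 : MemLp (fun ω => ℓ n ω - f ω) 2 P :=
      ⟨((ℓ n).continuous.measurable.aemeasurable.sub hf.aemeasurable).aestronglyMeasurable,
        hn.trans (by simp)⟩
    have h2 := (IsGaussian.memLp_dual P (ℓ n) 2 (by simp)).sub h1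
    have : (⇑(ℓ n) - fun ω => ℓ n ω - f ω) = f := by ext; simp
    rwa [this] at h2
  have hmem : hL2.toLp f ∈ gaussianHilbert P := by
    refine mem_closure_of_tendsto (f := fun n => dualToL2 P (ℓ n)) (b := atTop) ?_
      (Eventually.of_forall fun n => ⟨ℓ n, rfl⟩)
    rw [Lp.tendsto_Lp_iff_tendsto_eLpNorm']
    refine hℓ.congr fun n => eLpNorm_congr_ae ?_
    filter_upwards [coeFn_dualToL2 P (ℓ n), hL2.coeFn_toLp] with ω h1 h2
    simp [h1, h2]
  have heq : hL2.toLp f = paleyWiener hι h := by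
    refine eq_of_forall_inner_dualToL2 hmem (paleyWiener_mem hι h) fun ℓ => ?_
    rw [inner_paleyWiener_dualToL2, ← hf.covariance, inner_eq_integral]
    refine integral_congr_ae ?_
    filter_upwards [coeFn_dualToL2 P ℓ, hL2.coeFn_toLp] with ω h1 h2
    rw [h1, h2]
  rw [← heq]
  exact hL2.coeFn_toLp.symm

/-- A shift living after `t` is orthogonal to every `h` living before `t`, so it changes no
generator of `𝓕_t` beyond a null set. -/
theorem pastSigmaAlgebra_add [SecondCountableTopology Ω] [CompleteSpace Ω]
    {P : Measure Ω} [IsGaussian P] {ι : NoiseSpace H₀ →L[ℝ] Ω} (hι : IsCameronMartin P ι)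
    {t : ℝ} {x : NoiseSpace H₀} (hx : ∀ᵐ s : ℝ, s ≤ t → x s = 0) {S : Set Ω}
    (hS : MeasurableSet[pastSigmaAlgebra P ι t] S) : ∀ᵐ ω ∂P, ω + ι x ∈ S ↔ ω ∈ S := by
  induction S, hS using MeasurableSpace.generateFrom_induction with
  | hC S hS =>
    obtain ⟨h, f, B, hh, hf, -, rfl⟩ := hS
    have h0 : inner ℝ x h = 0 := by
      rw [L2.inner_def]
      refine integral_eq_zero_of_ae ?_
      filter_upwards [hx, hh] with s h1 h2
      rcases le_or_gt s t with h3 | h3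
      · simp [h1 h3]
      · simp [h2 h3]
    have h1 := hf.ae_eq_paleyWiener hι
    filter_upwards [h1, (hι.quasiMeasurePreserving_add x).ae h1, hι.paleyWiener_add x h]
      with ω h2 h3 h4
    rw [mem_preimage, mem_preimage, h3, h4, h0, add_zero, h2]
  | empty => simp
  | compl S _ ih =>
    filter_upwards [ih] with ω h
    simp only [mem_compl_iff, h]
  | iUnion S _ ih =>
    filter_upwards [ae_all_iff.2 ih] with ω h
    simp only [mem_iUnion, h]

end PaleyWiener

/-! ### A discrete Girsanov formula -/

section Girsanov

variable {Ω H₀ : Type*} [NormedAddCommGroup Ω] [NormedSpace ℝ Ω] [MeasurableSpace Ω] [BorelSpace Ω]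
  [NormedAddCommGroup H₀] [InnerProductSpace ℝ H₀]

theorem IsCameronMartin.lintegral_add_mul [SecondCountableTopology Ω] [CompleteSpace Ω] 
    {P : Measure Ω} [IsGaussian P]
    {ι : NoiseSpace H₀ →L[ℝ] Ω} (hι : IsCameronMartin P ι)
    (x : NoiseSpace H₀) {f : Ω → ℝ≥0∞} (hf : Measurable f) :
    ∫⁻ ω, ENNReal.ofReal (Real.exp (-paleyWiener hι x ω - ‖x‖ ^ 2 / 2)) * f (ω + ι x) ∂P
      = ∫⁻ ω, f ω ∂P := by
  have mg := measurable_Lp (paleyWiener hι x)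
  have h := hι.lintegral_add x
    (f := fun ω => ENNReal.ofReal (Real.exp (-paleyWiener hι x ω + ‖x‖ ^ 2 / 2)) * f ω)
    (by fun_prop)
  have h1 : ∀ ω, ENNReal.ofReal (Real.exp (paleyWiener hι x ω - ‖x‖ ^ 2 / 2)) *
      (ENNReal.ofReal (Real.exp (-paleyWiener hι x ω + ‖x‖ ^ 2 / 2)) * f ω) = f ω := fun ω => by
    rw [← mul_assoc, ← ENNReal.ofReal_mul (Real.exp_pos _).le, ← Real.exp_add]
    simp
  simp_rw [h1] at h
  rw [← h]
  refine lintegral_congr_ae ?_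
  filter_upwards [hι.paleyWiener_add x x] with ω h2
  rw [h2, real_inner_self_eq_norm_sq]
  congr 3
  ring

/-- A countably valued piecewise constant shift, chosen adaptedly: the `i`-th block is
`e i (κ i ω)`, and none of the first `k + 1` choices is affected by the `k`-th block. -/
structure IsAdaptedShift (P : Measure Ω) (ι : NoiseSpace H₀ →L[ℝ] Ω)
    (e : ℕ → ℕ → NoiseSpace H₀) (κ : ℕ → Ω → ℕ) : Prop where
  measurable : ∀ i, Measurable (κ i)
  orthogonal : ∀ i k, i < k → ∀ m n, inner ℝ (e i m) (e k n) = 0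
  invariant : ∀ i k, i ≤ k → ∀ n, ∀ᵐ ω ∂P, κ i (ω + ι (e k n)) = κ i ω

/-- The sum of the first `k` blocks of a shift. -/
noncomputable def blockSum {V : Type*} [AddCommMonoid V] (e : ℕ → ℕ → V) (κ : ℕ → Ω → ℕ) (k : ℕ)
    (ω : Ω) : V :=
  ∑ i ∈ Finset.range k, e i (κ i ω)

/-- The logarithm of the Girsanov density of a shift. -/
noncomputable def girsanovExponent {P : Measure Ω} [IsGaussian P]
    {ι : NoiseSpace H₀ →L[ℝ] Ω} (hι : IsCameronMartin P ι) (e : ℕ → ℕ → NoiseSpace H₀)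
    (κ : ℕ → Ω → ℕ) (k : ℕ) (ω : Ω) : ℝ :=
  ∑ i ∈ Finset.range k, (-paleyWiener hι (e i (κ i ω)) ω - ‖e i (κ i ω)‖ ^ 2 / 2)

theorem measurable_eval_nat {α β : Type*} [MeasurableSpace α] [MeasurableSpace β] {f : ℕ → α → β}
    (hf : ∀ n, Measurable (f n)) {κ : α → ℕ} (hκ : Measurable κ) :
    Measurable fun ω => f (κ ω) ω :=
  (measurable_from_prod_countable_left (f := fun q : α × ℕ => f q.2 q.1) hf).comp
    (measurable_id.prodMk hκ)

theorem measurable_blockSum [SecondCountableTopology Ω] (ι : NoiseSpace H₀ →L[ℝ] Ω) {e : ℕ → ℕ → NoiseSpace H₀}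
    {κ : ℕ → Ω → ℕ} (hκ : ∀ i, Measurable (κ i)) (k : ℕ) :
    Measurable fun ω => ι (blockSum e κ k ω) := by
  simp_rw [blockSum, map_sum]
  exact Finset.measurable_sum _ fun i _ => (measurable_of_countable fun n => ι (e i n)).comp (hκ i)

theorem measurable_girsanovExponent {P : Measure Ω} [IsGaussian P]
    {ι : NoiseSpace H₀ →L[ℝ] Ω} (hι : IsCameronMartin P ι) {e : ℕ → ℕ → NoiseSpace H₀}
    {κ : ℕ → Ω → ℕ} (hκ : ∀ i, Measurable (κ i)) (k : ℕ) :
    Measurable (girsanovExponent hι e κ k) := by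
  unfold girsanovExponent
  refine Finset.measurable_fun_sum _ fun i _ => ?_
  refine measurable_eval_nat (f := fun n ω => -paleyWiener hι (e i n) ω - ‖e i n‖ ^ 2 / 2)
    (fun n => ?_) (hκ i)
  have := measurable_Lp (paleyWiener hι (e i n))
  fun_prop

/-- Induction on the number of blocks. On the event `κ k = n` the last block is the deterministic
shift `e k n`, to which Cameron-Martin applies; earlier choices are invariant under it, and earlier
Paley-Wiener integrals too, by orthogonality. -/
theorem IsAdaptedShift.lintegral_girsanov [SecondCountableTopology Ω] [CompleteSpace Ω] 
    {P : Measure Ω} [IsGaussian P]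
    {ι : NoiseSpace H₀ →L[ℝ] Ω} (hι : IsCameronMartin P ι) {e : ℕ → ℕ → NoiseSpace H₀}
    {κ : ℕ → Ω → ℕ} (h : IsAdaptedShift P ι e κ) {f : Ω → ℝ≥0∞} (hf : Measurable f) (k : ℕ) :
    ∫⁻ ω, ENNReal.ofReal (Real.exp (girsanovExponent hι e κ k ω)) * f (ω + ι (blockSum e κ k ω)) ∂P
      = ∫⁻ ω, f ω ∂P := by
  induction k with
  | zero => simp [girsanovExponent, blockSum]
  | succ k ih =>
    have mb := measurable_blockSum ι (e := e) h.measurable k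
    have mG := measurable_girsanovExponent hι (e := e) h.measurable k
    set F : Ω → ℝ≥0∞ := fun ω => ENNReal.ofReal (Real.exp (girsanovExponent hι e κ k ω)) *
      f (ω + ι (blockSum e κ k ω)) with hF
    have mF : Measurable F := by
      have : Measurable fun ω => f (ω + ι (blockSum e κ k ω)) :=
        hf.comp (measurable_id.add mb)
      exact mG.exp.ennreal_ofReal.mul this
    have mset : ∀ n, MeasurableSet {ω | κ k ω = n} := fun n =>
      h.measurable k (measurableSet_singleton n)
    have split : ∀ G : Ω → ℝ≥0∞, Measurable G →
        ∫⁻ ω, G ω ∂P = ∑' n, ∫⁻ ω, {ω | κ k ω = n}.indicator G ω ∂P := by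
      intro G hG
      rw [← lintegral_tsum fun n => (hG.indicator (mset n)).aemeasurable]
      refine lintegral_congr fun ω => ?_
      rw [tsum_eq_single (κ k ω) fun n hn => indicator_of_notMem (by simpa using hn.symm) _]
      simp
    rw [← ih, split F mF, split]
    swap
    · have mG' := measurable_girsanovExponent hι (e := e) h.measurable (k + 1)
      have : Measurable fun ω => f (ω + ι (blockSum e κ (k + 1) ω)) :=
        hf.comp (measurable_id.add (measurable_blockSum ι (e := e) h.measurable (k + 1)))
      exact mG'.exp.ennreal_ofReal.mul this
    refine tsum_congr fun n => ?_
    rw [← hι.lintegral_add_mul (e k n) (mF.indicator (mset n))]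
    refine lintegral_congr_ae ?_
    have h1 : ∀ᵐ ω ∂P, ∀ i ≤ k, κ i (ω + ι (e k n)) = κ i ω := by
      rw [ae_all_iff]; intro i
      rw [eventually_imp_distrib_left]
      exact fun hi => h.invariant i k hi n
    have h2 : ∀ᵐ ω ∂P, ∀ i < k, ∀ m,
        paleyWiener hι (e i m) (ω + ι (e k n)) = paleyWiener hι (e i m) ω := by
      rw [ae_all_iff]; intro i
      rw [eventually_imp_distrib_left]
      intro hi
      rw [ae_all_iff]
      intro m
      filter_upwards [hι.paleyWiener_add (e k n) (e i m)] with ω hω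
      rw [hω, real_inner_comm, h.orthogonal i k hi, add_zero]
    filter_upwards [h1, h2] with ω h1 h2
    have hk := h1 k le_rfl
    by_cases hn : κ k ω = n
    · rw [indicator_of_mem (by simpa using hn), indicator_of_mem (by simpa [hk] using hn)]
      have hs : blockSum e κ k (ω + ι (e k n)) = blockSum e κ k ω :=
        Finset.sum_congr rfl fun i hi => by rw [h1 i (Finset.mem_range.1 hi).le]
      have hg : girsanovExponent hι e κ k (ω + ι (e k n)) = girsanovExponent hι e κ k ω :=
        Finset.sum_congr rfl fun i hi => by
          rw [h1 i (Finset.mem_range.1 hi).le, h2 i (Finset.mem_range.1 hi)]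
      simp only [hF, hs, hg]
      rw [← mul_assoc, ← ENNReal.ofReal_mul (Real.exp_pos _).le, ← Real.exp_add]
      simp only [girsanovExponent, blockSum, Finset.sum_range_succ, hn, map_add]
      congr 2
      · rw [add_comm]
      · abel_nf
    · rw [indicator_of_notMem (by simpa using hn), indicator_of_notMem (by simpa [hk] using hn),
        mul_zero]

theorem IsAdaptedShift.neg [SecondCountableTopology Ω] [CompleteSpace Ω] 
    {P : Measure Ω} [IsGaussian P]
    {ι : NoiseSpace H₀ →L[ℝ] Ω} (hι : IsCameronMartin P ι) {e : ℕ → ℕ → NoiseSpace H₀}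
    {κ : ℕ → Ω → ℕ} (h : IsAdaptedShift P ι e κ) :
    IsAdaptedShift P ι (fun i n => -e i n) κ where
  measurable := h.measurable
  orthogonal i k hik m n := by rw [inner_neg_neg, h.orthogonal i k hik]
  invariant i k hik n := by
    filter_upwards [(hι.quasiMeasurePreserving_add (-e k n)).ae (h.invariant i k hik n)] with ω hω
    rw [← hω, map_neg, neg_add_cancel_right]

/-- Shifts of bounded energy do not increase the measure of small sets too much. -/
theorem IsAdaptedShift.measure_shift_le [SecondCountableTopology Ω] [CompleteSpace Ω] 
    {P : Measure Ω} [IsGaussian P]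
    {ι : NoiseSpace H₀ →L[ℝ] Ω} (hι : IsCameronMartin P ι) {e : ℕ → ℕ → NoiseSpace H₀}
    {κ : ℕ → Ω → ℕ} (h : IsAdaptedShift P ι e κ) {k : ℕ} {R : ℝ}
    (hR : ∀ ω, ∑ i ∈ Finset.range k, ‖e i (κ i ω)‖ ^ 2 ≤ R) {S : Set Ω} (hS : MeasurableSet S) :
    P {ω | ω + ι (blockSum e κ k ω) ∈ S} ≤ ENNReal.ofReal (Real.exp (R / 2)) * P S ^ (1 / 2 : ℝ) := by
  have mb := measurable_blockSum ι (e := e) h.measurable k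
  have mG := measurable_girsanovExponent hι (e := e) h.measurable k
  set T : Set Ω := {ω | ω + ι (blockSum e κ k ω) ∈ S} with hT
  have mT : MeasurableSet T := measurableSet_preimage (measurable_id.add mb) hS
  set g := girsanovExponent hι e κ k with hg
  have h1 : ∫⁻ ω, (T.indicator (fun ω => ENNReal.ofReal (Real.exp (g ω / 2))) ω) ^ (2 : ℝ) ∂P
      = P S := by
    have := h.lintegral_girsanov hι (f := S.indicator 1) (measurable_one.indicator hS) k
    rw [lintegral_indicator_one hS] at this
    rw [← this]
    refine lintegral_congr fun ω => ?_
    by_cases hω : ω ∈ T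
    · have : ω + ι (blockSum e κ k ω) ∈ S := hω
      rw [indicator_of_mem hω, indicator_of_mem this, Pi.one_apply, mul_one,
        ENNReal.ofReal_rpow_of_pos (Real.exp_pos _), ← Real.exp_mul]
      congr 2
      ring
    · have : ω + ι (blockSum e κ k ω) ∉ S := hω
      rw [indicator_of_notMem hω, indicator_of_notMem this, mul_zero,
        ENNReal.zero_rpow_of_pos (by norm_num)]
  -- `-g` is the Girsanov exponent of the opposite shift plus the total energy, and the density of
  -- the opposite shift has integral `1`.
  have h2 : ∫⁻ ω, (ENNReal.ofReal (Real.exp (-(g ω) / 2))) ^ (2 : ℝ) ∂P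
      ≤ ENNReal.ofReal (Real.exp R) := by
    have := (h.neg hι).lintegral_girsanov hι (f := 1) measurable_one k
    simp only [Pi.one_apply, mul_one, lintegral_one, measure_univ] at this
    calc _ ≤ ∫⁻ ω, ENNReal.ofReal (Real.exp R) * ENNReal.ofReal (Real.exp
            (girsanovExponent hι (fun i n => -e i n) κ k ω)) ∂P := by
          refine lintegral_mono_ae ?_
          have hneg : ∀ᵐ ω ∂P, ∀ i n, paleyWiener hι (-e i n) ω = -paleyWiener hι (e i n) ω := by
            simp_rw [ae_all_iff]
            intro i n
            rw [map_neg]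
            exact Lp.coeFn_neg _
          filter_upwards [hneg] with ω hω
          rw [← ENNReal.ofReal_mul (Real.exp_pos _).le, ← Real.exp_add,
            ENNReal.ofReal_rpow_of_pos (Real.exp_pos _), ← Real.exp_mul]
          refine ENNReal.ofReal_le_ofReal (Real.exp_le_exp.2 ?_)
          simp only [hg, girsanovExponent, hω, norm_neg, neg_neg]
          have h3 := hR ω
          simp only [Finset.sum_sub_distrib, Finset.sum_neg_distrib, ← Finset.sum_div]
          linarith
      _ = _ := by rw [lintegral_const_mul' _ _ ENNReal.ofReal_ne_top, this, mul_one]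
  -- Cauchy-Schwarz for `1_T = (1_T e^{g/2}) · e^{-g/2}`; the first factor has squared norm `P S` by
  -- Girsanov's formula.
  calc P T = ∫⁻ ω, (T.indicator (fun ω => ENNReal.ofReal (Real.exp (g ω / 2))) *
          fun ω => ENNReal.ofReal (Real.exp (-(g ω) / 2))) ω ∂P := by
        rw [← lintegral_indicator_one mT]
        refine lintegral_congr fun ω => ?_
        by_cases hω : ω ∈ T
        · rw [Pi.mul_apply, indicator_of_mem hω, indicator_of_mem hω,
            ← ENNReal.ofReal_mul (Real.exp_pos _).le, ← Real.exp_add]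
          ring_nf
          simp
        · simp [hω]
    _ ≤ _ := ENNReal.lintegral_mul_le_Lp_mul_Lq P (by
          constructor <;> norm_num : (2 : ℝ).HolderConjugate 2)
          ((by fun_prop : Measurable fun ω => ENNReal.ofReal (Real.exp (g ω / 2))).indicator
            mT).aemeasurable (by fun_prop)
    _ ≤ P S ^ (1 / 2 : ℝ) * ENNReal.ofReal (Real.exp R) ^ (1 / 2 : ℝ) := by
        rw [h1]
        gcongr
    _ = _ := by
        rw [mul_comm, ENNReal.ofReal_rpow_of_pos (Real.exp_pos _), ← Real.exp_mul]
        congr 3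
        ring

end Girsanov

/-! ### Cutting and delaying shifts -/

section Shifts

/-- Multiplication by the indicator of a set, on `L^p`. -/
noncomputable def cut {α X : Type*} [MeasurableSpace α] {μ : Measure α} [NormedAddCommGroup X]
    {p : ℝ≥0∞} {S : Set α} (hS : MeasurableSet S) : Lp X p μ →+ Lp X p μ :=
  AddMonoidHom.mk' (fun h => ((Lp.memLp h).indicator hS).toLp) fun h k => by
    refine Lp.ext ?_
    filter_upwards [((Lp.memLp h).indicator hS).coeFn_toLp, ((Lp.memLp k).indicator hS).coeFn_toLp,
      ((Lp.memLp (h + k)).indicator hS).coeFn_toLp, Lp.coeFn_add h k,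
      Lp.coeFn_add ((Lp.memLp h).indicator hS).toLp ((Lp.memLp k).indicator hS).toLp]
      with x h1 h2 h3 h4 h5
    rw [h3, h5, Pi.add_apply, h1, h2]
    by_cases hx : x ∈ S
    · rw [indicator_of_mem hx, indicator_of_mem hx, indicator_of_mem hx, h4, Pi.add_apply]
    · simp only [indicator_of_notMem hx, add_zero]

theorem coeFn_cut {α X : Type*} [MeasurableSpace α] {μ : Measure α} [NormedAddCommGroup X]
    {p : ℝ≥0∞} {S : Set α} (hS : MeasurableSet S) (h : Lp X p μ) :
    cut hS h =ᵐ[μ] S.indicator h := ((Lp.memLp h).indicator hS).coeFn_toLp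

theorem norm_cut_le {α X : Type*} [MeasurableSpace α] {μ : Measure α} [NormedAddCommGroup X]
    {p : ℝ≥0∞} {S : Set α} (hS : MeasurableSet S) (h : Lp X p μ) : ‖cut hS h‖ ≤ ‖h‖ := by
  refine Lp.norm_le_norm_of_ae_le ?_
  filter_upwards [coeFn_cut hS h] with x hx
  rw [hx]
  exact norm_indicator_le_norm_self _ _

variable {X : Type*} [NormedAddCommGroup X] {p : ℝ≥0∞}

theorem memLp_indicator_unit (h : ShiftSpace X p) :
    MemLp ((Icc (0 : ℝ) 1).indicator h) p (volume : Measure ℝ) :=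
  (memLp_indicator_iff_restrict measurableSet_Icc).2 (Lp.memLp h)

theorem ae_add_unit (h k : ShiftSpace X p) :
    ∀ᵐ x : ℝ, x ∈ Icc (0 : ℝ) 1 → (h + k : ShiftSpace X p) x = h x + k x := by
  have := Lp.coeFn_add h k
  rwa [Filter.EventuallyEq, ae_restrict_iff' measurableSet_Icc] at this

/-- Extension by zero from `[0, 1]` to the real line. -/
noncomputable def extendZero : ShiftSpace X p →+ Lp X p (volume : Measure ℝ) :=
  AddMonoidHom.mk' (fun h => (memLp_indicator_unit h).toLp) fun h k => by
    refine Lp.ext ?_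
    filter_upwards [(memLp_indicator_unit h).coeFn_toLp, (memLp_indicator_unit k).coeFn_toLp,
      (memLp_indicator_unit (h + k)).coeFn_toLp, ae_add_unit h k,
      Lp.coeFn_add (memLp_indicator_unit h).toLp (memLp_indicator_unit k).toLp]
      with x h1 h2 h3 h4 h5
    rw [h3, h5, Pi.add_apply, h1, h2]
    by_cases hx : x ∈ Icc (0 : ℝ) 1
    · rw [indicator_of_mem hx, indicator_of_mem hx, indicator_of_mem hx, h4 hx]
    · simp only [indicator_of_notMem hx, add_zero]

theorem coeFn_extendZero (h : ShiftSpace X p) :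
    extendZero h =ᵐ[volume] (Icc (0 : ℝ) 1).indicator h := (memLp_indicator_unit h).coeFn_toLp

theorem norm_extendZero (h : ShiftSpace X p) : ‖extendZero h‖ = ‖h‖ := by
  have : extendZero h = (memLp_indicator_unit h).toLp := rfl
  rw [this, Lp.norm_toLp, eLpNorm_indicator_eq_eLpNorm_restrict measurableSet_Icc, Lp.norm_def]

variable [NormedSpace ℝ X] [Fact (1 ≤ p)]

/-- The shift delayed by `s`. -/
noncomputable def delay (s : ℝ) : ShiftSpace X p →+ ShiftSpace X p :=
  ((LpToLpRestrictCLM ℝ X ℝ volume p (Icc (0 : ℝ) 1)).toLinearMap.toAddMonoidHom.comp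
    (Lp.compMeasurePreserving (fun x => x - s) (measurePreserving_sub_right volume s))).comp
      extendZero

theorem coeFn_delay (s : ℝ) (h : ShiftSpace X p) :
    ∀ᵐ x : ℝ, x ∈ Icc (0 : ℝ) 1 → delay s h x = (Icc (0 : ℝ) 1).indicator h (x - s) := by
  have h1 := LpToLpRestrictCLM_coeFn ℝ (Icc (0 : ℝ) 1)
    (Lp.compMeasurePreserving (fun x => x - s) (measurePreserving_sub_right volume s)
      (extendZero h))
  rw [Filter.EventuallyEq, ae_restrict_iff' measurableSet_Icc] at h1
  have h2 := Lp.coeFn_compMeasurePreserving (extendZero h) (measurePreserving_sub_right volume s)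
  have h3 := (measurePreserving_sub_right (volume : Measure ℝ) s).quasiMeasurePreserving.ae
    (coeFn_extendZero h)
  filter_upwards [h1, h2, h3] with x h4 h5 h6 hx
  rw [← h6]
  exact (h4 hx).trans h5

theorem norm_delay_le (s : ℝ) (h : ShiftSpace X p) : ‖delay s h‖ ≤ ‖h‖ := by
  have h1 : ‖delay s h‖ ≤ ‖Lp.compMeasurePreserving (fun x => x - s)
      (measurePreserving_sub_right volume s) (extendZero h)‖ := by
    rw [Lp.norm_def, Lp.norm_def]
    refine ENNReal.toReal_mono (Lp.eLpNorm_ne_top _) ?_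
    refine (eLpNorm_congr_ae (LpToLpRestrictCLM_coeFn ℝ (Icc (0 : ℝ) 1) _)).trans_le ?_
    exact eLpNorm_mono_measure _ Measure.restrict_le_self
  rwa [Lp.norm_compMeasurePreserving, norm_extendZero] at h1

theorem delay_zero (h : ShiftSpace X p) : delay 0 h = h := by
  refine Lp.ext ?_
  rw [Filter.EventuallyEq, ae_restrict_iff' measurableSet_Icc]
  filter_upwards [coeFn_delay 0 h] with x hx hx1
  rw [hx hx1, sub_zero, indicator_of_mem hx1]

/-- Translations are continuous in `L^p` for `p < ∞`, so the delay disappears in the limit. -/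
theorem tendsto_delay (hp : p ≠ ∞) (h : ShiftSpace X p) :
    Tendsto (fun n : ℕ => delay (1 / n) h) atTop (𝓝 h) := by
  have hc : Continuous fun s : ℝ => delay s h := by
    refine (LpToLpRestrictCLM ℝ X ℝ volume p (Icc (0 : ℝ) 1)).continuous.comp ?_
    exact Continuous.compMeasurePreservingLp (f := fun _ : ℝ => extendZero h)
      (g := fun s => (ContinuousMap.mk (fun q : ℝ × ℝ => q.2 - q.1) (by fun_prop)).curry s)
      continuous_const (ContinuousMap.continuous _)
      (fun s => measurePreserving_sub_right volume s) hp
  have := (hc.tendsto 0).comp tendsto_one_div_atTop_nhds_zero_nat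
  rwa [delay_zero] at this

/-- The part in `(k / N, (k + 1) / N]` of the shift delayed by `1 / N`. -/
noncomputable def delayedBlock (N k : ℕ) : ShiftSpace X p →+ ShiftSpace X p :=
  (cut (measurableSet_Ioc (a := (k / N : ℝ)) (b := ((k + 1 : ℕ) / N : ℝ)))).comp (delay (1 / N))

theorem norm_delayedBlock_le (N k : ℕ) (h : ShiftSpace X p) : ‖delayedBlock N k h‖ ≤ ‖h‖ :=
  (norm_cut_le measurableSet_Ioc _).trans (norm_delay_le _ _)

theorem continuous_delayedBlock (N k : ℕ) :
    Continuous fun h : ShiftSpace X p => delayedBlock N k h := by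
  refine (LipschitzWith.of_dist_le_mul (K := 1) fun h h' => ?_).continuous
  rw [NNReal.coe_one, one_mul, dist_eq_norm, dist_eq_norm, ← map_sub]
  exact norm_delayedBlock_le N k (h - h')

omit [NormedSpace ℝ X] [Fact (1 ≤ p)] in
theorem vanishesOn_iff {h : ShiftSpace X p} {s t : ℝ} :
    VanishesOn h s t ↔ ∀ᵐ x : ℝ, x ∈ Icc (0 : ℝ) 1 → x ∈ Icc s t → h x = 0 := by
  rw [VanishesOn, ae_restrict_iff' measurableSet_Icc]

/-- After a delay by one mesh width, the block over `(k/N, (k+1)/N]` sees `h` only on `[0, k/N]`.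
This makes the choice of a block insensitive to that block and to later ones. -/
theorem delayedBlock_eq_zero {N k : ℕ} (hN : 0 < N) {h : ShiftSpace X p}
    (hh : VanishesOn h 0 (k / N)) : delayedBlock N k h = 0 := by
  have hN' : (0 : ℝ) < N := by exact_mod_cast hN
  refine Lp.ext ?_
  have h0 := coeFn_cut (measurableSet_Ioc (a := (k / N : ℝ)) (b := ((k + 1 : ℕ) / N : ℝ)))
    (delay (1 / N) h)
  have h2 := (measurePreserving_sub_right (volume : Measure ℝ) (1 / N)).quasiMeasurePreserving.ae
    (vanishesOn_iff.1 hh)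
  rw [Filter.EventuallyEq, ae_restrict_iff' measurableSet_Icc] at h0
  have h3 := Lp.coeFn_zero X p (volume.restrict (Icc (0 : ℝ) 1))
  rw [Filter.EventuallyEq, ae_restrict_iff' measurableSet_Icc] at h3
  rw [Filter.EventuallyEq, ae_restrict_iff' measurableSet_Icc]
  filter_upwards [h0, coeFn_delay (1 / N) h, h2, h3] with x h0 h1 h2 h3 hx
  refine (h0 hx).trans ?_
  rw [h3 hx, Pi.zero_apply, indicator_apply]
  split_ifs with hxk
  · rw [h1 hx, indicator_apply]
    split_ifs with hx'
    · refine h2 hx' ⟨hx'.1, ?_⟩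
      have h4 := hxk.2
      push_cast at h4
      rw [add_div] at h4
      linarith
    · rfl
  · rfl

theorem delayedBlock_congr {N k : ℕ} (hN : 0 < N) {h h' : ShiftSpace X p}
    (hh : VanishesOn (h - h') 0 (k / N)) : delayedBlock N k h = delayedBlock N k h' := by
  rw [← sub_eq_zero, ← map_sub, delayedBlock_eq_zero hN hh]

omit [NormedSpace ℝ X] [Fact (1 ≤ p)] in
theorem sum_cut {N : ℕ} (hN : 0 < N) (h : ShiftSpace X p) :
    ∑ k ∈ Finset.range N, cut (measurableSet_Ioc (a := (k / N : ℝ)) (b := ((k + 1 : ℕ) / N : ℝ))) h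
      = h := by
  have hN' : (0 : ℝ) < N := by exact_mod_cast hN
  have key : ∀ M : ℕ, ∀ᵐ x ∂(volume.restrict (Icc (0 : ℝ) 1)),
      (∑ k ∈ Finset.range M, cut (measurableSet_Ioc (a := (k / N : ℝ))
        (b := ((k + 1 : ℕ) / N : ℝ))) h : ShiftSpace X p) x = (Ioc (0 : ℝ) (M / N)).indicator h x := by
    intro M
    induction M with
    | zero =>
      filter_upwards [Lp.coeFn_zero X p (volume.restrict (Icc (0 : ℝ) 1))] with x hx
      simpa using hx
    | succ M ih =>
      rw [Finset.sum_range_succ]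
      filter_upwards [ih, coeFn_cut (measurableSet_Ioc (a := (M / N : ℝ))
        (b := ((M + 1 : ℕ) / N : ℝ))) h, Lp.coeFn_add (∑ k ∈ Finset.range M, cut (measurableSet_Ioc
          (a := (k / N : ℝ)) (b := ((k + 1 : ℕ) / N : ℝ))) h) (cut (measurableSet_Ioc
          (a := (M / N : ℝ)) (b := ((M + 1 : ℕ) / N : ℝ))) h)] with x h1 h2 h3
      rw [h3, Pi.add_apply, h1, h2]
      have hM : (M / N : ℝ) ≤ ((M + 1 : ℕ) / N : ℝ) := by gcongr; simp
      have hM0 : (0 : ℝ) ≤ M / N := by positivity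
      have hu : Ioc (0 : ℝ) ((M + 1 : ℕ) / N) = Ioc 0 (M / N : ℝ) ∪ Ioc (M / N) ((M + 1 : ℕ) / N) :=
        (Ioc_union_Ioc_eq_Ioc hM0 hM).symm
      have hd : Disjoint (Ioc (0 : ℝ) (M / N)) (Ioc (M / N : ℝ) ((M + 1 : ℕ) / N)) :=
        Ioc_disjoint_Ioc_of_le le_rfl
      rw [hu, indicator_union_of_disjoint hd]
  refine Lp.ext ?_
  have h1 := key N
  have h2 : ∀ᵐ x : ℝ, x ≠ 0 := by simp [ae_iff]
  filter_upwards [h1, ae_restrict_of_ae h2, ae_restrict_mem measurableSet_Icc] with x h1 h2 h3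
  rw [h1, div_self hN'.ne', indicator_of_mem (show x ∈ Ioc (0 : ℝ) 1 from
    ⟨lt_of_le_of_ne h3.1 h2.symm, h3.2⟩)]

theorem sum_delayedBlock {N : ℕ} (hN : 0 < N) (h : ShiftSpace X p) :
    ∑ k ∈ Finset.range N, delayedBlock N k h = delay (1 / N) h :=
  sum_cut hN (delay (1 / N) h)

/-! ### The embedding of shifts into the noise space -/

variable {H₀ : Type*} [NormedAddCommGroup H₀] [InnerProductSpace ℝ H₀]

omit [Fact (1 ≤ p)] in
theorem coeFn_shiftToNoise (hp : 2 < p) (j : X →L[ℝ] H₀) (h : ShiftSpace X p) :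
    shiftToNoise hp j h =ᵐ[volume] (Icc (0 : ℝ) 1).indicator (fun x => j (h x)) :=
  (memLp_extend hp j h).coeFn_toLp

omit [Fact (1 ≤ p)] in
theorem shiftToNoise_add (hp : 2 < p) (j : X →L[ℝ] H₀) (h k : ShiftSpace X p) :
    shiftToNoise hp j (h + k) = shiftToNoise hp j h + shiftToNoise hp j k := by
  refine Lp.ext ?_
  filter_upwards [coeFn_shiftToNoise hp j h, coeFn_shiftToNoise hp j k,
    coeFn_shiftToNoise hp j (h + k), ae_add_unit h k,
    Lp.coeFn_add (shiftToNoise hp j h) (shiftToNoise hp j k)] with x h1 h2 h3 h4 h5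
  rw [h3, h5, Pi.add_apply, h1, h2]
  by_cases hx : x ∈ Icc (0 : ℝ) 1
  · rw [indicator_of_mem hx, indicator_of_mem hx, indicator_of_mem hx, h4 hx, map_add]
  · simp only [indicator_of_notMem hx, add_zero]

/-- `shiftToNoise` as an additive homomorphism. -/
noncomputable def shiftHom (hp : 2 < p) (j : X →L[ℝ] H₀) : ShiftSpace X p →+ NoiseSpace H₀ :=
  AddMonoidHom.mk' (shiftToNoise hp j) (shiftToNoise_add hp j)

omit [Fact (1 ≤ p)] in
theorem norm_shiftHom_le (hp : 2 < p) (j : X →L[ℝ] H₀) (h : ShiftSpace X p) :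
    ‖shiftHom hp j h‖ ≤ ‖j‖ * ‖h‖ := by
  have : IsProbabilityMeasure ((volume : Measure ℝ).restrict (Icc (0 : ℝ) 1)) := ⟨by simp⟩
  have h1 : shiftHom hp j h = (memLp_extend hp j h).toLp _ := rfl
  rw [h1, Lp.norm_toLp, eLpNorm_indicator_eq_eLpNorm_restrict measurableSet_Icc, Lp.norm_def]
  have h2 : eLpNorm (fun x => j (h x)) 2 (volume.restrict (Icc (0 : ℝ) 1))
      ≤ ‖j‖₊ • eLpNorm h p (volume.restrict (Icc (0 : ℝ) 1)) :=
    (eLpNorm_le_eLpNorm_of_exponent_le hp.le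
      (j.continuous.comp_aestronglyMeasurable (Lp.aestronglyMeasurable h))).trans
      (eLpNorm_le_nnreal_smul_eLpNorm_of_ae_le_mul (Eventually.of_forall fun x => by
        exact_mod_cast j.le_opNorm (h x)) p)
  have h3 := ENNReal.toReal_mono (by
    rw [ENNReal.smul_def, smul_eq_mul]
    exact ENNReal.mul_ne_top ENNReal.coe_ne_top (Lp.eLpNorm_ne_top h)) h2
  rwa [ENNReal.smul_def, smul_eq_mul, ENNReal.toReal_mul, ENNReal.coe_toReal, coe_nnnorm] at h3

omit [Fact (1 ≤ p)] in
theorem shiftHom_eq_zero_of_le (hp : 2 < p) (j : X →L[ℝ] H₀) {h : ShiftSpace X p} {s : ℝ}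
    (hh : VanishesOn h 0 s) : ∀ᵐ x : ℝ, x ≤ s → shiftHom hp j h x = 0 := by
  filter_upwards [coeFn_shiftToNoise hp j h, vanishesOn_iff.1 hh] with x h1 h2 hx
  refine h1.trans ?_
  by_cases hx1 : x ∈ Icc (0 : ℝ) 1
  · rw [indicator_of_mem hx1, h2 hx1 ⟨hx1.1, hx⟩, map_zero]
  · rw [indicator_of_notMem hx1]

omit [Fact (1 ≤ p)] in
theorem inner_shiftHom_cut (hp : 2 < p) (j : X →L[ℝ] H₀) {S T : Set ℝ} (hS : MeasurableSet S)
    (hT : MeasurableSet T) (hST : Disjoint S T) (h k : ShiftSpace X p) :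
    inner ℝ (shiftHom hp j (cut hS h)) (shiftHom hp j (cut hT k)) = 0 := by
  rw [L2.inner_def]
  refine integral_eq_zero_of_ae ?_
  have h1 := coeFn_cut hS h
  have h2 := coeFn_cut hT k
  rw [Filter.EventuallyEq, ae_restrict_iff' measurableSet_Icc] at h1 h2
  filter_upwards [coeFn_shiftToNoise hp j (cut hS h), coeFn_shiftToNoise hp j (cut hT k), h1, h2]
    with x h3 h4 h5 h6
  have h3' : shiftHom hp j (cut hS h) x = _ := h3
  have h4' : shiftHom hp j (cut hT k) x = _ := h4
  rw [h3', h4', Pi.zero_apply]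
  by_cases hx : x ∈ Icc (0 : ℝ) 1
  · rw [indicator_of_mem hx, indicator_of_mem hx, h5 hx, h6 hx]
    by_cases hxS : x ∈ S
    · rw [indicator_of_notMem (hST.notMem_of_mem_left hxS), map_zero, inner_zero_right]
    · rw [indicator_of_notMem hxS, map_zero, inner_zero_left]
  · rw [indicator_of_notMem hx, inner_zero_left]

omit [NormedSpace ℝ X] [Fact (1 ≤ p)] in
theorem vanishesOn_cut (h : ShiftSpace X p) {a b s : ℝ} (hs : s ≤ a) :
    VanishesOn (cut (measurableSet_Ioc (a := a) (b := b)) h) 0 s := by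
  filter_upwards [coeFn_cut (measurableSet_Ioc (a := a) (b := b)) h] with x h1 h2
  rw [h1, indicator_of_notMem fun h3 => (h2.2.trans hs).not_gt h3.1]

omit [NormedSpace ℝ X] [Fact (1 ≤ p)] in
theorem cut_cut {α : Type*} [MeasurableSpace α] {μ : Measure α} {S : Set α} (hS : MeasurableSet S)
    (h : Lp X p μ) : cut hS (cut hS h) = cut hS h := by
  refine Lp.ext ?_
  filter_upwards [coeFn_cut hS (cut hS h), coeFn_cut hS h] with x h1 h2
  rw [h1, h2]
  by_cases hx : x ∈ S <;> simp [hx, h2]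

omit [NormedSpace ℝ X] [Fact (1 ≤ p)] in
theorem VanishesOn.add {h k : ShiftSpace X p} {s t : ℝ} (hh : VanishesOn h s t)
    (hk : VanishesOn k s t) : VanishesOn (h + k) s t := by
  filter_upwards [hh, hk, Lp.coeFn_add h k] with x h1 h2 h3 hx
  rw [h3, Pi.add_apply, h1 hx, h2 hx, add_zero]

omit [Fact (1 ≤ p)] in
theorem VanishesOn.smul {h : ShiftSpace X p} {s t : ℝ} (hh : VanishesOn h s t) (c : ℝ) :
    VanishesOn (c • h) s t := by
  filter_upwards [hh, Lp.coeFn_smul c h] with x h1 h3 hx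
  rw [h3, Pi.smul_apply, h1 hx, smul_zero]

omit [NormedSpace ℝ X] [Fact (1 ≤ p)] in
theorem vanishesOn_zero (s t : ℝ) : VanishesOn (0 : ShiftSpace X p) s t := by
  filter_upwards [Lp.coeFn_zero X p (volume.restrict (Icc (0 : ℝ) 1))] with x h1 hx
  rw [h1, Pi.zero_apply]

end Shifts

/-! ### Approximation of adapted shifts by countably valued ones -/

theorem exists_measurable_rounding {E : Type*} [NormedAddCommGroup E] [SecondCountableTopology E]
    [MeasurableSpace E] [BorelSpace E] {ε : ℝ} (hε : 0 < ε) :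
    ∃ (ν : E → ℕ) (d : ℕ → E), Measurable ν ∧ ∀ h, ‖d (ν h) - h‖ ≤ ε := by
  classical
  have hex : ∀ h : E, ∃ n, dist (TopologicalSpace.denseSeq E n) h < ε := fun h => by
    obtain ⟨n, hn⟩ := (TopologicalSpace.denseRange_denseSeq E).exists_dist_lt h hε
    exact ⟨n, by rwa [dist_comm]⟩
  refine ⟨fun h => Nat.find (hex h), TopologicalSpace.denseSeq E,
    measurable_find hex fun n => ?_, fun h => ?_⟩
  · exact measurableSet_lt (by fun_prop) measurable_const
  · rw [← dist_eq_norm]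
    exact (Nat.find_spec (hex h)).le

theorem norm_sum_sq_eq_of_orthogonal {V : Type*} [NormedAddCommGroup V] [InnerProductSpace ℝ V]
    (f : ℕ → V) (hf : ∀ i k, i < k → inner ℝ (f i) (f k) = 0) (n : ℕ) :
    ‖∑ i ∈ Finset.range n, f i‖ ^ 2 = ∑ i ∈ Finset.range n, ‖f i‖ ^ 2 := by
  induction n with
  | zero => simp
  | succ n ih =>
    rw [Finset.sum_range_succ, Finset.sum_range_succ, norm_add_sq_real, ih, sum_inner,
      Finset.sum_eq_zero fun i hi => hf i n (Finset.mem_range.1 hi)]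
    ring

section Approximation

variable {X : Type*} [NormedAddCommGroup X] {p : ℝ≥0∞} [NormedSpace ℝ X] [Fact (1 ≤ p)]
variable {Ω H₀ : Type*} [NormedAddCommGroup Ω] [NormedSpace ℝ Ω] [MeasurableSpace Ω] [BorelSpace Ω]
  [NormedAddCommGroup H₀] [InnerProductSpace ℝ H₀]

omit [NormedSpace ℝ X] [Fact (1 ≤ p)] in
theorem vanishesOn_zero_zero (h : ShiftSpace X p) : VanishesOn h 0 0 := by
  have h2 : ∀ᵐ x : ℝ, x ≠ 0 := by simp [ae_iff]
  filter_upwards [ae_restrict_of_ae h2] with x hx hx'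
  exact absurd (le_antisymm hx'.2 hx'.1) hx

omit [BorelSpace Ω] in
-- `η k` is what is known of the shift at time `k/N`. The blocks are chosen from the `η k`, whatever
-- `ω` is; where the `η k` come from a single small `h`, their sum is close to the delayed `h`.
theorem exists_adapted_approximation {P : Measure Ω}
    {ι : NoiseSpace H₀ →L[ℝ] Ω} (hp : 2 < p) (j : X →L[ℝ] H₀)
    [SecondCountableTopology (ShiftSpace X p)] [MeasurableSpace (ShiftSpace X p)]
    [BorelSpace (ShiftSpace X p)] {N : ℕ} (hN : 0 < N) {ε R : ℝ} (hε : 0 < ε) (hR : 0 ≤ R)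
    {η : ℕ → Ω → ShiftSpace X p} (hm : ∀ k, 0 < k → k < N → Measurable (η k))
    (hinv : ∀ k, 0 < k → k < N → ∀ x : ShiftSpace X p, VanishesOn x 0 (k / N) →
      ∀ᵐ ω ∂P, η k (ω + ι (shiftHom hp j x)) = η k ω) :
    ∃ (e : ℕ → ℕ → ShiftSpace X p) (κ : ℕ → Ω → ℕ),
      IsAdaptedShift P ι (fun i n => shiftHom hp j (e i n)) κ ∧
      (∀ ω, ∑ i ∈ Finset.range N, ‖shiftHom hp j (e i (κ i ω))‖ ^ 2 ≤ R) ∧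
      ∀ (ω : Ω) (h : ShiftSpace X p),
        (∀ k, 0 < k → k < N → VanishesOn (h - η k ω) 0 (k / N)) →
        (‖j‖ * (‖h‖ + N * ε)) ^ 2 ≤ R →
        ‖blockSum e κ N ω - delay (1 / N) h‖ ≤ N * ε := by
  classical
  have hN' : (0 : ℝ) < N := by exact_mod_cast hN
  obtain ⟨ν, d, hν, hd⟩ := exists_measurable_rounding (E := ShiftSpace X p) hε
  -- Index `0` is reserved for the zero block, used when nothing is to be added. Cutting the dense
  -- points to disjoint intervals makes the blocks orthogonal in the noise space.
  let e : ℕ → ℕ → ShiftSpace X p := fun k n => Nat.casesOn n 0 fun n =>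
    cut (measurableSet_Ioc (a := (k / N : ℝ)) (b := ((k + 1 : ℕ) / N : ℝ))) (d n)
  have he0 : ∀ k, e k 0 = 0 := fun k => rfl
  have hes : ∀ k n, e k (n + 1) =
    cut (measurableSet_Ioc (a := (k / N : ℝ)) (b := ((k + 1 : ℕ) / N : ℝ))) (d n) := fun k n => rfl
  obtain ⟨κ₀, hκ₀⟩ : ∃ κ₀ : ℕ → Ω → ℕ, ∀ k ω, κ₀ k ω =
    if 0 < k ∧ k < N then ν (delayedBlock N k (η k ω)) + 1 else 0 := ⟨_, fun _ _ => rfl⟩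
  -- Energy cutoff: a block is dropped once the energy up to and including it exceeds `R`. The test
  -- involves only `κ₀ 0, …, κ₀ k`, so adaptedness survives.
  obtain ⟨κ, hκdef⟩ : ∃ κ : ℕ → Ω → ℕ, ∀ k ω, κ k ω =
    if ∑ i ∈ Finset.range (k + 1), ‖shiftHom hp j (e i (κ₀ i ω))‖ ^ 2 ≤ R then κ₀ k ω else 0 :=
    ⟨_, fun _ _ => rfl⟩
  have mκ₀ : ∀ k, Measurable (κ₀ k) := by
    intro k
    by_cases hk : 0 < k ∧ k < N
    · have h1 : Measurable fun ω => ν (delayedBlock N k (η k ω)) :=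
        hν.comp ((continuous_delayedBlock N k).measurable.comp (hm k hk.1 hk.2))
      have h2 : κ₀ k = fun ω => ν (delayedBlock N k (η k ω)) + 1 :=
        funext fun ω => (hκ₀ k ω).trans (if_pos hk)
      rw [h2]
      exact (measurable_of_countable fun n : ℕ => n + 1).comp h1
    · have h2 : κ₀ k = fun _ => 0 := funext fun ω => (hκ₀ k ω).trans (if_neg hk)
      rw [h2]
      exact measurable_const
  have mκ : ∀ k, Measurable (κ k) := by
    intro k
    rw [show κ k = _ from funext (hκdef k)]
    refine Measurable.ite ?_ (mκ₀ k) measurable_const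
    refine measurableSet_le (Finset.measurable_fun_sum _ fun i _ => ?_) measurable_const
    exact (measurable_of_countable fun n => ‖shiftHom hp j (e i n)‖ ^ 2).comp (mκ₀ i)
  have evan : ∀ i k n, i ≤ k → VanishesOn (e k n) 0 (i / N) := by
    intro i k n hik
    cases n with
    | zero => exact vanishesOn_zero _ _
    | succ n => exact vanishesOn_cut _ (by gcongr)
  have orth : ∀ i k, i < k → ∀ m n,
      inner ℝ (shiftHom hp j (e i m)) (shiftHom hp j (e k n)) = 0 := by
    intro i k hik m n
    cases m with
    | zero => rw [he0, map_zero, inner_zero_left]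
    | succ m =>
      cases n with
      | zero => rw [he0, map_zero, inner_zero_right]
      | succ n =>
        refine inner_shiftHom_cut hp j _ _ (Ioc_disjoint_Ioc_of_le ?_) _ _
        gcongr
        omega
  have inv₀ : ∀ i k, i ≤ k → ∀ n, ∀ᵐ ω ∂P, κ₀ i (ω + ι (shiftHom hp j (e k n))) = κ₀ i ω := by
    intro i k hik n
    by_cases hi : 0 < i ∧ i < N
    · filter_upwards [hinv i hi.1 hi.2 _ (evan i k n hik)] with ω hω
      rw [hκ₀, hκ₀, hω]
    · exact Eventually.of_forall fun ω => by rw [hκ₀, hκ₀, if_neg hi, if_neg hi]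
  have adapted : IsAdaptedShift P ι (fun i n => shiftHom hp j (e i n)) κ := by
    refine ⟨mκ, orth, fun i k hik n => ?_⟩
    have : ∀ᵐ ω ∂P, ∀ l ≤ i, κ₀ l (ω + ι (shiftHom hp j (e k n))) = κ₀ l ω := by
      rw [ae_all_iff]
      intro l
      rw [eventually_imp_distrib_left]
      exact fun hl => inv₀ l k (hl.trans hik) n
    filter_upwards [this] with ω hω
    have hs : ∑ l ∈ Finset.range (i + 1),
        ‖shiftHom hp j (e l (κ₀ l (ω + ι (shiftHom hp j (e k n)))))‖ ^ 2
        = ∑ l ∈ Finset.range (i + 1), ‖shiftHom hp j (e l (κ₀ l ω))‖ ^ 2 :=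
      Finset.sum_congr rfl fun l hl => by
        rw [hω l (Nat.lt_succ_iff.1 (Finset.mem_range.1 hl))]
    rw [hκdef, hκdef, hs, hω i le_rfl]
  refine ⟨e, κ, adapted, fun ω => ?_, fun ω h hvan hRh => ?_⟩
  · have hle : ∀ i, ‖shiftHom hp j (e i (κ i ω))‖ ^ 2 ≤ ‖shiftHom hp j (e i (κ₀ i ω))‖ ^ 2 := by
      intro i
      rw [hκdef]
      split_ifs
      · exact le_rfl
      · rw [he0, map_zero, norm_zero, zero_pow two_ne_zero]; exact sq_nonneg _
    have : ∀ k, ∑ i ∈ Finset.range k, ‖shiftHom hp j (e i (κ i ω))‖ ^ 2 ≤ R := by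
      intro k
      induction k with
      | zero => simpa using hR
      | succ k ih =>
        by_cases hk : ∑ i ∈ Finset.range (k + 1), ‖shiftHom hp j (e i (κ₀ i ω))‖ ^ 2 ≤ R
        · exact (Finset.sum_le_sum fun i _ => hle i).trans hk
        · rw [Finset.sum_range_succ]
          have : κ k ω = 0 := (hκdef k ω).trans (if_neg hk)
          rw [this, he0, map_zero, norm_zero]
          simpa using ih
    exact this N
  · have hblock : ∀ k ∈ Finset.range N, ‖e k (κ₀ k ω) - delayedBlock N k h‖ ≤ ε := by
      intro k hk
      rw [Finset.mem_range] at hk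
      rcases Nat.eq_zero_or_pos k with rfl | hk0
      · have h1 : κ₀ 0 ω = 0 := by rw [hκ₀]; simp
        rw [h1, he0, delayedBlock_eq_zero hN, sub_zero, norm_zero]
        · exact hε.le
        · simpa using vanishesOn_zero_zero h
      · have h1 : κ₀ k ω = ν (delayedBlock N k (η k ω)) + 1 :=
          (hκ₀ k ω).trans (if_pos ⟨hk0, hk⟩)
        rw [h1, hes, ← delayedBlock_congr hN (hvan k hk0 hk)]
        have h2 : delayedBlock N k h = cut (measurableSet_Ioc (a := (k / N : ℝ))
            (b := ((k + 1 : ℕ) / N : ℝ))) (delayedBlock N k h) := (cut_cut _ _).symm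
        nth_rw 2 [h2]
        rw [← map_sub]
        exact (norm_cut_le _ _).trans (hd _)
    have hsum : ‖∑ k ∈ Finset.range N, e k (κ₀ k ω) - delay (1 / N) h‖ ≤ N * ε := by
      rw [← sum_delayedBlock hN, ← Finset.sum_sub_distrib]
      refine (norm_sum_le_of_le _ hblock).trans ?_
      simp
    -- For `h` of controlled norm the cutoff is inactive: by orthogonality the energy is the squared
    -- norm of the sum, which is close to the delayed `h`.
    have hen : ∀ k, k ≤ N → ∑ i ∈ Finset.range k, ‖shiftHom hp j (e i (κ₀ i ω))‖ ^ 2 ≤ R := by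
      intro k hk
      refine (Finset.sum_le_sum_of_subset_of_nonneg (Finset.range_mono hk)
        fun _ _ _ => sq_nonneg _).trans ?_
      rw [← norm_sum_sq_eq_of_orthogonal (fun i => shiftHom hp j (e i (κ₀ i ω)))
        (fun i k hik => orth i k hik _ _), ← map_sum]
      refine le_trans ?_ hRh
      have h1 := norm_shiftHom_le hp j (∑ k ∈ Finset.range N, e k (κ₀ k ω))
      have h2 := norm_le_norm_add_norm_sub' (∑ k ∈ Finset.range N, e k (κ₀ k ω)) (delay (1 / N) h)
      have h3 := norm_delay_le (1 / N) h
      refine pow_le_pow_left₀ (norm_nonneg _) (h1.trans ?_) 2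
      gcongr
      linarith
    have hκ : ∀ k ∈ Finset.range N, e k (κ k ω) = e k (κ₀ k ω) := fun k hk => by
      have : κ k ω = κ₀ k ω := (hκdef k ω).trans (if_pos (hen (k + 1) (Finset.mem_range.1 hk)))
      rw [this]
    rw [blockSum, Finset.sum_congr rfl hκ]
    exact hsum

/-- Fatou's lemma for sets, here without any measurability. -/
theorem measure_le_of_eventually_mem {α : Type*} [MeasurableSpace α] {μ : Measure α} {Γ : Set α}
    {S : ℕ → Set α} {c : ℝ≥0∞} (h : ∀ᵐ x ∂μ, x ∈ Γ → ∀ᶠ n in atTop, x ∈ S n)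
    (hS : ∀ n, μ (S n) ≤ c) : μ Γ ≤ c := by
  have h1 : μ Γ ≤ μ (⋃ n, ⋂ m ≥ n, S m) := by
    refine measure_mono_ae ?_
    filter_upwards [h] with x hx hxΓ
    obtain ⟨n, hn⟩ := eventually_atTop.1 (hx hxΓ)
    exact mem_iUnion.2 ⟨n, mem_iInter₂.2 hn⟩
  refine h1.trans ?_
  have hmono : Monotone fun n => ⋂ m ≥ n, S m := fun a b hab =>
    biInter_subset_biInter_left fun m (hm : b ≤ m) => hab.trans hm
  rw [hmono.measure_iUnion]
  exact iSup_le fun n => (measure_mono (biInter_subset_of_mem (show n ≥ n from le_rfl))).trans (hS n)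

/-- The law of the noise shifted by an adapted shift of bounded energy is controlled by the law of
the noise, also after applying a continuous map to the shift. -/
theorem measure_adapted_shift_le [SecondCountableTopology Ω] [CompleteSpace Ω]
    {P : Measure Ω} [IsGaussian P]
    {ι : NoiseSpace H₀ →L[ℝ] Ω} (hι : IsCameronMartin P ι) (hp : 2 < p) (hp' : p ≠ ∞)
    (j : X →L[ℝ] H₀) [SecondCountableTopology (ShiftSpace X p)] [MeasurableSpace (ShiftSpace X p)]
    [BorelSpace (ShiftSpace X p)] {η : ℝ → Ω → ShiftSpace X p}
    (hm : ∀ s, 0 < s → s ≤ 1 → Measurable (η s))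
    (hinv : ∀ s, 0 < s → s ≤ 1 → ∀ x : ShiftSpace X p, VanishesOn x 0 s →
      ∀ᵐ ω ∂P, η s (ω + ι (shiftHom hp j x)) = η s ω)
    {ζ : Ω → ShiftSpace X p} {Γ : Set Ω}
    (hζ : ∀ s, 0 < s → s ≤ 1 → ∀ᵐ ω ∂P, ω ∈ Γ → VanishesOn (ζ ω - η s ω) 0 s)
    (hζ1 : ∀ ω ∈ Γ, ‖ζ ω‖ ≤ 1) {S T : Set Ω} {B : Ω → Set (ShiftSpace X p)}
    (hB : ∀ x, ∀ᵐ ω ∂P, x ∈ B ω → ω + ι (shiftHom hp j x) ∈ S)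
    (hΓB : ∀ ω ∈ Γ ∩ T, B ω ∈ 𝓝 (ζ ω)) :
    P (Γ ∩ T) ≤ ENNReal.ofReal (Real.exp (2 * ‖j‖ ^ 2)) * P S ^ (1 / 2 : ℝ) := by
  -- With `n + 1` blocks rounded to within `1/(n+1)²` the total error is `1/(n+1) ≤ 1`. As `‖h‖ ≤
  -- 1`, the energy is at most `(2‖j‖)²`, whence the constant `exp (2‖j‖²)`.
  have happ : ∀ n : ℕ, ∃ (e : ℕ → ℕ → ShiftSpace X p) (κ : ℕ → Ω → ℕ),
      IsAdaptedShift P ι (fun i n => shiftHom hp j (e i n)) κ ∧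
      (∀ ω, ∑ i ∈ Finset.range (n + 1), ‖shiftHom hp j (e i (κ i ω))‖ ^ 2 ≤ 4 * ‖j‖ ^ 2) ∧
      ∀ (ω : Ω) (h : ShiftSpace X p), (∀ k, 0 < k → k < n + 1 →
        VanishesOn (h - η (k / (n + 1 : ℕ)) ω) 0 (k / (n + 1 : ℕ))) → ‖h‖ ≤ 1 →
        ‖blockSum e κ (n + 1) ω - delay (1 / (n + 1 : ℕ)) h‖ ≤ 1 / (n + 1 : ℝ) := by
    intro n
    have hn : (0 : ℝ) < (n + 1 : ℕ) := by positivity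
    have hε : (0 : ℝ) < 1 / ((n + 1 : ℕ) * (n + 1 : ℕ)) := by positivity
    have heq : ((n + 1 : ℕ) : ℝ) * (1 / ((n + 1 : ℕ) * (n + 1 : ℕ))) = 1 / (n + 1 : ℝ) := by
      push_cast
      field_simp
    have hle : 1 / (n + 1 : ℝ) ≤ 1 := by
      rw [div_le_one (by positivity)]
      linarith [(Nat.cast_nonneg n : (0 : ℝ) ≤ n)]
    have hmem : ∀ k : ℕ, 0 < k → k < n + 1 → (0 : ℝ) < k / (n + 1 : ℕ) ∧
        (k / (n + 1 : ℕ) : ℝ) ≤ 1 := fun k h0 h1 =>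
      ⟨div_pos (by exact_mod_cast h0) hn, (div_le_one hn).2 (by exact_mod_cast h1.le)⟩
    obtain ⟨e, κ, h1, h2, h3⟩ := exists_adapted_approximation (P := P) (ι := ι) hp j n.succ_pos
      hε (R := 4 * ‖j‖ ^ 2) (by positivity) (η := fun k => η (k / (n + 1 : ℕ)))
      (fun k h0 h1 => hm _ (hmem k h0 h1).1 (hmem k h0 h1).2)
      (fun k h0 h1 => hinv _ (hmem k h0 h1).1 (hmem k h0 h1).2)
    refine ⟨e, κ, h1, h2, fun ω h hv hh => ?_⟩
    refine (h3 ω h hv ?_).trans_eq heq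
    rw [heq, mul_pow, mul_comm]
    gcongr
    nlinarith [norm_nonneg h, (by positivity : (0 : ℝ) ≤ 1 / (n + 1 : ℝ))]
  choose e κ hadapt henergy hclose using happ
  have hz : ∀ n, ∀ ω, blockSum (fun i m => shiftHom hp j (e n i m)) (κ n) (n + 1) ω
      = shiftHom hp j (blockSum (e n) (κ n) (n + 1) ω) := fun n ω => by
    simp only [blockSum, map_sum]
  refine measure_le_of_eventually_mem
    (S := fun n => {ω | ω + ι (shiftHom hp j (blockSum (e n) (κ n) (n + 1) ω)) ∈ toMeasurable P S})
    ?_ fun n => ?_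
  · have hall : ∀ᵐ ω ∂P, ∀ n k : ℕ, 0 < k → k < n + 1 → ω ∈ Γ →
        VanishesOn (ζ ω - η (k / (n + 1 : ℕ)) ω) 0 (k / (n + 1 : ℕ)) := by
      simp_rw [ae_all_iff]
      intro n k h0 h1
      have hn : (0 : ℝ) < (n + 1 : ℕ) := by positivity
      exact hζ _ (div_pos (by exact_mod_cast h0) hn) ((div_le_one hn).2 (by exact_mod_cast h1.le))
    -- `hB` has a null set for each fixed shift. The approximants take countably many values, so one
    -- null set serves for all of them.
    have hval : ∀ᵐ ω ∂P, ∀ n, blockSum (e n) (κ n) (n + 1) ω ∈ B ω →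
        ω + ι (shiftHom hp j (blockSum (e n) (κ n) (n + 1) ω)) ∈ S := by
      rw [ae_all_iff]
      intro n
      have hcount : (range fun c : Fin (n + 1) → ℕ => ∑ i : Fin (n + 1), e n i (c i)).Countable :=
        countable_range _
      have : ∀ᵐ ω ∂P, ∀ x ∈ range fun c : Fin (n + 1) → ℕ => ∑ i : Fin (n + 1), e n i (c i),
          x ∈ B ω → ω + ι (shiftHom hp j x) ∈ S :=
        (ae_ball_iff hcount).2 fun x _ => hB x
      filter_upwards [this] with ω hω
      refine hω _ ⟨fun i => κ n i ω, ?_⟩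
      simp only [blockSum]
      exact Fin.sum_univ_eq_sum_range (fun i => e n i (κ n i ω)) (n + 1)
    filter_upwards [hall, hval] with ω h1 h2 hω
    have htend : Tendsto (fun n => blockSum (e n) (κ n) (n + 1) ω) atTop (𝓝 (ζ ω)) := by
      have h3 := (tendsto_delay hp' (ζ ω)).comp (tendsto_add_atTop_nat 1)
      have h4 : Tendsto (fun n => blockSum (e n) (κ n) (n + 1) ω - delay (1 / (n + 1 : ℕ)) (ζ ω))
          atTop (𝓝 0) := squeeze_zero_norm (fun n => hclose n ω (ζ ω)
            (fun k a b => h1 n k a b hω.1) (hζ1 ω hω.1)) tendsto_one_div_add_atTop_nhds_zero_nat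
      have h5 := h4.add h3
      simpa using h5
    filter_upwards [htend (hΓB ω hω)] with n hn
    exact subset_toMeasurable P S (h2 n hn)
  · have := (hadapt n).measure_shift_le hι (henergy n) (measurableSet_toMeasurable P S)
    simp only [hz] at this
    refine this.trans_eq ?_
    rw [measure_toMeasurable]
    congr 3
    ring

end Approximation

/-! ### The Euler scheme for the transfer of variations of the initial condition -/

section Survival

variable {U M : Type*} {Φ : ℝ → ℝ → U ⊕ Unit → M → U ⊕ Unit}

theorem IsConsistent.survival_anti (hΦ : IsConsistent Φ) {s t : ℝ} (hs : 0 ≤ s) (hst : s ≤ t)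
    (ht : t ≤ 1) : survival Φ t ⊆ survival Φ s := by
  intro x hx h
  refine hx ?_
  rw [← hΦ.comp 0 s t le_rfl hs hst ht, h, hΦ.death s t hs hst ht]

theorem IsRegularFlow.isOpen_survival [NormedAddCommGroup U] [NormedSpace ℝ U] [MetricSpace M]
    (hΦ : IsRegularFlow Φ) {t : ℝ} (h0 : 0 ≤ t) (h1 : t ≤ 1) : IsOpen (survival Φ t) := by
  have hc : Continuous fun x : U × M =>
      ((⟨(0, t), le_rfl, h0, h1⟩, Sum.inl x.1, x.2) : TimePair × (U ⊕ Unit) × M) :=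
    continuous_const.prodMk ((continuous_inl.comp continuous_fst).prodMk continuous_snd)
  exact hΦ.isOpen_alive.preimage hc

theorem IsRegularFlow.continuousOn_flow [NormedAddCommGroup U] [NormedSpace ℝ U] [MetricSpace M]
    (hΦ : IsRegularFlow Φ) {t : ℝ} (h0 : 0 ≤ t) (h1 : t ≤ 1) :
    ContinuousOn (fun x : U × M => Φ 0 t (Sum.inl x.1) x.2) (survival Φ t) := by
  have hc : Continuous fun x : U × M =>
      ((⟨(0, t), le_rfl, h0, h1⟩, Sum.inl x.1, x.2) : TimePair × (U ⊕ Unit) × M) :=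
    continuous_const.prodMk ((continuous_inl.comp continuous_fst).prodMk continuous_snd)
  exact hΦ.continuousOn.comp hc.continuousOn fun x hx => hx

end Survival

section Transfer

variable {X U M : Type*} [NormedAddCommGroup X] {p : ℝ≥0∞} [NormedSpace ℝ X] [Fact (1 ≤ p)]
  [NormedAddCommGroup U] [NormedSpace ℝ U] [MetricSpace M]
variable {Ω H₀ : Type*} [NormedAddCommGroup Ω] [NormedSpace ℝ Ω] [MeasurableSpace Ω]
  [NormedAddCommGroup H₀] [InnerProductSpace ℝ H₀]
  {P : Measure Ω} {ι : NoiseSpace H₀ →L[ℝ] Ω} {hp : 2 < p} {j : X →L[ℝ] H₀} {ξξ : Ω → M}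
  {Φ : ℝ → ℝ → U ⊕ Unit → M → U ⊕ Unit} {r : ℝ → U → M → ℝ≥0∞} {τ : ShiftSpace X p → M → M}
  {A : ℝ → ℝ → U × M → U →L[ℝ] ShiftSpace X p}

/-- The field `A_1^{(s)} w`, extended by `0` outside of `𝒩_s`. -/
noncomputable def transferField (Φ : ℝ → ℝ → U ⊕ Unit → M → U ⊕ Unit)
    (A : ℝ → ℝ → U × M → U →L[ℝ] ShiftSpace X p) (s : ℝ) (w : U) : U × M → ShiftSpace X p :=
  (survival Φ s).indicator fun x => A 1 s x w

/-- The Euler scheme with `n` steps for the field `A_1^{(s)} w` along the segment from `u` in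
direction `w`. -/
noncomputable def transferEuler (Φ : ℝ → ℝ → U ⊕ Unit → M → U ⊕ Unit)
    (τ : ShiftSpace X p → M → M) (A : ℝ → ℝ → U × M → U →L[ℝ] ShiftSpace X p)
    (u w : U) (s : ℝ) (ξ : M) (n : ℕ) : ℕ → ShiftSpace X p :=
  eulerPoint (fun x h => transferField Φ A s w (u + x • w, τ h ξ)) n

theorem IsNoiseTransfer.continuousOn_transferField (hA : IsNoiseTransfer P ι ξξ Φ r τ A) {s : ℝ}
    (hs : 0 < s) (hs1 : s ≤ 1) (w : U) : ContinuousOn (transferField Φ A s w) (survival Φ s) := by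
  refine ContinuousOn.congr ?_ fun x hx => indicator_of_mem hx _
  exact ((hA.locallyLipschitz s 1 hs hs1 le_rfl).continuousOn).clm_apply continuousOn_const

omit [NormedAddCommGroup U] [NormedSpace ℝ U] in
theorem IsShiftAction.mem_survival_iff (hτ : IsShiftAction hp P ι j ξξ Φ τ) {s : ℝ} (hs : 0 ≤ s)
    (hs1 : s ≤ 1) {k : ShiftSpace X p} (hk : VanishesOn k 0 s) (u : U) (ξ : M) :
    (u, τ k ξ) ∈ survival Φ s ↔ (u, ξ) ∈ survival Φ s := by
  simp only [survival, mem_ofPred_eq, hτ.dependency 0 s le_rfl hs hs1 k hk]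

variable [SecondCountableTopology Ω] [CompleteSpace Ω] [BorelSpace Ω] [IsGaussian P]
  [SecondCountableTopology (ShiftSpace X p)]

/-- `𝓕_s`-measurability of `A_1^{(s)}` is converted into invariance under shifts after `s`, tested
on a countable basis of the target. -/
theorem IsNoiseTransfer.ae_transferField_shift_eq (hA : IsNoiseTransfer P ι ξξ Φ r τ A)
    (hι : IsCameronMartin P ι) (hτ : IsShiftAction hp P ι j ξξ Φ τ) {s : ℝ} (hs : 0 < s)
    (hs1 : s ≤ 1) (w u : U) {k : ShiftSpace X p} (hk : VanishesOn k 0 s) :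
    ∀ᵐ ω ∂P, transferField Φ A s w (u, τ k (ξξ ω)) = transferField Φ A s w (u, ξξ ω) := by
  have hS : ∀ b ∈ TopologicalSpace.countableBasis (ShiftSpace X p),
      ∀ᵐ ω ∂P, ω + ι (shiftHom hp j k) ∈ {ω | (u, ξξ ω) ∈ survival Φ s ∧
        A 1 s (u, ξξ ω) ∈ {T : U →L[ℝ] ShiftSpace X p | T w ∈ b}} ↔
      ω ∈ {ω | (u, ξξ ω) ∈ survival Φ s ∧
        A 1 s (u, ξξ ω) ∈ {T : U →L[ℝ] ShiftSpace X p | T w ∈ b}} := by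
    intro b hb
    refine pastSigmaAlgebra_add hι (shiftHom_eq_zero_of_le hp j hk)
      (hA.measurable 1 ⟨one_pos, le_rfl⟩ s ⟨hs.le, hs1⟩ u _ ?_)
    refine IsOpen.measurableSet ?_
    exact (TopologicalSpace.isOpen_of_mem_countableBasis hb).preimage
      (ContinuousLinearMap.apply ℝ (ShiftSpace X p) w).continuous
  filter_upwards [(ae_ball_iff (TopologicalSpace.countable_countableBasis _)).2 hS,
    hτ.shift k] with ω h1 h2
  have hmem := hτ.mem_survival_iff hs.le hs1 hk u (ξξ ω)
  by_cases h3 : (u, ξξ ω) ∈ survival Φ s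
  · rw [transferField, indicator_of_mem h3, indicator_of_mem (hmem.2 h3)]
    refine Inseparable.eq ?_
    rw [(TopologicalSpace.isBasis_countableBasis _).inseparable_iff]
    intro b hb
    have h4 := h1 b hb
    have h5 : ξξ (ω + ι (shiftHom hp j k)) = τ k (ξξ ω) := h2
    simp only [h5, h3, hmem.2 h3, true_and] at h4
    exact h4
  · rw [transferField, indicator_of_notMem h3, indicator_of_notMem (mt hmem.1 h3)]

/-- The Euler scheme evaluates the field at random points, so one null set has to serve all `u`,
`h`, `k`. It is obtained from a dense sequence and continuity on the open survival set; off that set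
both sides are `0`. -/
theorem IsNoiseTransfer.ae_forall_transferField_shift_eq [SecondCountableTopology U]
    (hA : IsNoiseTransfer P ι ξξ Φ r τ A)
    (hι : IsCameronMartin P ι) (hτ : IsShiftAction hp P ι j ξξ Φ τ) (hΦ : IsRegularFlow Φ) {s : ℝ}
    (hs : 0 < s) (hs1 : s ≤ 1) (w : U) :
    ∀ᵐ ω ∂P, ∀ (u : U) (h k : ShiftSpace X p), VanishesOn k 0 s →
      transferField Φ A s w (u, τ (k + h) (ξξ ω)) = transferField Φ A s w (u, τ h (ξξ ω)) := by
  let K := {k : ShiftSpace X p // VanishesOn k 0 s}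
  have : Nonempty K := ⟨⟨0, vanishesOn_zero _ _⟩⟩
  let D := TopologicalSpace.denseSeq (U × ShiftSpace X p × K)
  have h0 : ∀ n, ∀ᵐ ω ∂P, transferField Φ A s w ((D n).1, τ ((D n).2.2 + (D n).2.1) (ξξ ω))
      = transferField Φ A s w ((D n).1, τ (D n).2.1 (ξξ ω)) := by
    intro n
    filter_upwards [(hι.quasiMeasurePreserving_add (shiftHom hp j (D n).2.1)).ae
      (hA.ae_transferField_shift_eq hι hτ hs hs1 w (D n).1 (D n).2.2.2),
      hτ.shift (D n).2.1] with ω h1 h2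
    have h3 : ξξ (ω + ι (shiftHom hp j (D n).2.1)) = τ (D n).2.1 (ξξ ω) := h2
    rw [h3] at h1
    rw [hτ.add, h1]
  filter_upwards [ae_all_iff.2 h0] with ω hω u h k hk
  have c1 : Continuous fun q : U × ShiftSpace X p × K => (q.1, τ q.2.1 (ξξ ω)) :=
    continuous_fst.prodMk (hτ.continuous.comp
      ((continuous_fst.comp continuous_snd).prodMk continuous_const))
  have c2 : Continuous fun q : U × ShiftSpace X p × K =>
      (q.1, τ ((q.2.2 : ShiftSpace X p) + q.2.1) (ξξ ω)) :=
    continuous_fst.prodMk (hτ.continuous.comp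
      (((continuous_subtype_val.comp (continuous_snd.comp continuous_snd)).add
        (continuous_fst.comp continuous_snd)).prodMk continuous_const))
  have hmem : ∀ q : U × ShiftSpace X p × K,
      (q.1, τ ((q.2.2 : ShiftSpace X p) + q.2.1) (ξξ ω)) ∈ survival Φ s ↔
      (q.1, τ q.2.1 (ξξ ω)) ∈ survival Φ s := fun q => by
    rw [hτ.add]
    exact hτ.mem_survival_iff hs.le hs1 q.2.2.2 _ _
  by_cases hs2 : (u, τ h (ξξ ω)) ∈ survival Φ s
  · have hO : IsOpen {q : U × ShiftSpace X p × K | (q.1, τ q.2.1 (ξξ ω)) ∈ survival Φ s} :=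
      (hΦ.isOpen_survival hs.le hs1).preimage c1
    have hF := hA.continuousOn_transferField hs hs1 w
    have key := Set.EqOn.of_subset_closure (s := {q : U × ShiftSpace X p × K |
        (q.1, τ q.2.1 (ξξ ω)) ∈ survival Φ s} ∩ range D)
      (t := {q : U × ShiftSpace X p × K | (q.1, τ q.2.1 (ξξ ω)) ∈ survival Φ s})
      (f := fun q => transferField Φ A s w (q.1, τ ((q.2.2 : ShiftSpace X p) + q.2.1) (ξξ ω)))
      (g := fun q => transferField Φ A s w (q.1, τ q.2.1 (ξξ ω))) ?_
      (hF.comp c2.continuousOn fun q hq => (hmem q).2 hq)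
      (hF.comp c1.continuousOn fun q hq => hq) inter_subset_left
      ((TopologicalSpace.denseRange_denseSeq _).open_subset_closure_inter hO)
    · exact key (show (u, h, (⟨k, hk⟩ : K)) ∈ _ from hs2)
    · rintro _ ⟨-, n, rfl⟩
      exact hω n
  · rw [transferField, indicator_of_notMem hs2,
      indicator_of_notMem (mt (hmem (u, h, ⟨k, hk⟩)).1 hs2)]

theorem IsNoiseTransfer.ae_transferEuler_shift_eq [SecondCountableTopology U]
    (hA : IsNoiseTransfer P ι ξξ Φ r τ A)
    (hι : IsCameronMartin P ι) (hτ : IsShiftAction hp P ι j ξξ Φ τ) (hΦ : IsRegularFlow Φ) {s : ℝ}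
    (hs : 0 < s) (hs1 : s ≤ 1) (u w : U) (n : ℕ) :
    ∀ᵐ ω ∂P, ∀ k : ShiftSpace X p, VanishesOn k 0 s → ∀ i,
      transferEuler Φ τ A u w s (τ k (ξξ ω)) n i = transferEuler Φ τ A u w s (ξξ ω) n i := by
  filter_upwards [hA.ae_forall_transferField_shift_eq hι hτ hΦ hs hs1 w] with ω hω k hk i
  induction i with
  | zero => rfl
  | succ i ih =>
    rw [transferEuler] at ih ⊢
    rw [transferEuler] at ih ⊢
    rw [eulerPoint, eulerPoint, ih, ← hτ.add, add_comm _ k, hω _ _ _ hk]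

/-- On `[0, s]` the scheme driven by `A_1^{(1)}` agrees with the one driven by `A_1^{(s)}`, as long
as its points survive. Together with the invariance of the latter this says that the Euler iterate
is adapted. -/
theorem IsNoiseTransfer.ae_vanishesOn_transferEuler_sub [SecondCountableTopology U]
    (hA : IsNoiseTransfer P ι ξξ Φ r τ A) (hΦc : IsConsistent Φ)
    (hι : IsCameronMartin P ι) (hτ : IsShiftAction hp P ι j ξξ Φ τ) (hΦ : IsRegularFlow Φ) {s : ℝ}
    (hs : 0 < s) (hs1 : s ≤ 1) (u w : U) (n : ℕ) :
    ∀ᵐ ω ∂P, (∀ i < n, (u + (i / n : ℝ) • w, τ (transferEuler Φ τ A u w 1 (ξξ ω) n i) (ξξ ω))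
        ∈ survival Φ 1) → ∀ i ≤ n,
      VanishesOn (transferEuler Φ τ A u w 1 (ξξ ω) n i - transferEuler Φ τ A u w s (ξξ ω) n i)
        0 s := by
  filter_upwards [hA.ae_forall_transferField_shift_eq hι hτ hΦ hs hs1 w] with ω hω hgood i hi
  induction i with
  | zero =>
    have : transferEuler Φ τ A u w 1 (ξξ ω) n 0 - transferEuler Φ τ A u w s (ξξ ω) n 0 = 0 :=
      sub_self (0 : ShiftSpace X p)
    rw [this]
    exact vanishesOn_zero _ _
  | succ i ih =>
    have ih := ih (by omega)
    have hg := hgood i (by omega)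
    have h1 : ∀ s, transferEuler Φ τ A u w s (ξξ ω) n (i + 1)
        = transferEuler Φ τ A u w s (ξξ ω) n i + (1 / n : ℝ) • transferField Φ A s w
          (u + (i / n : ℝ) • w, τ (transferEuler Φ τ A u w s (ξξ ω) n i) (ξξ ω)) := fun s => rfl
    have h2 := hω (u + (i / n : ℝ) • w) (transferEuler Φ τ A u w s (ξξ ω) n i) _ ih
    rw [sub_add_cancel] at h2
    rw [h1, h1, ← h2, add_sub_add_comm, ← smul_sub]
    refine ih.add (VanishesOn.smul ?_ _)
    rcases hs1.eq_or_lt with rfl | hs1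
    · rw [sub_self]
      exact vanishesOn_zero _ _
    · rw [transferField, transferField, indicator_of_mem hg,
        indicator_of_mem (hΦc.survival_anti hs.le hs1.le le_rfl hg)]
      exact hA.compatible s 1 1 hs hs1 le_rfl le_rfl _ hg w

end Transfer

/-! ### Measurability of the Euler scheme in the noise -/

section Measurability

variable {X U M : Type*} [NormedAddCommGroup X] {p : ℝ≥0∞} [NormedSpace ℝ X] [Fact (1 ≤ p)]
  [NormedAddCommGroup U] [NormedSpace ℝ U] [MetricSpace M]
variable {Ω H₀ : Type*} [NormedAddCommGroup Ω] [NormedSpace ℝ Ω] [MeasurableSpace Ω]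
  [NormedAddCommGroup H₀] [InnerProductSpace ℝ H₀]
  {P : Measure Ω} {ι : NoiseSpace H₀ →L[ℝ] Ω} {hp : 2 < p} {j : X →L[ℝ] H₀} {ξξ : Ω → M}
  {Φ : ℝ → ℝ → U ⊕ Unit → M → U ⊕ Unit} {r : ℝ → U → M → ℝ≥0∞} {τ : ShiftSpace X p → M → M}
  {A : ℝ → ℝ → U × M → U →L[ℝ] ShiftSpace X p}
  [SecondCountableTopology U] [MeasurableSpace U] [BorelSpace U] [SecondCountableTopology M]
  [MeasurableSpace M] [BorelSpace M] [SecondCountableTopology (ShiftSpace X p)]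
  [MeasurableSpace (ShiftSpace X p)] [BorelSpace (ShiftSpace X p)]

omit [SecondCountableTopology U] [SecondCountableTopology (ShiftSpace X p)] in
theorem IsNoiseTransfer.measurable_transferField (hA : IsNoiseTransfer P ι ξξ Φ r τ A)
    (hΦ : IsRegularFlow Φ) {s : ℝ} (hs : 0 < s) (hs1 : s ≤ 1) (w : U) :
    Measurable (transferField Φ A s w) := by
  classical
  have hO := hΦ.isOpen_survival hs.le hs1
  have h1 := ContinuousOn.measurable_piecewise (f := transferField Φ A s w)
    (g := fun _ => (0 : ShiftSpace X p)) (hA.continuousOn_transferField hs hs1 w)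
    continuousOn_const hO.measurableSet
  convert h1 using 1
  ext1 x
  by_cases hx : x ∈ survival Φ s
  · rw [piecewise_eq_of_mem _ _ _ hx]
  · rw [piecewise_eq_of_notMem _ _ _ hx, transferField, indicator_of_notMem hx]

omit [SecondCountableTopology U] in
theorem IsNoiseTransfer.measurable_transferEuler (hA : IsNoiseTransfer P ι ξξ Φ r τ A)
    (hΦ : IsRegularFlow Φ) (hτ : IsShiftAction hp P ι j ξξ Φ τ) {s : ℝ} (hs : 0 < s) (hs1 : s ≤ 1)
    (u w : U) (n i : ℕ) : Measurable fun ξ => transferEuler Φ τ A u w s ξ n i := by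
  induction i with
  | zero => exact measurable_const
  | succ i ih =>
    have h1 : Measurable fun ξ => τ (transferEuler Φ τ A u w s ξ n i) ξ :=
      hτ.continuous.measurable.comp (ih.prodMk measurable_id)
    have h2 : Measurable fun ξ => transferField Φ A s w (u + (i / n : ℝ) • w,
        τ (transferEuler Φ τ A u w s ξ n i) ξ) :=
      (hA.measurable_transferField hΦ hs hs1 w).comp (measurable_const.prodMk h1)
    exact ih.add (h2.const_smul (1 / n : ℝ))

end Measurability

/-! ### Comparison of the transition probabilities from nearby points -/

theorem continuous_toU {U : Type*} [Zero U] [TopologicalSpace U] :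
    Continuous (toU : U ⊕ Unit → U) :=
  continuous_id.sumElim continuous_const

section GoodSet

variable {X U M : Type*} [NormedAddCommGroup X] {p : ℝ≥0∞} [NormedSpace ℝ X] [Fact (1 ≤ p)]
  [NormedAddCommGroup U] [NormedSpace ℝ U] [MetricSpace M]
variable {Ω H₀ : Type*} [NormedAddCommGroup Ω] [NormedSpace ℝ Ω] [MeasurableSpace Ω]
  [NormedAddCommGroup H₀] [InnerProductSpace ℝ H₀]
  {P : Measure Ω} {ι : NoiseSpace H₀ →L[ℝ] Ω} {hp : 2 < p} {j : X →L[ℝ] H₀} {ξξ : Ω → M}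
  {Φ : ℝ → ℝ → U ⊕ Unit → M → U ⊕ Unit} {r : ℝ → U → M → ℝ≥0∞} {τ : ShiftSpace X p → M → M}
  {A : ℝ → ℝ → U × M → U →L[ℝ] ShiftSpace X p}

/-- The noises for which `A_1^{(1)}` is bounded and Lipschitz near `(0, ξ)`, uniformly along small
shifts. -/
def goodSet (Φ : ℝ → ℝ → U ⊕ Unit → M → U ⊕ Unit) (τ : ShiftSpace X p → M → M)
    (A : ℝ → ℝ → U × M → U →L[ℝ] ShiftSpace X p) (m : ℕ) : Set M :=
  {ξ | ∀ (u : U) (h : ShiftSpace X p), ‖u‖ ≤ 1 / m → ‖h‖ ≤ 1 / m →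
    (u, τ h ξ) ∈ survival Φ 1 ∧ ‖A 1 1 (u, τ h ξ)‖ ≤ m ∧
    ∀ (u' : U) (h' : ShiftSpace X p), ‖u'‖ ≤ 1 / m → ‖h'‖ ≤ 1 / m →
      ‖A 1 1 (u, τ h ξ) - A 1 1 (u', τ h' ξ)‖ ≤ m * (‖u - u'‖ + ‖h - h'‖)}

/-- Local Lipschitz continuity of `A_1^{(1)}` composed with that of `h ↦ τ h ξ`; any sufficiently
large `m` serves as inverse radius, bound and Lipschitz constant at once. -/
theorem IsNoiseTransfer.exists_mem_goodSet (hA : IsNoiseTransfer P ι ξξ Φ r τ A)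
    (hΦ : IsRegularFlow Φ) (hτ : IsShiftAction hp P ι j ξξ Φ τ) {ξ : M}
    (hξ : ((0 : U), ξ) ∈ survival Φ 1) : ∃ m : ℕ, 0 < m ∧ ξ ∈ goodSet Φ τ A m := by
  have hO := hΦ.isOpen_survival zero_le_one le_rfl
  obtain ⟨K, t, ht, hK⟩ := hA.locallyLipschitz 1 1 one_pos le_rfl le_rfl hξ
  rw [hO.nhdsWithin_eq hξ] at ht
  obtain ⟨K', t', ht', hK'⟩ := hτ.locallyLipschitz ξ 0
  have hF : Continuous fun q : U × ShiftSpace X p => (q.1, τ q.2 ξ) :=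
    continuous_fst.prodMk (hτ.continuous.comp (continuous_snd.prodMk continuous_const))
  have hF0 : Tendsto (fun q : U × ShiftSpace X p => (q.1, τ q.2 ξ)) (𝓝 0) (𝓝 (0, ξ)) := by
    have := hF.tendsto 0
    rwa [Prod.snd_zero, Prod.fst_zero, hτ.zero] at this
  have h1 : ∀ᶠ q : U × ShiftSpace X p in 𝓝 0,
      (q.1, τ q.2 ξ) ∈ t ∧ (q.1, τ q.2 ξ) ∈ survival Φ 1 ∧ q.2 ∈ t' :=
    (hF0.eventually ht).and ((hF0.eventually (hO.mem_nhds hξ)).and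
      ((continuous_snd.tendsto (0 : U × ShiftSpace X p)).eventually ht'))
  obtain ⟨δ, hδ, hball⟩ := Metric.eventually_nhds_iff.1 h1
  obtain ⟨m, hm⟩ := exists_nat_gt (max (max (1 / δ) 1)
    (‖A 1 1 (0, ξ)‖ + 2 * (K * (1 + K'))))
  have hmδ : 1 / δ < m := ((le_max_left _ _).trans (le_max_left _ _)).trans_lt hm
  have hm1 : (1 : ℝ) < m := ((le_max_right _ _).trans (le_max_left _ _)).trans_lt hm
  have hmA : ‖A 1 1 (0, ξ)‖ + 2 * (K * (1 + K')) < m := (le_max_right _ _).trans_lt hm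
  have hm0 : (0 : ℝ) < m := one_pos.trans hm1
  have hmδ' : 1 / (m : ℝ) < δ := (one_div_lt hδ hm0).1 hmδ
  have hm1' : 1 / (m : ℝ) ≤ 1 := (div_le_one hm0).2 hm1.le
  have hb : ∀ (u : U) (h : ShiftSpace X p), ‖u‖ ≤ 1 / m → ‖h‖ ≤ 1 / m →
      (u, τ h ξ) ∈ t ∧ (u, τ h ξ) ∈ survival Φ 1 ∧ h ∈ t' := fun u h hu hh =>
    hball (y := (u, h)) (by
      rw [dist_zero_right, Prod.norm_def]
      exact (max_le hu hh).trans_lt hmδ')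
  have hlip : ∀ (u : U) (h : ShiftSpace X p), ‖u‖ ≤ 1 / m → ‖h‖ ≤ 1 / m →
      ∀ (u' : U) (h' : ShiftSpace X p), ‖u'‖ ≤ 1 / m → ‖h'‖ ≤ 1 / m →
      ‖A 1 1 (u, τ h ξ) - A 1 1 (u', τ h' ξ)‖ ≤ K * (1 + K') * (‖u - u'‖ + ‖h - h'‖) := by
    intro u h hu hh u' h' hu' hh'
    have h2 := hK.dist_le_mul _ (hb u h hu hh).1 _ (hb u' h' hu' hh').1
    have h3 := hK'.dist_le_mul _ (hb u h hu hh).2.2 _ (hb u' h' hu' hh').2.2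
    rw [dist_eq_norm] at h2 h3
    rw [mul_assoc]
    refine h2.trans (mul_le_mul_of_nonneg_left ?_ K.2)
    rw [Prod.dist_eq]
    have h4 : 0 ≤ (K' : ℝ) := K'.2
    have h5 := norm_nonneg (u - u')
    have h6 := norm_nonneg (h - h')
    refine max_le ?_ (h3.trans ?_)
    · rw [dist_eq_norm]
      nlinarith
    · nlinarith
  have h0 : ‖(0 : U)‖ ≤ 1 / m := by rw [norm_zero]; positivity
  have h0' : ‖(0 : ShiftSpace X p)‖ ≤ 1 / m := by rw [norm_zero]; positivity
  have hKK : 0 ≤ (K : ℝ) * (1 + K') := by positivity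
  refine ⟨m, by exact_mod_cast hm0, fun u h hu hh => ⟨(hb u h hu hh).2.1, ?_, ?_⟩⟩
  · have h2 := hlip u h hu hh 0 0 h0 h0'
    rw [hτ.zero, sub_zero, sub_zero] at h2
    have h3 := norm_le_norm_add_norm_sub' (A 1 1 (u, τ h ξ)) (A 1 1 (0, ξ))
    have h4 : K * (1 + K') * (‖u‖ + ‖h‖) ≤ K * (1 + K') * 2 :=
      mul_le_mul_of_nonneg_left (by linarith) hKK
    linarith
  · intro u' h' hu' hh'
    refine (hlip u h hu hh u' h' hu' hh').trans (mul_le_mul_of_nonneg_right ?_ (by positivity))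
    linarith [norm_nonneg (A 1 1 ((0 : U), ξ))]

/-! ### Steering one initial point to another by shifting the noise -/

theorem norm_segment_le {u u' : U} {δ x : ℝ} (hu : ‖u‖ ≤ δ) (hu' : ‖u'‖ ≤ δ)
    (hx : x ∈ Icc (0 : ℝ) 1) : ‖u + x • (u' - u)‖ ≤ δ := by
  have h1 : u + x • (u' - u) = (1 - x) • u + x • u' := by
    rw [smul_sub, sub_smul, one_smul]; abel
  rw [h1]
  refine (norm_add_le _ _).trans ?_
  rw [norm_smul, norm_smul, Real.norm_of_nonneg hx.1, Real.norm_of_nonneg (sub_nonneg.2 hx.2)]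
  nlinarith [hx.1, hx.2]

/-- The transfer identity read as the transport equation of `le_of_transport_equation`.
Differentiability at `h` reduces to that at `0` for the noise `τ h ξ`, since `τ` is an action. -/
theorem hasFDerivAt_shift_and_hasDerivAt_segment (hA : IsNoiseTransfer P ι ξξ Φ r τ A)
    (hΦ : IsRegularFlow Φ) (hτ : IsShiftAction hp P ι j ξξ Φ τ) (hd : IsShiftDifferentiable Φ τ)
    (ℓ : StrongDual ℝ U) {u w : U} {x : ℝ} {h : ShiftSpace X p} {ξ : M}
    (hs : (u + x • w, τ h ξ) ∈ survival Φ 1) :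
    ∃ g : StrongDual ℝ (ShiftSpace X p),
      HasFDerivAt (fun h => ℓ (toU (Φ 0 1 (Sum.inl (u + x • w)) (τ h ξ)))) g h ∧
      HasDerivAt (fun x : ℝ => ℓ (toU (Φ 0 1 (Sum.inl (u + x • w)) (τ h ξ))))
        (-(g (A 1 1 (u + x • w, τ h ξ) w))) x := by
  have h1 := (hd 1 ⟨zero_le_one, le_rfl⟩ _ _ hs).hasFDerivAt
  have h2 := (hΦ.differentiable 0 1 le_rfl zero_le_one le_rfl (u + x • w) (τ h ξ) hs).hasFDerivAt
  have h3 := hA.transfer 1 ⟨one_pos, le_rfl⟩ _ _ hs w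
  set g := fderiv ℝ (fun h' : ShiftSpace X p =>
    toU (Φ 0 1 (Sum.inl (u + x • w)) (τ h' (τ h ξ)))) 0
  refine ⟨ℓ.comp g, ?_, ?_⟩
  · have h4 : HasFDerivAt (fun h' : ShiftSpace X p => h' - h) (ContinuousLinearMap.id ℝ _) h :=
      (hasFDerivAt_id h).sub_const h
    rw [← sub_self h] at h1
    have h5 := ℓ.hasFDerivAt.comp h (HasFDerivAt.comp (f := fun h' => h' - h) h h1 h4)
    rw [ContinuousLinearMap.comp_id] at h5
    refine h5.congr_of_eventuallyEq (Eventually.of_forall fun h' => ?_)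
    simp only [Function.comp_apply, ← hτ.add, sub_add_cancel]
  · have h4 : HasDerivAt (fun x : ℝ => u + x • w) w x := by
      simpa using ((hasDerivAt_id x).smul_const w).const_add u
    have h5 := ℓ.hasFDerivAt.comp_hasDerivAt x (h2.comp_hasDerivAt x h4)
    refine h5.congr_deriv ?_
    rw [eq_neg_of_add_eq_zero_left h3, map_neg, ContinuousLinearMap.comp_apply]

omit [MetricSpace M] in
-- The radius `1/(4m²)` gives `‖u' - u‖ ≤ 1/(2m²)`, hence speed at most `1/(2m)`: the curve stays in
-- half of the ball of radius `1/m` on which `goodSet` gives control, as the transport argument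
-- requires.
theorem transferField_bound {m : ℕ} (hm : 0 < m) {ξ : M} (hξ : ξ ∈ goodSet Φ τ A m) {u u' : U}
    (hu : ‖u‖ ≤ 1 / (4 * m ^ 2)) (hu' : ‖u'‖ ≤ 1 / (4 * m ^ 2)) {x : ℝ} (hx : x ∈ Icc (0 : ℝ) 1)
    {h : ShiftSpace X p} (hh : ‖h‖ ≤ 1 / m) :
    (u + x • (u' - u), τ h ξ) ∈ survival Φ 1 ∧
      ‖transferField Φ A 1 (u' - u) (u + x • (u' - u), τ h ξ)‖ ≤ 1 / (2 * m) := by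
  have hm1 : (1 : ℝ) ≤ m := by exact_mod_cast hm
  have hle : 1 / (4 * (m : ℝ) ^ 2) ≤ 1 / m :=
    one_div_le_one_div_of_le (by positivity) (by nlinarith)
  obtain ⟨h1, h2, -⟩ := hξ _ h (norm_segment_le (hu.trans hle) (hu'.trans hle) hx) hh
  refine ⟨h1, ?_⟩
  rw [transferField, indicator_of_mem h1]
  refine (ContinuousLinearMap.le_of_opNorm_le _ h2 _).trans ?_
  have h3 : ‖u' - u‖ ≤ 1 / (2 * (m : ℝ) ^ 2) := by
    refine (norm_sub_le _ _).trans ((add_le_add hu' hu).trans_eq ?_)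
    field_simp
    norm_num
  refine (mul_le_mul_of_nonneg_left h3 (by positivity)).trans_eq ?_
  field_simp

omit [MetricSpace M] in
theorem norm_transferEuler_le {m : ℕ} (hm : 0 < m) {ξ : M} (hξ : ξ ∈ goodSet Φ τ A m) {u u' : U}
    (hu : ‖u‖ ≤ 1 / (4 * m ^ 2)) (hu' : ‖u'‖ ≤ 1 / (4 * m ^ 2)) {n i : ℕ} (hi : i ≤ n) :
    ‖transferEuler Φ τ A u (u' - u) 1 ξ n i‖ ≤ 1 / (2 * m) := by
  have hm0 : (0 : ℝ) < m := by exact_mod_cast hm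
  have hle : 1 / (2 * (m : ℝ)) ≤ 1 / m := one_div_le_one_div_of_le hm0 (by linarith)
  refine (norm_eulerPoint_le (by positivity) le_rfl (fun x hx h hh =>
    (transferField_bound hm hξ hu hu' hx (hh.trans hle)).2) hi).trans ?_
  refine mul_le_of_le_one_left (by positivity) (div_le_one_of_le₀ ?_ (by positivity))
  exact_mod_cast hi

theorem exists_shift_of_mem_goodSet (hA : IsNoiseTransfer P ι ξξ Φ r τ A)
    (hΦ : IsRegularFlow Φ) (hτ : IsShiftAction hp P ι j ξξ Φ τ) (hd : IsShiftDifferentiable Φ τ)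
    [CompleteSpace X] {m : ℕ} (hm : 0 < m) {ξ : M} (hξ : ξ ∈ goodSet Φ τ A m) {u u' : U}
    (hu : ‖u‖ ≤ 1 / (4 * m ^ 2)) (hu' : ‖u'‖ ≤ 1 / (4 * m ^ 2)) :
    ∃ h : ShiftSpace X p,
      Tendsto (fun n => transferEuler Φ τ A u (u' - u) 1 ξ n n) atTop (𝓝 h) ∧
      Φ 0 1 (Sum.inl u') (τ h ξ) = Φ 0 1 (Sum.inl u) ξ := by
  have hm0 : (0 : ℝ) < m := by exact_mod_cast hm
  have hm1 : (1 : ℝ) ≤ m := by exact_mod_cast hm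
  have h2ρ : 2 * (1 / (2 * (m : ℝ))) = 1 / m := by field_simp
  have hρ : 0 < 1 / (2 * (m : ℝ)) := by positivity
  have hle : 1 / (2 * (m : ℝ)) ≤ 1 / m := one_div_le_one_div_of_le hm0 (by linarith)
  have hle2 : 1 / (4 * (m : ℝ) ^ 2) ≤ 1 / m :=
    one_div_le_one_div_of_le (by positivity) (by nlinarith)
  set w := u' - u with hw
  obtain ⟨a, ha⟩ : ∃ a : ℝ → ShiftSpace X p → ShiftSpace X p,
    a = fun x h => transferField Φ A 1 w (u + x • w, τ h ξ) := ⟨_, rfl⟩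
  have hseg : ∀ x ∈ Icc (0 : ℝ) 1, ‖u + x • w‖ ≤ 1 / m := fun x hx =>
    norm_segment_le (hu.trans hle2) (hu'.trans hle2) hx
  have hb : ∀ x ∈ Icc (0 : ℝ) 1, ∀ h, ‖h‖ ≤ 1 / m →
      (u + x • w, τ h ξ) ∈ survival Φ 1 ∧ ‖a x h‖ ≤ 1 / (2 * m) := fun x hx h hh => by
    rw [ha]
    exact transferField_bound hm hξ hu hu' hx hh
  have haA : ∀ x ∈ Icc (0 : ℝ) 1, ∀ h, ‖h‖ ≤ 1 / m → a x h = A 1 1 (u + x • w, τ h ξ) w :=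
    fun x hx h hh => by
      rw [ha]
      exact indicator_of_mem (hb x hx h hh).1 _
  have hlip : ∀ x ∈ Icc (0 : ℝ) 1, ∀ y ∈ Icc (0 : ℝ) 1, ∀ h k : ShiftSpace X p,
      ‖h‖ ≤ 1 / m → ‖k‖ ≤ 1 / m →
      ‖a x h - a y k‖ ≤ (m * (‖w‖ + 1) * ‖w‖) * (|x - y| + ‖h - k‖) := by
    intro x hx y hy h k hh hk
    rw [haA x hx h hh, haA y hy k hk, ← sub_apply]
    have h1 := (hξ _ h (hseg x hx) hh).2.2 _ k (hseg y hy) hk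
    refine (ContinuousLinearMap.le_of_opNorm_le _ h1 w).trans ?_
    have h2 : ‖u + x • w - (u + y • w)‖ = |x - y| * ‖w‖ := by
      rw [add_sub_add_left_eq_sub, ← sub_smul, norm_smul, Real.norm_eq_abs]
    rw [h2]
    have h3 : |x - y| * ‖w‖ + ‖h - k‖ ≤ (‖w‖ + 1) * (|x - y| + ‖h - k‖) := by
      nlinarith [abs_nonneg (x - y), norm_nonneg w, norm_nonneg (h - k),
        mul_nonneg (norm_nonneg w) (norm_nonneg (h - k))]
    calc m * (|x - y| * ‖w‖ + ‖h - k‖) * ‖w‖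
        ≤ m * ((‖w‖ + 1) * (|x - y| + ‖h - k‖)) * ‖w‖ := by gcongr
      _ = _ := by ring
  obtain ⟨c, hc0, hcρ, hc⟩ := exists_integral_curve (a := a) hρ.le le_rfl
    (show 0 ≤ m * (‖w‖ + 1) * ‖w‖ by positivity)
    (fun x hx h hh => (hb x hx h (hh.trans hle)).2)
    (fun x hx y hy h k hh hk => hlip x hx y hy h k (hh.trans hle) (hk.trans hle))
  have htend := tendsto_eulerPoint (a := a) hρ.le le_rfl
    (show 0 ≤ m * (‖w‖ + 1) * ‖w‖ by positivity)
    (fun x hx h hh => (hb x hx h (hh.trans hle)).2)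
    (fun x hx y hy h k hh hk => hlip x hx y hy h k (hh.trans hle) (hk.trans hle)) hc0 hcρ hc
  refine ⟨c 1, by rw [ha] at htend; exact htend, ?_⟩
  have hc1 : ‖c 1‖ ≤ 1 / m := (hcρ 1 ⟨zero_le_one, le_rfl⟩).trans hle
  have hu1 : u + (1 : ℝ) • w = u' := by rw [one_smul, hw, add_sub_cancel]
  have hu0 : u + (0 : ℝ) • w = u := by rw [zero_smul, add_zero]
  have hcont : ContinuousOn (fun q : ℝ × ShiftSpace X p =>
      toU (Φ 0 1 (Sum.inl (u + q.1 • w)) (τ q.2 ξ))) (Icc 0 1 ×ˢ Metric.closedBall 0 (1 / m)) := by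
    have h1 : Continuous fun q : ℝ × ShiftSpace X p => (u + q.1 • w, τ q.2 ξ) :=
      (continuous_const.add (continuous_fst.smul continuous_const)).prodMk
        (hτ.continuous.comp (continuous_snd.prodMk continuous_const))
    refine continuous_toU.comp_continuousOn ((hΦ.continuousOn_flow zero_le_one le_rfl).comp
      h1.continuousOn fun q hq => (hb q.1 hq.1 q.2 ?_).1)
    simpa using hq.2
  have key : toU (Φ 0 1 (Sum.inl u') (τ (c 1) ξ)) = toU (Φ 0 1 (Sum.inl u) ξ) := by
    -- The transport equation is scalar, so the end points are compared through continuous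
    -- functionals.
    refine (SeparatingDual.eq_iff_forall_dual_eq (R := ℝ)).2 fun ℓ => ?_
    have h1 := eq_of_transport_equation (G := fun x h =>
      ℓ (toU (Φ 0 1 (Sum.inl (u + x • w)) (τ h ξ)))) (a := a) hρ
      (show 0 ≤ m * (‖w‖ + 1) * ‖w‖ by positivity) hc hcρ (by rw [h2ρ]; exact hlip)
      (by rw [h2ρ]; exact ℓ.continuous.comp_continuousOn hcont) (by
        rw [h2ρ]
        intro x hx h hh
        rw [haA x hx h hh.le]
        exact hasFDerivAt_shift_and_hasDerivAt_segment hA hΦ hτ hd ℓ (hb x hx h hh.le).1)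
    simpa only [hu1, hu0, hc0, hτ.zero] using h1
  -- `toU` sends the death state to `0`, so equality of values gives equality of states only because
  -- both sides survive.
  have s1 := (hb 1 ⟨zero_le_one, le_rfl⟩ (c 1) hc1).1
  have s0 := (hb 0 ⟨le_rfl, zero_le_one⟩ 0 (by rw [norm_zero]; positivity)).1
  rw [hu1] at s1
  rw [hu0, hτ.zero] at s0
  simp only [survival, mem_ofPred_eq] at s0 s1
  revert key s0 s1
  rcases Φ 0 1 (Sum.inl u') (τ (c 1) ξ) with v | ⟨⟩ <;> rcases Φ 0 1 (Sum.inl u) ξ with v' | ⟨⟩ <;>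
    simp [toU]

/-- On the good event the target `O` is reached from `u'` under the limiting shift, hence, `O` being
open, under all late Euler iterates. These are adapted, so `measure_adapted_shift_le` bounds each
event uniformly in `n`. -/
theorem measure_goodSet_inter_le (hA : IsNoiseTransfer P ι ξξ Φ r τ A) (hΦc : IsConsistent Φ)
    (hΦ : IsRegularFlow Φ) (hτ : IsShiftAction hp P ι j ξξ Φ τ) (hd : IsShiftDifferentiable Φ τ)
    (hι : IsCameronMartin P ι) (hp_top : p ≠ ∞)
    [SecondCountableTopology Ω] [CompleteSpace Ω] [BorelSpace Ω] [IsGaussian P]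
    [SecondCountableTopology X] [CompleteSpace X] [SecondCountableTopology U]
    [SecondCountableTopology M] [MeasurableSpace M] [BorelSpace M] (hξξ : AEMeasurable ξξ P)
    {m : ℕ} (hm : 0 < m) {u u' : U}
    (hu : ‖u‖ ≤ 1 / (4 * m ^ 2)) (hu' : ‖u'‖ ≤ 1 / (4 * m ^ 2)) {O : Set (U ⊕ Unit)}
    (hO : IsOpen O) :
    P {ω | ξξ ω ∈ goodSet Φ τ A m ∧ Φ 0 1 (Sum.inl u) (ξξ ω) ∈ O} ≤
      ENNReal.ofReal (Real.exp (2 * ‖j‖ ^ 2)) *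
        P {ω | Φ 0 1 (Sum.inl u') (ξξ ω) ∈ O} ^ (1 / 2 : ℝ) := by
  have : Fact (p ≠ ∞) := ⟨hp_top⟩
  have : SecondCountableTopology (ShiftSpace X p) := inferInstance
  borelize (ShiftSpace X p)
  borelize U
  have hm0 : (0 : ℝ) < m := by exact_mod_cast hm
  have hm1 : (1 : ℝ) ≤ m := by exact_mod_cast hm
  have hle : 1 / (2 * (m : ℝ)) ≤ 1 / m := one_div_le_one_div_of_le hm0 (by linarith)
  have hle2 : 1 / (4 * (m : ℝ) ^ 2) ≤ 1 / m :=
    one_div_le_one_div_of_le (by positivity) (by nlinarith)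
  have hle1 : 1 / (2 * (m : ℝ)) ≤ 1 := (div_le_one (by positivity)).2 (by linarith)
  have hcont : ∀ (ξ : M), ξ ∈ goodSet Φ τ A m → ∀ h : ShiftSpace X p, ‖h‖ ≤ 1 / m →
      Φ 0 1 (Sum.inl u') (τ h ξ) ∈ O → {x | Φ 0 1 (Sum.inl u') (τ x ξ) ∈ O} ∈ 𝓝 h := by
    intro ξ hξ h hh hhO
    have h1 : Continuous fun x : ShiftSpace X p => (u', τ x ξ) :=
      continuous_const.prodMk (hτ.continuous.comp (continuous_id.prodMk continuous_const))
    have h2 := (hΦ.continuousOn_flow zero_le_one le_rfl).continuousAt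
      ((hΦ.isOpen_survival zero_le_one le_rfl).mem_nhds (hξ u' h (hu'.trans hle2) hh).1)
    exact (ContinuousAt.comp (f := fun x : ShiftSpace X p => (u', τ x ξ)) h2
      h1.continuousAt).eventually (hO.mem_nhds hhO)
  refine measure_le_of_eventually_mem (Γ := {ω | ξξ ω ∈ goodSet Φ τ A m ∧
      Φ 0 1 (Sum.inl u) (ξξ ω) ∈ O})
    (S := fun n => {ω | ξξ ω ∈ goodSet Φ τ A m} ∩
      {ω | Φ 0 1 (Sum.inl u') (τ (transferEuler Φ τ A u (u' - u) 1 (ξξ ω) n n) (ξξ ω)) ∈ O})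
    (Eventually.of_forall fun ω hω => ?_) fun n => ?_
  · obtain ⟨h, hh, heq⟩ := exists_shift_of_mem_goodSet hA hΦ hτ hd hm hω.1 hu hu'
    have hhm : ‖h‖ ≤ 1 / m := (le_of_tendsto hh.norm (Eventually.of_forall fun n =>
      norm_transferEuler_le hm hω.1 hu hu' le_rfl)).trans hle
    filter_upwards [hh.eventually (hcont _ hω.1 h hhm (by rw [heq]; exact hω.2))] with n hn
    exact ⟨hω.1, hn⟩
  · have hmk : ∀ᵐ ω ∂P, ξξ ω = hξξ.mk ξξ ω := hξξ.ae_eq_mk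
    refine measure_adapted_shift_le hι hp hp_top j
      (η := fun s ω => transferEuler Φ τ A u (u' - u) s (hξξ.mk ξξ ω) n n)
      (ζ := fun ω => transferEuler Φ τ A u (u' - u) 1 (ξξ ω) n n)
      (B := fun ω => {x | Φ 0 1 (Sum.inl u') (τ x (ξξ ω)) ∈ O})
      (S := {ω | Φ 0 1 (Sum.inl u') (ξξ ω) ∈ O})
      (fun s hs hs1 => ?_) (fun s hs hs1 x hx => ?_) (fun s hs hs1 => ?_)
      (fun ω hω => ?_) (fun x => ?_) fun ω hω => ?_
    · exact (hA.measurable_transferEuler hΦ hτ hs hs1 u _ n n).comp hξξ.measurable_mk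
    · filter_upwards [hmk, (hι.quasiMeasurePreserving_add (shiftHom hp j x)).ae hmk,
        hτ.shift x, hA.ae_transferEuler_shift_eq hι hτ hΦ hs hs1 u (u' - u) n]
        with ω h1 h2 h3 h4
      have h3' : ξξ (ω + ι (shiftHom hp j x)) = τ x (ξξ ω) := h3
      rw [← h1, ← h2, h3', h4 x hx]
    · filter_upwards [hmk, hA.ae_vanishesOn_transferEuler_sub hΦc hι hτ hΦ hs hs1 u (u' - u) n]
        with ω h1 h2 hω
      rw [← h1]
      refine h2 (fun i hi => (transferField_bound hm hω hu hu' ⟨by positivity, ?_⟩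
        ((norm_transferEuler_le hm hω hu hu' hi.le).trans hle)).1) n le_rfl
      exact div_le_one_of_le₀ (by exact_mod_cast hi.le) (by positivity)
    · exact (norm_transferEuler_le hm hω hu hu' le_rfl).trans hle1
    · filter_upwards [hτ.shift x] with ω h1 h2
      have h1' : ξξ (ω + ι (shiftHom hp j x)) = τ x (ξξ ω) := h1
      simpa only [mem_ofPred_eq, h1'] using h2
    · exact hcont _ hω.1 _ ((norm_transferEuler_le hm hω.1 hu hu' le_rfl).trans hle) hω.2

end GoodSet

/-! ### Invariant measures of Markov kernels -/

section Invariant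

variable {Y : Type*} [MeasurableSpace Y]

theorem bind_mono {κ : Y → Measure Y} (hκ : Measurable κ) {μ ν : Measure Y} (h : μ ≤ ν) :
    μ.bind κ ≤ ν.bind κ := by
  refine Measure.le_iff.2 fun s hs => ?_
  rw [Measure.bind_apply hs hκ.aemeasurable, Measure.bind_apply hs hκ.aemeasurable]
  exact lintegral_mono' h le_rfl

theorem bind_apply_univ {κ : Y → Measure Y} (hκ : Measurable κ) [∀ y, IsProbabilityMeasure (κ y)]
    (μ : Measure Y) : μ.bind κ univ = μ univ := by
  rw [Measure.bind_apply .univ hκ.aemeasurable]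
  simp

theorem bind_sub_eq {κ : Y → Measure Y} (hκ : Measurable κ)
    {μ ν : Measure Y} [IsFiniteMeasure ν] (hμ : μ.bind κ = μ) (hν : ν.bind κ = ν) (h : ν ≤ μ) :
    (μ - ν).bind κ = μ - ν := by
  have h1 : (μ - ν).bind κ + ν = μ := by
    conv_rhs => rw [← hμ, ← Measure.sub_add_cancel_of_le h]
    refine Measure.ext fun s hs => ?_
    rw [Measure.add_apply, Measure.bind_apply hs hκ.aemeasurable,
      Measure.bind_apply hs hκ.aemeasurable, lintegral_add_measure,
      ← Measure.bind_apply hs hκ.aemeasurable (m := ν), hν]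
  calc (μ - ν).bind κ = (μ - ν).bind κ + ν - ν := Measure.add_sub_cancel.symm
    _ = μ - ν := by rw [h1]

/-- Two different invariant probability measures of a Markov kernel dominate mutually singular
nonzero invariant measures. -/
theorem exists_mutuallySingular_invariant {κ : Y → Measure Y} (hκ : Measurable κ)
    [∀ y, IsProbabilityMeasure (κ y)] {μ ν : Measure Y} [IsProbabilityMeasure μ]
    [IsProbabilityMeasure ν] (hμ : μ.bind κ = μ) (hν : ν.bind κ = ν) (hne : μ ≠ ν) :
    ∃ μ' ν' : Measure Y, μ' ≠ 0 ∧ ν' ≠ 0 ∧ μ' ≤ μ ∧ ν' ≤ ν ∧ μ'.bind κ = μ' ∧ ν'.bind κ = ν' ∧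
      μ' ⟂ₘ ν' := by
  obtain ⟨m, hm⟩ : ∃ m : Measure Y, m = μ ⊓ ν := ⟨_, rfl⟩
  have hmμ : m ≤ μ := hm ▸ inf_le_left
  have hmν : m ≤ ν := hm ▸ inf_le_right
  have : IsFiniteMeasure m := isFiniteMeasure_of_le μ hmμ
  -- A Markov kernel is monotone and preserves mass, so `m.bind κ ≤ μ ⊓ ν = m` with equal total
  -- mass.
  have hmm : m.bind κ = m := by
    have h1 : m.bind κ ≤ m := by
      conv_rhs => rw [hm]
      exact le_inf ((bind_mono hκ hmμ).trans_eq hμ) ((bind_mono hκ hmν).trans_eq hν)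
    have : IsFiniteMeasure (m.bind κ) := isFiniteMeasure_of_le m h1
    exact Measure.eq_of_le_of_measure_univ_eq h1 (bind_apply_univ hκ m)
  have hsub : ∀ μ₁ μ₂ : Measure Y, IsProbabilityMeasure μ₁ → IsProbabilityMeasure μ₂ →
      m ≤ μ₁ → m ≤ μ₂ → μ₁ ≠ μ₂ → μ₁ - m ≠ 0 := by
    intro μ₁ μ₂ _ _ h1 h2 h12 h0
    have h3 := Measure.sub_add_cancel_of_le h1
    rw [h0, zero_add] at h3
    exact h12 (Measure.eq_of_le_of_measure_univ_eq (h3 ▸ h2) (by simp))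
  refine ⟨μ - m, ν - m, hsub μ ν ‹_› ‹_› hmμ hmν hne, hsub ν μ ‹_› ‹_› hmν hmμ hne.symm,
    Measure.sub_le, Measure.sub_le, bind_sub_eq hκ hμ hmm hmμ, bind_sub_eq hκ hν hmm hmν,
    Measure.mutuallySingular_of_disjoint ?_⟩
  rw [disjoint_iff_inf_le]
  have h1 : (μ - m) ⊓ (ν - m) + m ≤ m := by
    conv_rhs => rw [hm]
    refine le_inf ?_ ?_
    · calc (μ - m) ⊓ (ν - m) + m ≤ (μ - m) + m := by gcongr; exact inf_le_left
        _ = μ := Measure.sub_add_cancel_of_le hmμ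
    · calc (μ - m) ⊓ (ν - m) + m ≤ (ν - m) + m := by gcongr; exact inf_le_right
        _ = ν := Measure.sub_add_cancel_of_le hmν
  refine Measure.le_iff.2 fun s hs => ?_
  have h2 := h1 s
  rw [Measure.add_apply] at h2
  have h3 : ((μ - m) ⊓ (ν - m)) s + m s ≤ 0 + m s := by rwa [zero_add]
  exact (ENNReal.add_le_add_iff_right (measure_ne_top m s)).1 h3

theorem ae_eq_zero_of_bind_eq {κ : Y → Measure Y} (hκ : Measurable κ) {μ : Measure Y}
    (hμ : μ.bind κ = μ) {s : Set Y} (hs : MeasurableSet s) (h : μ s = 0) : ∀ᵐ y ∂μ, κ y s = 0 := by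
  rw [← hμ, Measure.bind_apply hs hκ.aemeasurable] at h
  exact (lintegral_eq_zero_iff ((Measure.measurable_coe hs).comp hκ)).1 h

theorem measure_ne_zero_of_bind_eq {κ : Y → Measure Y} (hκ : Measurable κ) {μ : Measure Y} (h0 : μ ≠ 0)
    (hμ : μ.bind κ = μ) {s : Set Y} (hs : MeasurableSet s) (hpos : ∀ᵐ y ∂μ, κ y s ≠ 0) :
    μ s ≠ 0 := by
  intro h
  have : ∀ᵐ y ∂μ, False := by
    filter_upwards [hpos, ae_eq_zero_of_bind_eq hκ hμ hs h] with y h1 h2 using h1 h2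
  rw [ae_iff] at this
  exact h0 (Measure.measure_univ_eq_zero.1 (by simpa using this))

end Invariant

/-! ### The transition probabilities -/

theorem borelSpace_sum_unit {U : Type*} [Zero U] [TopologicalSpace U] [MeasurableSpace U]
    [BorelSpace U] : BorelSpace (U ⊕ Unit) := by
  refine ⟨le_antisymm (fun s hs => ?_) ?_⟩
  · have hs1 : MeasurableSet (Sum.inl ⁻¹' s : Set U) := (measurableSet_sum_iff.1 hs).1
    have h1 : s = (toU ⁻¹' (Sum.inl ⁻¹' s : Set U) ∩ range Sum.inl)
        ∪ Sum.inr '' (Sum.inr ⁻¹' s) := by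
      ext x
      rcases x with u | x
      · simp [toU]
      · simpa using ⟨fun h => ⟨x, h⟩, fun ⟨_, h⟩ => h⟩
    rw [h1]
    have h2 : Measurable[borel (U ⊕ Unit)] (toU : U ⊕ Unit → U) := by
      borelize (U ⊕ Unit)
      exact continuous_toU.measurable
    refine MeasurableSet.union (MeasurableSet.inter (h2 hs1) ?_) ?_
    · exact MeasurableSpace.measurableSet_generateFrom isOpen_range_inl
    · exact MeasurableSpace.measurableSet_generateFrom
        (isOpenMap_inr _ (isOpen_discrete _))
  · refine MeasurableSpace.generateFrom_le fun s hs => ?_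
    obtain ⟨h1, h2⟩ := isOpen_sum_iff.1 hs
    exact measurableSet_sum_iff.2 ⟨h1.measurableSet, h2.measurableSet⟩

section Transition

variable {U M Ω : Type*} [NormedAddCommGroup U] [NormedSpace ℝ U] [MetricSpace M]
  [MeasurableSpace Ω] [MeasurableSpace U] [BorelSpace U]
  [SecondCountableTopology M] [MeasurableSpace M] [BorelSpace M]
  {Φ : ℝ → ℝ → U ⊕ Unit → M → U ⊕ Unit} {P : Measure Ω} {ξξ : Ω → M}

/-- Continuous on the open set of survival and constant on its complement. -/
theorem IsRegularFlow.measurable_flow (hΦ : IsRegularFlow Φ) :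
    Measurable fun x : (U ⊕ Unit) × M => Φ 0 1 x.1 x.2 := by
  classical
  have : BorelSpace (U ⊕ Unit) := borelSpace_sum_unit
  have hc : Continuous fun x : (U ⊕ Unit) × M =>
      ((⟨(0, 1), le_rfl, zero_le_one, le_rfl⟩, x) : TimePair × (U ⊕ Unit) × M) :=
    continuous_const.prodMk continuous_id
  have hO : IsOpen {x : (U ⊕ Unit) × M | Φ 0 1 x.1 x.2 ≠ Sum.inr ()} :=
    hΦ.isOpen_alive.preimage hc
  have hF : ContinuousOn (fun x : (U ⊕ Unit) × M => Φ 0 1 x.1 x.2)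
      {x : (U ⊕ Unit) × M | Φ 0 1 x.1 x.2 ≠ Sum.inr ()} :=
    hΦ.continuousOn.comp hc.continuousOn fun x hx => hx
  have h1 := ContinuousOn.measurable_piecewise (g := fun _ => (Sum.inr () : U ⊕ Unit)) hF
    continuousOn_const hO.measurableSet
  convert h1 using 1
  ext1 x
  by_cases hx : x ∈ {x : (U ⊕ Unit) × M | Φ 0 1 x.1 x.2 ≠ Sum.inr ()}
  · rw [piecewise_eq_of_mem _ _ _ hx]
  · rw [piecewise_eq_of_notMem _ _ _ hx]
    exact not_not.1 hx

theorem measurable_transition [SFinite P] (hΦ : IsRegularFlow Φ) {ξ : Ω → M} (hξ : Measurable ξ) :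
    Measurable fun u : U ⊕ Unit => P.map fun ω => Φ 0 1 u (ξ ω) := by
  refine Measure.measurable_of_measurable_coe _ fun s hs => ?_
  have h1 : Measurable fun q : (U ⊕ Unit) × Ω => Φ 0 1 q.1 (ξ q.2) :=
    hΦ.measurable_flow.comp (measurable_fst.prodMk (hξ.comp measurable_snd))
  have h2 := measurable_measure_prodMk_left (ν := P) (h1 hs)
  convert h2 using 2 with u
  exact Measure.map_apply (h1.comp measurable_prodMk_left) hs

theorem IsInvariantMeasure.bind_eq [IsProbabilityMeasure P] (hΦ : IsRegularFlow Φ)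
    (hξξ : AEMeasurable ξξ P) {μ : Measure (U ⊕ Unit)} (hμ : IsInvariantMeasure P ξξ Φ μ) :
    μ.bind (fun u : U ⊕ Unit => P.map fun ω => Φ 0 1 u (hξξ.mk ξξ ω)) = μ := by
  have := hμ.isProbabilityMeasure
  have hκ := measurable_transition (P := P) hΦ hξξ.measurable_mk
  have hm : ∀ u : U ⊕ Unit, Measurable fun ω => Φ 0 1 u (hξξ.mk ξξ ω) := fun u =>
    hΦ.measurable_flow.comp (measurable_const.prodMk hξξ.measurable_mk)
  have : ∀ u : U ⊕ Unit, IsProbabilityMeasure (P.map fun ω => Φ 0 1 u (hξξ.mk ξξ ω)) := fun u =>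
    Measure.isProbabilityMeasure_map (hm u).aemeasurable
  refine Measure.ext fun s hs => ?_
  rw [Measure.bind_apply hs hκ.aemeasurable]
  have h1 := hμ.invariant (s.indicator 1) (measurable_one.indicator hs) ⟨1, fun u => by
    by_cases hu : u ∈ s <;> simp [hu]⟩
  have h2 : ∀ u, markovOp P ξξ Φ (s.indicator 1) u
      = (P.map fun ω => Φ 0 1 u (hξξ.mk ξξ ω)).real s := by
    intro u
    rw [markovOp, ← integral_indicator_one hs, integral_map (hm u).aemeasurable
      (measurable_one.indicator hs).aestronglyMeasurable]
    refine integral_congr_ae ?_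
    filter_upwards [hξξ.ae_eq_mk] with ω hω
    rw [hω]
  simp_rw [h2] at h1
  rw [integral_indicator_one hs] at h1
  simp only [measureReal_def] at h1
  replace h1 := (integral_toReal (μ := μ) ((Measure.measurable_coe hs).comp hκ).aemeasurable
    (Eventually.of_forall fun u => measure_lt_top _ _)).symm.trans h1
  refine (ENNReal.toReal_eq_toReal_iff' ?_ (measure_ne_top _ _)).1 h1
  refine ne_top_of_le_ne_top ENNReal.one_ne_top ?_
  calc ∫⁻ u, (P.map fun ω => Φ 0 1 u (hξξ.mk ξξ ω)) s ∂μ ≤ ∫⁻ _, 1 ∂μ :=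
        lintegral_mono fun u => prob_le_one
    _ = 1 := by simp

end Transition

theorem exists_measure_goodSet_ne_zero {Ω H₀ X U M : Type*}
    [NormedAddCommGroup Ω] [NormedSpace ℝ Ω] [MeasurableSpace Ω]
    [NormedAddCommGroup H₀] [InnerProductSpace ℝ H₀]
    [NormedAddCommGroup X] [NormedSpace ℝ X] {p : ℝ≥0∞} [Fact (1 ≤ p)]
    [NormedAddCommGroup U] [NormedSpace ℝ U] [MetricSpace M]
    {P : Measure Ω} {ι : NoiseSpace H₀ →L[ℝ] Ω} {hp : 2 < p} {j : X →L[ℝ] H₀} {ξξ : Ω → M}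
    {Φ : ℝ → ℝ → U ⊕ Unit → M → U ⊕ Unit} {r : ℝ → U → M → ℝ≥0∞}
    {τ : ShiftSpace X p → M → M} {A : ℝ → ℝ → U × M → U →L[ℝ] ShiftSpace X p}
    (hA : IsNoiseTransfer P ι ξξ Φ r τ A) (hΦ : IsRegularFlow Φ)
    (hτ : IsShiftAction hp P ι j ξξ Φ τ)
    (hpos : P {ω | Φ 0 1 (Sum.inl 0) (ξξ ω) ∈ range Sum.inl} ≠ 0) :
    ∃ m : ℕ, 0 < m ∧ P {ω | ξξ ω ∈ goodSet Φ τ A m} ≠ 0 := by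
  by_contra! h
  refine hpos (measure_mono_null (t := ⋃ m : ℕ, ⋃ _ : 0 < m, {ω | ξξ ω ∈ goodSet Φ τ A m})
    (fun ω hω => ?_) (measure_iUnion_null fun m => measure_iUnion_null fun hm => h m hm))
  obtain ⟨v, hv⟩ := hω
  have h1 : ((0 : U), ξξ ω) ∈ survival Φ 1 := by
    simp [survival, ← hv]
  obtain ⟨m, hm, hmem⟩ := hA.exists_mem_goodSet hΦ hτ h1
  exact mem_iUnion₂.2 ⟨m, hm, hmem⟩

end RandomDynamics

/-! ### Conclusion: uniqueness of the invariant measure -/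

open RandomDynamics in
theorem mainTheorem10
    {Ω H₀ X₀ U M : Type*}
    [NormedAddCommGroup Ω] [NormedSpace ℝ Ω] [CompleteSpace Ω]
    [TopologicalSpace.SeparableSpace Ω] [MeasurableSpace Ω] [BorelSpace Ω]
    [NormedAddCommGroup H₀] [InnerProductSpace ℝ H₀] [CompleteSpace H₀]
    [NormedAddCommGroup X₀] [NormedSpace ℝ X₀] [CompleteSpace X₀]
    [TopologicalSpace.SeparableSpace X₀]
    [NormedAddCommGroup U] [NormedSpace ℝ U] [CompleteSpace U]
    [TopologicalSpace.SeparableSpace U] [MeasurableSpace U] [BorelSpace U]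
    [MetricSpace M] [CompleteSpace M] [TopologicalSpace.SeparableSpace M]
    [MeasurableSpace M] [BorelSpace M]
    (P : Measure Ω) [IsGaussian P]
    (ι : RandomDynamics.NoiseSpace H₀ →L[ℝ] Ω) (hι : RandomDynamics.IsCameronMartin P ι)
    (j : X₀ →L[ℝ] H₀) (hj : Function.Injective j)
    (p : ℝ≥0∞) [Fact (1 ≤ p)] (hp : 2 < p) (hp_top : p < ∞)
    (ξξ : Ω → M) (hξξ : AEMeasurable ξξ P)
    (Φ : ℝ → ℝ → U ⊕ Unit → M → U ⊕ Unit)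
    (hΦ_consistent : RandomDynamics.IsConsistent Φ)
    (hΦ_regular : RandomDynamics.IsRegularFlow Φ)
    (r : ℝ → U → M → ℝ≥0∞) (hr : RandomDynamics.IsBlowUpGauge P ι ξξ Φ r)
    (τ : RandomDynamics.ShiftSpace X₀ p → M → M)
    (hτ : RandomDynamics.IsShiftAction hp P ι j ξξ Φ τ)
    (hτ_diff : RandomDynamics.IsShiftDifferentiable Φ τ)
    (A : ℝ → ℝ → U × M → U →L[ℝ] RandomDynamics.ShiftSpace X₀ p)
    (hA : RandomDynamics.IsNoiseTransfer P ι ξξ Φ r τ A)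
    (hpos : ∀ O : Set U, IsOpen O → O.Nonempty → ∀ u : U,
      0 < P {ω | Φ 0 1 (Sum.inl u) (ξξ ω) ∈ Sum.inl '' O}) :
    ∀ μ ν : Measure (U ⊕ Unit),
      RandomDynamics.IsInvariantMeasure P ξξ Φ μ → μ (range Sum.inl) = 1 →
      RandomDynamics.IsInvariantMeasure P ξξ Φ ν → ν (range Sum.inl) = 1 →
      μ = ν := by
  intro μ ν hμ hμ1 hν hν1
  have := hμ.isProbabilityMeasure
  have := hν.isProbabilityMeasure
  have : SecondCountableTopology Ω := UniformSpace.secondCountable_of_separable Ω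
  have : SecondCountableTopology X₀ := UniformSpace.secondCountable_of_separable X₀
  have : SecondCountableTopology U := UniformSpace.secondCountable_of_separable U
  have : SecondCountableTopology M := UniformSpace.secondCountable_of_separable M
  have : BorelSpace (U ⊕ Unit) := borelSpace_sum_unit
  by_contra hne
  obtain ⟨κ, hκdef⟩ : ∃ κ : U ⊕ Unit → Measure (U ⊕ Unit),
    κ = fun u => P.map fun ω => Φ 0 1 u (hξξ.mk ξξ ω) := ⟨_, rfl⟩
  have hκ : Measurable κ := hκdef ▸ measurable_transition hΦ_regular hξξ.measurable_mk
  have hm : ∀ u : U ⊕ Unit, Measurable fun ω => Φ 0 1 u (hξξ.mk ξξ ω) := fun u =>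
    hΦ_regular.measurable_flow.comp (measurable_const.prodMk hξξ.measurable_mk)
  have hκs : ∀ (u : U ⊕ Unit) (s : Set (U ⊕ Unit)), MeasurableSet s →
      κ u s = P {ω | Φ 0 1 u (ξξ ω) ∈ s} := by
    intro u s hs
    rw [hκdef, Measure.map_apply (hm u) hs]
    refine measure_congr ?_
    filter_upwards [hξξ.ae_eq_mk] with ω hω
    exact congrArg (fun ξ => Φ 0 1 u ξ ∈ s) hω.symm
  have : ∀ u, IsProbabilityMeasure (κ u) := fun u => by
    rw [hκdef]
    exact Measure.isProbabilityMeasure_map (hm u).aemeasurable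
  have hμκ : μ.bind κ = μ := hκdef ▸ hμ.bind_eq hΦ_regular hξξ
  have hνκ : ν.bind κ = ν := hκdef ▸ hν.bind_eq hΦ_regular hξξ
  obtain ⟨μ', ν', hμ0, hν0, hμle, hνle, hμ'κ, hν'κ, S, hS, hμS, hνS⟩ :=
    exists_mutuallySingular_invariant hκ hμκ hνκ hne
  -- Reaching the open set `univ` from `0` is survival from `0`, which therefore has positive
  -- probability.
  obtain ⟨m, hm0, hgood⟩ := exists_measure_goodSet_ne_zero hA hΦ_regular hτ (by
    have := hpos univ isOpen_univ univ_nonempty 0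
    rw [image_univ] at this
    exact this.ne')
  have hδ : 0 < 1 / (4 * (m : ℝ) ^ 2) := by positivity
  obtain ⟨V, hV⟩ : ∃ V : Set U, V = Metric.ball 0 (1 / (4 * (m : ℝ) ^ 2)) := ⟨_, rfl⟩
  have hVo : IsOpen V := hV ▸ Metric.isOpen_ball
  have hVn : V.Nonempty := ⟨0, hV ▸ Metric.mem_ball_self hδ⟩
  have hVle : ∀ u ∈ V, ‖u‖ ≤ 1 / (4 * (m : ℝ) ^ 2) := fun u hu => by
    rw [hV] at hu
    exact (mem_ball_zero_iff.1 hu).le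
  -- Irreducibility makes an invariant `ρ'` charge `V`, and invariance makes `κ y s = 0` for
  -- `ρ'`-almost every `y`; so some point of `V` qualifies. Mass on `U` is needed since
  -- irreducibility is assumed from points of `U` only.
  have hcharge : ∀ (ρ ρ' : Measure (U ⊕ Unit)), IsProbabilityMeasure ρ → ρ (range Sum.inl) = 1 →
      ρ' ≤ ρ → ρ' ≠ 0 → ρ'.bind κ = ρ' → ∀ s, MeasurableSet s → ρ' s = 0 →
      ∃ u ∈ V, κ (Sum.inl u) s = 0 := by
    intro ρ ρ' _ hρ1 hle h0 hinv s hs hs0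
    have hpos' : ∀ᵐ y ∂ρ', κ y (Sum.inl '' V) ≠ 0 := by
      have h1 : ∀ᵐ y ∂ρ, y ∈ range (Sum.inl : U → U ⊕ Unit) :=
        (prob_compl_eq_zero_iff measurableSet_range_inl).2 hρ1
      filter_upwards [Measure.absolutelyContinuous_of_le hle h1] with y hy
      obtain ⟨u, rfl⟩ := hy
      rw [hκs _ _ hVo.measurableSet.inl_image]
      exact (hpos V hVo hVn u).ne'
    have h2 := measure_ne_zero_of_bind_eq hκ h0 hinv hVo.measurableSet.inl_image hpos'
    have h3 := ae_eq_zero_of_bind_eq hκ hinv hs hs0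
    by_contra! hcon
    refine h2 (measure_mono_null (fun y hy => ?_) h3)
    obtain ⟨u, hu, rfl⟩ := hy
    exact hcon u hu
  obtain ⟨u, hu, huS⟩ := hcharge μ μ' ‹_› hμ1 hμle hμ0 hμ'κ S hS hμS
  obtain ⟨u', hu', huS'⟩ := hcharge ν ν' ‹_› hν1 hνle hν0 hν'κ Sᶜ hS.compl hνS
  -- Outer regularity bridges the open sets of the comparison and the measurable `Sᶜ`: from `u` the
  -- state is almost surely in `Sᶜ ⊆ O`, while from `u'` the set `O` has probability below `1/n`.
  -- For `n = 0` the inverse is `∞` and nothing is claimed.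
  have hle : ∀ n : ℕ, P {ω | ξξ ω ∈ goodSet Φ τ A m} ≤
      ENNReal.ofReal (Real.exp (2 * ‖j‖ ^ 2)) * ((n : ℝ≥0∞)⁻¹) ^ (1 / 2 : ℝ) := by
    intro n
    obtain ⟨O, hSO, hO, hOn⟩ := Set.exists_isOpen_lt_of_lt (μ := κ (Sum.inl u')) Sᶜ (n : ℝ≥0∞)⁻¹
      (by rw [huS']; exact ENNReal.inv_pos.2 (ENNReal.natCast_ne_top n))
    rw [hκs _ _ hO.measurableSet] at hOn
    have h1 := measure_goodSet_inter_le hA hΦ_consistent hΦ_regular hτ hτ_diff hι hp_top.ne hξξ hm0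
      (hVle u hu) (hVle u' hu') hO
    rw [hκs _ _ hS] at huS
    refine le_trans (measure_mono_ae ?_) (h1.trans (by gcongr))
    have h2 : ∀ᵐ ω ∂P, Φ 0 1 (Sum.inl u) (ξξ ω) ∉ S := by
      rw [ae_iff]
      simpa using huS
    filter_upwards [h2] with ω hω hωg
    exact ⟨hωg, hSO hω⟩
  have hlim : Tendsto (fun n : ℕ => ENNReal.ofReal (Real.exp (2 * ‖j‖ ^ 2)) *
      ((n : ℝ≥0∞)⁻¹) ^ (1 / 2 : ℝ)) atTop (𝓝 0) := by
    have h1 := (ENNReal.continuous_rpow_const (y := 1 / 2)).tendsto 0 |>.comp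
      ENNReal.tendsto_inv_nat_nhds_zero
    rw [ENNReal.zero_rpow_of_pos (by norm_num)] at h1
    have h2 := ENNReal.Tendsto.const_mul h1
      (Or.inr (ENNReal.ofReal_ne_top (r := Real.exp (2 * ‖j‖ ^ 2))))
    rw [mul_zero] at h2
    exact h2
  exact hgood (le_antisymm (ge_of_tendsto' hlim hle) zero_le)
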